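/- Let $d\ge 1$, $0<\alpha\le 1$, and let $\Omega\subset\mathbb R^{d+1}$ be a bounded domain with $C^{1,\alpha}$ boundary: near every boundary point, in suitable orthonormal coordinates, $\Omega$ is the region on one side of the graph of a $C^{1,\alpha}$ function of $d$ variables. Let $\sigma$ be the surface measure on $\partial\Omega$, $\nu_x$ the outward unit normal vector at $x\in\partial\Omega$, and $\omega_{d+1}$ the area of the unit sphere in $\mathbb R^{d+1}$. The Neumann–Poincaré operators on $\partial\Omega$ are $$\mathcal K[f](x)=-\frac1{\omega_{d+1}}\,\mathrm{p.v.}\!\int_{\partial\Omega}\frac{(x-y)\cdot\nu_y}{|x-y|^{d+1}}f(y)\,d\sigma(y),\qquad \mathcal K^*[f](x)=\frac1{\omega_{d+1}}\,\mathrm{p.v.}\!\int_{\partial\Omega}\frac{(x-y)\cdot\nu_x}{|x-y|^{d+1}}f(y)\,d\sigma(y),$$ where the principal value is the limit as $\varepsilon\to0^+$ of the integrals over $\{y\in\partial\Omega:|x-y|>\varepsilon\}$. Let $H^{1/2}(\partial\Omega)$ be the space of (real- or complex-valued) $f\in L^2(\partial\Omega)$ with $$\|f\|_{H^{1/2}}^2=\int_{\partial\Omega}|f|^2\,d\sigma+\int_{\partial\Omega\times\partial\Omega}\frac{|f(x)-f(y)|^2}{|x-y|^{1+d}}\,d\sigma(x)\,d\sigma(y)<\infty,$$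 and let $H^{-1/2}(\partial\Omega)$ be its dual space, with $g\in L^2(\partial\Omega)$ identified with the functional $f\mapsto\int_{\partial\Omega}gf\,d\sigma$. Then: 1. For every $f\in H^{1/2}(\partial\Omega)$ the principal value $\mathcal K[f](x)$ exists for $\sigma$-almost every $x$, $\mathcal K[f]$ belongs to $H^{1/2}(\partial\Omega)$, and $\mathcal K$ is a compact operator on $H^{1/2}(\partial\Omega)$. 2. For every $g\in L^2(\partial\Omega)$ the principal value $\mathcal K^*[g](x)$ exists for $\sigma$-almost every $x$ and defines a function in $L^2(\partial\Omega)$; the operator $\mathcal K^*$ extends from $L^2(\partial\Omega)$ to a bounded operator on $H^{-1/2}(\partial\Omega)$, which satisfies $\langle\mathcal K^*\varphi,f\rangle=\langle\varphi,\mathcal K f\rangle$ for all $\varphi\in H^{-1/2}(\partial\Omega)$ and $f\in H^{1/2}(\partial\Omega)$, and this operator is compact on $H^{-1/2}(\partial\Omega)$. -/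

import Mathlib

open MeasureTheory Filter Topology Set
open scoped ENNReal NNReal

noncomputable section

namespace NeumannPoincare

/-- The first `d` coordinates `x'` of a point `x = (x', x_{d+1})` of `ℝ^{d+1}`. -/
def headCoords {d : ℕ} (x : EuclideanSpace ℝ (Fin (d + 1))) : EuclideanSpace ℝ (Fin d) :=
  WithLp.toLp 2 (fun i => x i.castSucc)

/-- A bounded domain `Ω ⊂ ℝ^{d+1}` with `C^{1,α}` boundary: near every boundary point, in suitable
orthonormal coordinates, `Ω` is the region on one side of the graph of a `C^{1,α}` function. -/
structure C1HolderDomain (d : ℕ) (α : ℝ) where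
  carrier : Set (EuclideanSpace ℝ (Fin (d + 1)))
  isOpen : IsOpen carrier
  isConnected : IsConnected carrier
  isBounded : Bornology.IsBounded carrier
  boundary : ∀ p ∈ frontier carrier,
    ∃ (T : EuclideanSpace ℝ (Fin (d + 1)) ≃ₗᵢ[ℝ] EuclideanSpace ℝ (Fin (d + 1)))
      (g : EuclideanSpace ℝ (Fin d) → ℝ) (C r : ℝ),
      0 < r ∧ ContDiff ℝ 1 g ∧ (∀ u v, ‖fderiv ℝ g u - fderiv ℝ g v‖ ≤ C * ‖u - v‖ ^ α) ∧
      ∀ x ∈ Metric.ball p r, (x ∈ carrier ↔ g (headCoords (T x)) < T x (Fin.last d))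

/-- `v` is the outward unit normal vector of `Ω` at the boundary point `x`: a unit vector such that,
up to sets that are thin near `x`, the set `Ω` lies near `x` on the side `(y - x) · v < 0` of the
hyperplane through `x` orthogonal to `v`, and its complement on the other side. -/
def IsOutwardUnitNormal {E : Type*} [NormedAddCommGroup E] [InnerProductSpace ℝ E]
    (Ω : Set E) (x v : E) : Prop :=
  ‖v‖ = 1 ∧ ∀ ε > 0, ∀ᶠ y in 𝓝 x,
    (inner ℝ (y - x) v < -(ε * ‖y - x‖) → y ∈ Ω) ∧ (ε * ‖y - x‖ < inner ℝ (y - x) v → y ∉ Ω)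

open Classical in
/-- The outward unit normal vector at `x` (with the value `0` where there is none). -/
def outwardNormal {E : Type*} [NormedAddCommGroup E] [InnerProductSpace ℝ E] (Ω : Set E) (x : E) :
    E :=
  if h : ∃ v, IsOutwardUnitNormal Ω x v then h.choose else 0

/-- A set has at most one outward unit normal vector at a point, so that the choice made in
`outwardNormal` is irrelevant. -/
theorem IsOutwardUnitNormal.unique {E : Type*} [NormedAddCommGroup E] [InnerProductSpace ℝ E]
    {Ω : Set E} {x v w : E} (hv : IsOutwardUnitNormal Ω x v) (hw : IsOutwardUnitNormal Ω x w) :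
    v = w := by
  by_contra hne
  have hlt : inner ℝ v w < 1 := (inner_lt_one_iff_real_of_norm_eq_one hv.1 hw.1).2 hne
  set u := w - v with hu
  have hu0 : 0 < ‖u‖ := norm_pos_iff.2 (sub_ne_zero.2 (Ne.symm hne))
  have huv : inner ℝ u v = inner ℝ v w - 1 := by
    rw [hu, inner_sub_left, real_inner_self_eq_norm_sq, hv.1, real_inner_comm]; norm_num
  have huw : inner ℝ u w = 1 - inner ℝ v w := by
    rw [hu, inner_sub_left, real_inner_self_eq_norm_sq, hw.1]; norm_num
  set ε := (1 - inner ℝ v w) / (2 * ‖u‖) with hε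
  have hεpos : 0 < ε := by rw [hε]; apply div_pos <;> linarith
  have hεu : ε * ‖u‖ = (1 - inner ℝ v w) / 2 := by rw [hε]; field_simp
  have hcont : Tendsto (fun t : ℝ => x + t • u) (𝓝[>] 0) (𝓝 x) := by
    have : Tendsto (fun t : ℝ => x + t • u) (𝓝 0) (𝓝 (x + (0 : ℝ) • u)) := by
      apply Continuous.tendsto; fun_prop
    rw [zero_smul, add_zero] at this
    exact this.mono_left nhdsWithin_le_nhds
  obtain ⟨t, ⟨ht1, ht2⟩, ht0⟩ := ((hcont.eventually ((hv.2 ε hεpos).and (hw.2 ε hεpos))).and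
    self_mem_nhdsWithin).exists
  have ht : (0 : ℝ) < t := ht0
  have e : x + t • u - x = t • u := by abel
  have hn : ‖t • u‖ = t * ‖u‖ := by rw [norm_smul, Real.norm_of_nonneg ht.le]
  rw [e, hn, real_inner_smul_left, huv] at ht1
  rw [e, hn, real_inner_smul_left, huw] at ht2
  have h1 : ε * (t * ‖u‖) = t * ((1 - inner ℝ v w) / 2) := by rw [← hεu]; ring
  rw [h1] at ht1 ht2
  exact ht2.2 (by nlinarith) (ht1.1 (by nlinarith))

namespace C1HolderDomain

variable {d : ℕ} {α : ℝ} (D : C1HolderDomain d α)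

/-- The surface measure `σ` of `∂Ω`, as a measure on `ℝ^{d+1}` concentrated on `∂Ω`. -/
def surfaceMeasure : Measure (EuclideanSpace ℝ (Fin (d + 1))) :=
  (Measure.euclideanHausdorffMeasure d).restrict (frontier D.carrier)

instance : IsFiniteMeasure D.surfaceMeasure := by
  have hcomp : IsCompact (frontier D.carrier) :=
    Metric.isCompact_of_isClosed_isBounded isClosed_frontier
      (D.isBounded.closure.subset frontier_subset_closure)
  have key : (Measure.euclideanHausdorffMeasure d :
      Measure (EuclideanSpace ℝ (Fin (d + 1)))) (frontier D.carrier) < ∞ := by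
    apply hcomp.measure_lt_top_of_nhdsWithin
    intro p hp
    obtain ⟨T, g, C, r, hr, hg, -, hΩ⟩ := D.boundary p hp
    have hhead : Continuous (fun x => headCoords (T x)) := by
      unfold headCoords; fun_prop
    have hlast : Continuous (fun x => T x (Fin.last d)) := by fun_prop
    have hgc : Continuous (fun x => g (headCoords (T x))) := hg.continuous.comp hhead
    have hgraph : ∀ x ∈ frontier D.carrier ∩ Metric.ball p r,
        g (headCoords (T x)) = T x (Fin.last d) := by
      rintro x ⟨hx, hxr⟩
      have hnot : x ∉ D.carrier := by
        intro h
        rw [D.isOpen.frontier_eq] at hx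
        exact hx.2 h
      have hle : T x (Fin.last d) ≤ g (headCoords (T x)) := by
        by_contra h
        exact hnot ((hΩ x hxr).2 (not_le.1 h))
      refine le_antisymm ?_ hle
      by_contra h
      have hopen : {y | T y (Fin.last d) < g (headCoords (T y))} ∩ Metric.ball p r ∈ 𝓝 x :=
        ((isOpen_lt hlast hgc).inter Metric.isOpen_ball).mem_nhds ⟨not_le.1 h, hxr⟩
      obtain ⟨y, hy, hyΩ⟩ := mem_closure_iff_nhds.1 (frontier_subset_closure hx) _ hopen
      exact lt_asymm hy.1 ((hΩ y hy.2).1 hyΩ)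
    let Φ : EuclideanSpace ℝ (Fin d) → EuclideanSpace ℝ (Fin (d + 1)) :=
      fun u => T.symm (WithLp.toLp 2 (Fin.snoc (α := fun _ => ℝ) (fun i => u i) (g u)))
    have hΦ : ContDiff ℝ 1 Φ := by
      apply T.symm.contDiff.comp
      rw [contDiff_euclidean]
      intro i
      refine Fin.lastCases ?_ (fun j => ?_) i
      · simpa using hg
      · simp only [Fin.snoc_castSucc]; fun_prop
    obtain ⟨K, t, ht, hL⟩ := (hΦ.contDiffAt (x := headCoords (T p))).exists_lipschitzOnWith
    let t' := t ∩ Metric.ball (headCoords (T p)) 1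
    have ht' : t' ∈ 𝓝 (headCoords (T p)) := inter_mem ht (Metric.ball_mem_nhds _ one_pos)
    refine ⟨frontier D.carrier ∩ (Metric.ball p r ∩ (fun x => headCoords (T x)) ⁻¹' t'), ?_, ?_⟩
    · exact inter_mem self_mem_nhdsWithin (nhdsWithin_le_nhds
        (inter_mem (Metric.ball_mem_nhds _ hr) (hhead.continuousAt ht')))
    · have hsub : frontier D.carrier ∩ (Metric.ball p r ∩ (fun x => headCoords (T x)) ⁻¹' t') ⊆
          Φ '' t' := by
        rintro x ⟨hx, hxr, hxt⟩
        refine ⟨headCoords (T x), hxt, ?_⟩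
        have hgx := hgraph x ⟨hx, hxr⟩
        apply T.injective
        simp only [Φ, LinearIsometryEquiv.apply_symm_apply]
        ext i
        refine Fin.lastCases ?_ (fun j => ?_) i
        · simpa using hgx
        · simp [headCoords]
      refine (measure_mono hsub).trans_lt ?_
      rw [Measure.euclideanHausdorffMeasure_def, Measure.smul_apply, ENNReal.smul_def, smul_eq_mul]
      refine ENNReal.mul_lt_top ENNReal.coe_lt_top (lt_of_le_of_lt
        ((hL.mono inter_subset_left).hausdorffMeasure_image_le d.cast_nonneg) ?_)
      refine ENNReal.mul_lt_top (ENNReal.rpow_lt_top_of_nonneg d.cast_nonneg ENNReal.coe_ne_top) ?_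
      exact (measure_mono inter_subset_right).trans_lt measure_ball_lt_top
  exact ⟨by simpa [surfaceMeasure] using key⟩

/-- The outward unit normal vector `ν_x` of `Ω` at `x`. -/
def normal (x : EuclideanSpace ℝ (Fin (d + 1))) : EuclideanSpace ℝ (Fin (d + 1)) :=
  outwardNormal D.carrier x

variable (𝕜 : Type*) [RCLike 𝕜]

/-- `L²(∂Ω)`. -/
abbrev L2 : Type _ := Lp 𝕜 2 D.surfaceMeasure

variable {𝕜}

/-- The quotient `(f(x) - f(y)) / |x - y|^{(d+1)/2}`, as a function of `(x, y)`; the square of its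
modulus is `|f(x) - f(y)|² / |x - y|^{2 · (1/2) + d}`. -/
def diffQuotient {d : ℕ} (f : EuclideanSpace ℝ (Fin (d + 1)) → 𝕜)
    (z : EuclideanSpace ℝ (Fin (d + 1)) × EuclideanSpace ℝ (Fin (d + 1))) : 𝕜 :=
  (√(‖z.1 - z.2‖ ^ (d + 1)))⁻¹ • (f z.1 - f z.2)

theorem diffQuotient_congr {f g : EuclideanSpace ℝ (Fin (d + 1)) → 𝕜}
    (h : f =ᵐ[D.surfaceMeasure] g) :
    diffQuotient f =ᵐ[D.surfaceMeasure.prod D.surfaceMeasure] diffQuotient g := by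
  have h1 := Measure.quasiMeasurePreserving_fst (μ := D.surfaceMeasure) (ν := D.surfaceMeasure)
    |>.ae_eq_comp h
  have h2 := Measure.quasiMeasurePreserving_snd (μ := D.surfaceMeasure) (ν := D.surfaceMeasure)
    |>.ae_eq_comp h
  filter_upwards [h1, h2] with z hz1 hz2
  simp only [Function.comp_apply] at hz1 hz2
  simp only [diffQuotient, hz1, hz2]

theorem diffQuotient_add (f g : EuclideanSpace ℝ (Fin (d + 1)) → 𝕜) :
    diffQuotient (f + g) = diffQuotient f + diffQuotient g := by
  ext z
  simp only [diffQuotient, Pi.add_apply, ← smul_add]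
  congr 1; ring

theorem diffQuotient_smul (c : 𝕜) (f : EuclideanSpace ℝ (Fin (d + 1)) → 𝕜) :
    diffQuotient (c • f) = c • diffQuotient f := by
  ext z
  simp only [diffQuotient, Pi.smul_apply, ← smul_sub]
  rw [smul_comm]

theorem diffQuotient_add_ae (f g : D.L2 𝕜) :
    diffQuotient ⇑(f + g) =ᵐ[D.surfaceMeasure.prod D.surfaceMeasure]
      diffQuotient ⇑f + diffQuotient ⇑g :=
  (D.diffQuotient_congr (Lp.coeFn_add f g)).trans (diffQuotient_add _ _).eventuallyEq

theorem diffQuotient_smul_ae (c : 𝕜) (f : D.L2 𝕜) :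
    diffQuotient ⇑(c • f) =ᵐ[D.surfaceMeasure.prod D.surfaceMeasure] c • diffQuotient ⇑f :=
  (D.diffQuotient_congr (Lp.coeFn_smul c f)).trans (diffQuotient_smul _ _).eventuallyEq

variable (𝕜)

/-- The functions of `L²(∂Ω)` with
`∬ |f(x) - f(y)|² / |x - y|^{1 + d} dσ(x) dσ(y) < ∞`. -/
def sobolevHalfSubmodule : Submodule 𝕜 (D.L2 𝕜) where
  carrier := {f | MemLp (diffQuotient ⇑f) 2 (D.surfaceMeasure.prod D.surfaceMeasure)}
  zero_mem' := by
    have h : diffQuotient ⇑(0 : D.L2 𝕜) =ᵐ[D.surfaceMeasure.prod D.surfaceMeasure] 0 := by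
      refine (D.diffQuotient_congr (Lp.coeFn_zero 𝕜 2 D.surfaceMeasure)).trans ?_
      refine Eventually.of_forall fun z => ?_
      simp [diffQuotient]
    exact (memLp_congr_ae h).2 MemLp.zero
  add_mem' {f g} hf hg := (memLp_congr_ae (D.diffQuotient_add_ae f g)).2 (hf.add hg)
  smul_mem' c f hf := (memLp_congr_ae (D.diffQuotient_smul_ae c f)).2 (hf.const_smul c)

/-- The Sobolev space `H^{1/2}(∂Ω)`, normed in `norm_sq_eq` below. -/
def SobolevHalf : Type _ := D.sobolevHalfSubmodule 𝕜

namespace SobolevHalf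

instance : AddCommGroup (D.SobolevHalf 𝕜) :=
  inferInstanceAs (AddCommGroup (D.sobolevHalfSubmodule 𝕜))

instance : Module 𝕜 (D.SobolevHalf 𝕜) :=
  inferInstanceAs (Module 𝕜 (D.sobolevHalfSubmodule 𝕜))

/-- The inclusion of `H^{1/2}(∂Ω)` in `L²(∂Ω)`. -/
def toL2ₗ : D.SobolevHalf 𝕜 →ₗ[𝕜] D.L2 𝕜 := (D.sobolevHalfSubmodule 𝕜).subtype

/-- `f ↦ (f, (f(x) - f(y)) / |x - y|^{(d+1)/2})`, from which `H^{1/2}(∂Ω)` takes its norm. -/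
def graphMap : D.SobolevHalf 𝕜 →ₗ[𝕜]
    WithLp 2 (D.L2 𝕜 × Lp 𝕜 2 (D.surfaceMeasure.prod D.surfaceMeasure)) where
  toFun f := WithLp.toLp 2 (f.1, MemLp.toLp (diffQuotient ⇑f.1) f.2)
  map_add' f g := by
    apply WithLp.ofLp_injective
    refine Prod.ext rfl ?_
    exact ((MemLp.toLp_eq_toLp_iff (f + g).2 (f.2.add g.2)).2
      (D.diffQuotient_add_ae f.1 g.1)).trans
      (MemLp.toLp_add f.2 g.2)
  map_smul' c f := by
    apply WithLp.ofLp_injective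
    refine Prod.ext rfl ?_
    exact ((MemLp.toLp_eq_toLp_iff (c • f).2 (f.2.const_smul c)).2
      (D.diffQuotient_smul_ae c f.1)).trans
      (MemLp.toLp_const_smul c f.2)

theorem graphMap_injective : Function.Injective (graphMap D 𝕜) := fun _ _ h =>
  Subtype.ext (congrArg (fun z => (WithLp.ofLp z).1) h)

instance : NormedAddCommGroup (D.SobolevHalf 𝕜) :=
  NormedAddCommGroup.induced _ _ (graphMap D 𝕜) (graphMap_injective D 𝕜)

instance : NormedSpace 𝕜 (D.SobolevHalf 𝕜) :=
  NormedSpace.induced 𝕜 _ _ (graphMap D 𝕜)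

/-- The norm of `H^{1/2}(∂Ω)`. -/
theorem norm_sq_eq (f : D.SobolevHalf 𝕜) :
    ‖f‖ ^ 2 = ∫ x, ‖toL2ₗ D 𝕜 f x‖ ^ 2 ∂D.surfaceMeasure +
      ∫ z, ‖toL2ₗ D 𝕜 f z.1 - toL2ₗ D 𝕜 f z.2‖ ^ 2 / ‖z.1 - z.2‖ ^ (d + 1)
        ∂(D.surfaceMeasure.prod D.surfaceMeasure) := by
  have hL2 : ∀ {X : Type _} [MeasurableSpace X] (μ : Measure X) (h : Lp 𝕜 2 μ),
      ‖h‖ ^ 2 = ∫ x, ‖h x‖ ^ 2 ∂μ := by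
    intro X _ μ h
    have h1 := L2.inner_def (𝕜 := 𝕜) h h
    rw [inner_self_eq_norm_sq_to_K] at h1
    simp only [inner_self_eq_norm_sq_to_K] at h1
    norm_cast at h1
  have h0 : ‖f‖ = ‖graphMap D 𝕜 f‖ := rfl
  rw [h0, WithLp.prod_norm_sq_eq_of_L2, hL2, hL2]
  congr 1
  refine integral_congr_ae ?_
  filter_upwards [MemLp.coeFn_toLp f.2] with z hz
  change ‖(MemLp.toLp (diffQuotient ⇑f.1) f.2) z‖ ^ 2 = _
  rw [hz, diffQuotient, norm_smul, mul_pow, norm_inv, Real.norm_of_nonneg (Real.sqrt_nonneg _),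
    inv_pow, Real.sq_sqrt (by positivity), div_eq_inv_mul]
  rfl

/-- The inclusion of `H^{1/2}(∂Ω)` in `L²(∂Ω)` as a bounded operator. -/
def toL2 : D.SobolevHalf 𝕜 →L[𝕜] D.L2 𝕜 :=
  (toL2ₗ D 𝕜).mkContinuous 1 fun f => by
    rw [one_mul]
    have h0 : ‖f‖ = ‖graphMap D 𝕜 f‖ := rfl
    have h1 := WithLp.prod_norm_sq_eq_of_L2 (graphMap D 𝕜 f)
    have h2 : (graphMap D 𝕜 f).fst = toL2ₗ D 𝕜 f := rfl
    rw [h2] at h1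
    rw [h0]
    exact le_of_sq_le_sq (by nlinarith [sq_nonneg ‖(graphMap D 𝕜 f).snd‖]) (norm_nonneg _)

end SobolevHalf

/-- The Sobolev space `H^{-1/2}(∂Ω)`: the dual space of `H^{1/2}(∂Ω)`. -/
abbrev SobolevNegHalf : Type _ := StrongDual 𝕜 (D.SobolevHalf 𝕜)

/-- The inclusion of `L²(∂Ω)` in `H^{-1/2}(∂Ω)`: the function `g` is identified with the functional
`f ↦ ∫ g f dσ`, see `ofL2_apply`. -/
def ofL2 (g : D.L2 𝕜) : D.SobolevNegHalf 𝕜 :=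
  ((ContinuousLinearMap.mul 𝕜 𝕜).lpPairing D.surfaceMeasure 2 2 g).comp (SobolevHalf.toL2 D 𝕜)

theorem ofL2_apply (g : D.L2 𝕜) (f : D.SobolevHalf 𝕜) :
    D.ofL2 𝕜 g f = ∫ x, g x * SobolevHalf.toL2 D 𝕜 f x ∂D.surfaceMeasure := by
  simp [ofL2, ContinuousLinearMap.lpPairing_eq_integral]

variable {𝕜}

/-- `v` is the Cauchy principal value `p.v. ∫_{∂Ω} F(y) dσ(y)` with respect to the point `x`:
the limit for `ε → 0` of the integrals over `|x - y| > ε`, all of which exist. -/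
def HasPrincipalValue (F : EuclideanSpace ℝ (Fin (d + 1)) → 𝕜)
    (x : EuclideanSpace ℝ (Fin (d + 1))) (v : 𝕜) : Prop :=
  (∀ ε > 0, IntegrableOn F {y | ε < ‖x - y‖} D.surfaceMeasure) ∧
    Tendsto (fun ε : ℝ => ∫ y in {y | ε < ‖x - y‖}, F y ∂D.surfaceMeasure) (𝓝[>] 0) (𝓝 v)

/-- The area `ω_{d+1}` of the unit sphere of `ℝ^{d+1}`. -/
def sphereArea (d : ℕ) : ℝ :=
  (Measure.euclideanHausdorffMeasure d).real
    (Metric.sphere (0 : EuclideanSpace ℝ (Fin (d + 1))) 1)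

/-- The kernel `-(x - y) · ν_y / (ω_{d+1} |x - y|^{d+1})` of the operator `K`. -/
def kernelK (x y : EuclideanSpace ℝ (Fin (d + 1))) : ℝ :=
  -(1 / sphereArea d * (inner ℝ (x - y) (D.normal y) / ‖x - y‖ ^ (d + 1)))

/-- The kernel `(x - y) · ν_x / (ω_{d+1} |x - y|^{d+1})` of the operator `K*`. -/
def kernelKStar (x y : EuclideanSpace ℝ (Fin (d + 1))) : ℝ :=
  1 / sphereArea d * (inner ℝ (x - y) (D.normal x) / ‖x - y‖ ^ (d + 1))

/-- `h = K[f]`: at almost every point of `∂Ω` the principal value that defines `K[f]` exists and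
equals `h`. -/
def IsK (f h : D.L2 𝕜) : Prop :=
  ∀ᵐ x ∂D.surfaceMeasure, D.HasPrincipalValue (fun y => D.kernelK x y • f y) x (h x)

/-- `h = K*[f]`: at almost every point of `∂Ω` the principal value that defines `K*[f]` exists and
equals `h`. -/
def IsKStar (f h : D.L2 𝕜) : Prop :=
  ∀ᵐ x ∂D.surfaceMeasure, D.HasPrincipalValue (fun y => D.kernelKStar x y • f y) x (h x)

end C1HolderDomain

end NeumannPoincare

end

/-!
The kernel `k(x, y)` of `K` is weakly singular: as `∂Ω` is of class `C^{1,α}`, it leaves its tangent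
plane at `y` by `O(|x - y|^{1+α})`, so that `|k(x, y)| ≤ B |x - y|^{α-d}`, while the surface measure
is Ahlfors regular of dimension `d`. Hence the principal values are absolutely convergent integrals
for almost every `x`, and by Schur's test `K` and `K*` are bounded on `L²`, where Fubini's theorem
makes them transposes of each other.

That `K` acts on `H^{1/2}` rests on a further cancellation: `K` maps constants to constants, that is,
`∫ k(x, y) dσ(y)` is the same for all `x ∈ ∂Ω` (`exists_integral_kernelK_eq`). This is the solid angle
under which `Ω` is seen from `x`. The Gauss–Green formula `C1HolderDomain.gaussGreen` is applied to the
field `(y - x) (|y - x|² + ε²)^{-(d+1)/2}`, which is smooth, so that no neighbourhood of `x` has to be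
removed. After the rescaling `y = x + ε z` the volume integral is that of a fixed integrable even
function of `z` over the blow-up of `Ω` at `x`, and for `ε → 0` this set tends to a half space. The
Gauss–Green formula itself is proved from the definition of the surface measure as a Hausdorff
measure, by way of the area formula for graphs.

Consequently `K f(x) - K f(t)` is the integral of `(k(x, y) - k(t, y)) (f(y) - f(x))`. The integral is
split according to whether `|x - y|` is large compared with `|x - t|`; where it is, the Hölder
continuity of the normal vector gives `|k(x, y) - k(t, y)| ≤ B |x - t| |x - y|^{α-d-1}`. Weighted
Schur tests then bound the `H^{1/2}` seminorm of `K f` by the double integral of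
`|x - y|^{2α-d-1} |f(x) - f(y)|²` (`IsDoubleLayerKernel.exists_seminorm_le`). Its weight is weaker than
that of the `H^{1/2}` seminorm, so for each `ε > 0` there is a constant `C` with
`‖K f‖ ≤ ε ‖f‖ + C ‖f‖_{L²}` in `H^{1/2}`.

The `L²` norm is in turn at most `ε ‖f‖` plus a multiple of the largest of finitely many averages of
`f` over small balls (`isFinitelyControlled_toL2`). So `K f` is controlled by finitely many functionals
up to a small multiple of `‖f‖`, and `K` is compact because `H^{1/2}` is complete. The operator on
`H^{-1/2}` is the transpose of `K`, compact by Schauder's theorem, and it extends `K*` by the duality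
on `L²`.
-/

set_option linter.unusedSectionVars false

noncomputable section

namespace NeumannPoincare

/-! ### Integrals of powers of the distance against an Ahlfors regular measure -/

section PowerIntegrals

variable {E : Type*} [NormedAddCommGroup E]

/-- The weight `|x - y| ^ γ` as an extended nonnegative real. On the diagonal it takes the value
`0 ^ γ` of `Real.rpow`, which is `0` as soon as `γ ≠ 0`. -/
def distPow (γ : ℝ) (x y : E) : ℝ≥0∞ := ENNReal.ofReal (‖x - y‖ ^ γ)

theorem distPow_comm (γ : ℝ) (x y : E) : distPow γ x y = distPow γ y x := by
  rw [distPow, distPow, norm_sub_rev]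

theorem distPow_mul {x y : E} (h : x ≠ y) (γ δ : ℝ) :
    distPow γ x y * distPow δ x y = distPow (γ + δ) x y := by
  have : 0 < ‖x - y‖ := norm_pos_iff.2 (sub_ne_zero.2 h)
  rw [distPow, distPow, distPow, ← ENNReal.ofReal_mul (by positivity), Real.rpow_add this]

theorem distPow_sq (γ : ℝ) (x y : E) : distPow γ x y ^ 2 = distPow (2 * γ) x y := by
  rw [distPow, distPow, ← ENNReal.ofReal_pow (by positivity), ← Real.rpow_natCast,
    ← Real.rpow_mul (norm_nonneg _)]
  congr 2; push_cast; ring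

variable [MeasurableSpace E] [BorelSpace E] [SecondCountableTopology E]

theorem measurable_distPow (γ : ℝ) : Measurable (fun z : E × E => distPow γ z.1 z.2) := by
  unfold distPow; fun_prop

@[fun_prop]
theorem Measurable.distPow {X : Type*} [MeasurableSpace X] {γ : ℝ} {f g : X → E}
    (hf : Measurable f) (hg : Measurable g) : Measurable (fun z => distPow γ (f z) (g z)) :=
  (measurable_distPow γ).comp (hf.prodMk hg)

/-- `μ` is upper Ahlfors regular of dimension `d` with constant `A` at the point `x`. -/
def UpperRegularAt (μ : Measure E) (d : ℕ) (A : ℝ) (x : E) : Prop :=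
  ∀ ρ > 0, μ (Metric.closedBall x ρ) ≤ ENNReal.ofReal (A * ρ ^ d)

variable {μ : Measure E} {d : ℕ} {A : ℝ} {x : E}

theorem UpperRegularAt.measure_singleton (h : UpperRegularAt μ d A x) (hd : 1 ≤ d) :
    μ {x} = 0 := by
  have hlim : Tendsto (fun ρ : ℝ => ENNReal.ofReal (A * ρ ^ d)) (𝓝[>] 0) (𝓝 0) := by
    have : Tendsto (fun ρ : ℝ => ENNReal.ofReal (A * ρ ^ d)) (𝓝 0)
        (𝓝 (ENNReal.ofReal (A * (0 : ℝ) ^ d))) := by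
      exact (ENNReal.continuous_ofReal.comp (by fun_prop)).tendsto _
    rw [zero_pow (by omega), mul_zero, ENNReal.ofReal_zero] at this
    exact this.mono_left nhdsWithin_le_nhds
  refine le_antisymm (ge_of_tendsto hlim ?_) zero_le
  filter_upwards [self_mem_nhdsWithin] with ρ (hρ : 0 < ρ)
  exact (measure_mono (by simpa using hρ.le)).trans (h ρ hρ)

/-- On a dyadic annulus `|x - y| ^ (γ - d)` is of order `s ^ (γ - d)`, and the measure of the annulus
is at most of order `s ^ d`. -/
theorem UpperRegularAt.lintegral_annulus_le (h : UpperRegularAt μ d A x) (γ : ℝ)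
    {s : ℝ} (hs : 0 < s) :
    ∫⁻ y in {y | s ≤ ‖x - y‖ ∧ ‖x - y‖ ≤ 2 * s}, distPow (γ - d) x y ∂μ ≤
      ENNReal.ofReal (A * 2 ^ d * 2 ^ |γ| * s ^ γ) := by
  have hsub : {y | s ≤ ‖x - y‖ ∧ ‖x - y‖ ≤ 2 * s} ⊆ Metric.closedBall x (2 * s) := by
    rintro y ⟨-, hy⟩
    rwa [Metric.mem_closedBall, dist_comm, dist_eq_norm]
  have hpt : ∀ y ∈ {y | s ≤ ‖x - y‖ ∧ ‖x - y‖ ≤ 2 * s},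
      distPow (γ - d) x y ≤ ENNReal.ofReal (2 ^ |γ| * s ^ γ * (s ^ d)⁻¹) := by
    rintro y ⟨h1, h2⟩
    have hr : 0 < ‖x - y‖ := hs.trans_le h1
    apply ENNReal.ofReal_le_ofReal
    rw [Real.rpow_sub hr, Real.rpow_natCast, div_eq_mul_inv]
    have h3 : ‖x - y‖ ^ γ ≤ 2 ^ |γ| * s ^ γ := by
      rcases le_total 0 γ with hγ | hγ
      · rw [abs_of_nonneg hγ, ← Real.mul_rpow (by norm_num) hs.le]
        exact Real.rpow_le_rpow hr.le h2 hγ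
      · calc ‖x - y‖ ^ γ ≤ s ^ γ := Real.rpow_le_rpow_of_nonpos hs h1 hγ
          _ = 1 * s ^ γ := (one_mul _).symm
          _ ≤ 2 ^ |γ| * s ^ γ := by
            gcongr
            exact Real.one_le_rpow (by norm_num) (abs_nonneg _)
    gcongr
  calc ∫⁻ y in {y | s ≤ ‖x - y‖ ∧ ‖x - y‖ ≤ 2 * s}, distPow (γ - d) x y ∂μ
      ≤ ∫⁻ y in {y | s ≤ ‖x - y‖ ∧ ‖x - y‖ ≤ 2 * s},
          ENNReal.ofReal (2 ^ |γ| * s ^ γ * (s ^ d)⁻¹) ∂μ := by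
        refine setLIntegral_mono measurable_const hpt
    _ = ENNReal.ofReal (2 ^ |γ| * s ^ γ * (s ^ d)⁻¹) *
          μ {y | s ≤ ‖x - y‖ ∧ ‖x - y‖ ≤ 2 * s} := by rw [setLIntegral_const]
    _ ≤ ENNReal.ofReal (2 ^ |γ| * s ^ γ * (s ^ d)⁻¹) * ENNReal.ofReal (A * (2 * s) ^ d) := by
        gcongr
        exact (measure_mono hsub).trans (h _ (by positivity))
    _ = ENNReal.ofReal (A * 2 ^ d * 2 ^ |γ| * s ^ γ) := by
        rw [← ENNReal.ofReal_mul (by positivity)]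
        congr 1
        rw [mul_pow]
        field_simp

theorem ofReal_tsum_geometric {q B : ℝ} (hq0 : 0 ≤ q) (hq : q < 1) (hB : 0 ≤ B) :
    ∑' n : ℕ, ENNReal.ofReal (B * q ^ n) = ENNReal.ofReal (B * (1 - q)⁻¹) := by
  rw [← ENNReal.ofReal_tsum_of_nonneg (fun n => by positivity)
    ((summable_geometric_of_lt_one hq0 hq).mul_left B), tsum_mul_left,
    tsum_geometric_of_lt_one hq0 hq]

/-- The integral of `|x - y| ^ (β - d)` over a ball of radius `ρ` about `x` is of order `ρ ^ β`. -/
theorem exists_lintegral_near_le (d : ℕ) (hd : 1 ≤ d) (A : ℝ) (hA : 0 ≤ A) {β : ℝ} (hβ : 0 < β) :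
    ∃ C : ℝ, 0 ≤ C ∧ ∀ (μ : Measure E) (x : E), UpperRegularAt μ d A x → ∀ ρ > 0,
      ∫⁻ y in {y | ‖x - y‖ < ρ}, distPow (β - d) x y ∂μ ≤ ENNReal.ofReal (C * ρ ^ β) := by
  set q : ℝ := (2⁻¹ : ℝ) ^ β with hq
  have hq0 : 0 ≤ q := by positivity
  have hq1 : q < 1 := Real.rpow_lt_one (by norm_num) (by norm_num) hβ
  refine ⟨A * 2 ^ d * 2 ^ |β| * q * (1 - q)⁻¹, ?_, fun μ x h ρ hρ => ?_⟩
  · have : 0 ≤ (1 - q)⁻¹ := inv_nonneg.2 (by linarith)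
    positivity
  set s : ℕ → ℝ := fun n => (2⁻¹ : ℝ) ^ (n + 1) * ρ with hs
  have hspos : ∀ n, 0 < s n := fun n => by positivity
  have hcover : {y | ‖x - y‖ < ρ} ⊆
      {x} ∪ ⋃ n, {y | s n ≤ ‖x - y‖ ∧ ‖x - y‖ ≤ 2 * s n} := by
    intro y (hy : ‖x - y‖ < ρ)
    by_cases hxy : x = y
    · left; exact hxy.symm
    right
    have hr : 0 < ‖x - y‖ := norm_pos_iff.2 (sub_ne_zero.2 hxy)
    obtain ⟨n, hn1, hn2⟩ := exists_nat_pow_near_of_lt_one (x := ‖x - y‖ / ρ) (y := (2⁻¹ : ℝ))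
      (by positivity) ((div_lt_one hρ).2 hy).le (by norm_num) (by norm_num)
    refine mem_iUnion.2 ⟨n, ?_, ?_⟩
    · exact ((lt_div_iff₀ hρ).1 hn1).le
    · have := (div_le_iff₀ hρ).1 hn2
      calc ‖x - y‖ ≤ (2⁻¹ : ℝ) ^ n * ρ := this
        _ = 2 * s n := by simp only [hs, pow_succ]; ring
  calc ∫⁻ y in {y | ‖x - y‖ < ρ}, distPow (β - d) x y ∂μ
      ≤ ∫⁻ y in {x} ∪ ⋃ n, {y | s n ≤ ‖x - y‖ ∧ ‖x - y‖ ≤ 2 * s n},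
          distPow (β - d) x y ∂μ := lintegral_mono_set hcover
    _ ≤ ∫⁻ y in {x}, distPow (β - d) x y ∂μ +
          ∫⁻ y in ⋃ n, {y | s n ≤ ‖x - y‖ ∧ ‖x - y‖ ≤ 2 * s n}, distPow (β - d) x y ∂μ :=
        lintegral_union_le _ _ _
    _ ≤ 0 + ∑' n, ∫⁻ y in {y | s n ≤ ‖x - y‖ ∧ ‖x - y‖ ≤ 2 * s n},
          distPow (β - d) x y ∂μ := by
        gcongr
        · rw [setLIntegral_measure_zero _ _ (h.measure_singleton hd)]
        · exact lintegral_iUnion_le _ _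
    _ ≤ ∑' n : ℕ, ENNReal.ofReal (A * 2 ^ d * 2 ^ |β| * q * ρ ^ β * q ^ n) := by
        rw [zero_add]
        refine ENNReal.tsum_le_tsum fun n => (h.lintegral_annulus_le β (hspos n)).trans_eq ?_
        congr 1
        simp only [hs, hq]
        rw [Real.mul_rpow (by positivity) hρ.le, ← Real.rpow_pow_comm (by norm_num), pow_succ]
        ring
    _ = ENNReal.ofReal (A * 2 ^ d * 2 ^ |β| * q * (1 - q)⁻¹ * ρ ^ β) := by
        rw [ofReal_tsum_geometric hq0 hq1 (by positivity)]
        congr 1; ring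

/-- The integral of `|x - y| ^ (-β - d)` outside the ball of radius `ρ` about `x` is of order
`ρ ^ (-β)`. -/
theorem exists_lintegral_far_le (d : ℕ) (A : ℝ) (hA : 0 ≤ A) {β : ℝ} (hβ : 0 < β) :
    ∃ C : ℝ, 0 ≤ C ∧ ∀ (μ : Measure E) (x : E), UpperRegularAt μ d A x → ∀ ρ > 0,
      ∫⁻ y in {y | ρ ≤ ‖x - y‖}, distPow (-β - d) x y ∂μ ≤ ENNReal.ofReal (C * ρ ^ (-β)) := by
  set q : ℝ := (2 : ℝ) ^ (-β) with hq
  have hq0 : 0 ≤ q := by positivity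
  have hq1 : q < 1 := Real.rpow_lt_one_of_one_lt_of_neg (by norm_num) (by linarith)
  refine ⟨A * 2 ^ d * 2 ^ |(-β)| * (1 - q)⁻¹, ?_, fun μ x h ρ hρ => ?_⟩
  · have : 0 ≤ (1 - q)⁻¹ := inv_nonneg.2 (by linarith)
    positivity
  set s : ℕ → ℝ := fun n => (2 : ℝ) ^ n * ρ with hs
  have hspos : ∀ n, 0 < s n := fun n => by positivity
  have hcover : {y | ρ ≤ ‖x - y‖} ⊆
      ⋃ n, {y | s n ≤ ‖x - y‖ ∧ ‖x - y‖ ≤ 2 * s n} := by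
    intro y (hy : ρ ≤ ‖x - y‖)
    obtain ⟨n, hn1, hn2⟩ := exists_nat_pow_near (x := ‖x - y‖ / ρ) (y := (2 : ℝ))
      ((one_le_div hρ).2 hy) (by norm_num)
    refine mem_iUnion.2 ⟨n, ?_, ?_⟩
    · exact (le_div_iff₀ hρ).1 hn1
    · have := (div_lt_iff₀ hρ).1 hn2
      calc ‖x - y‖ ≤ (2 : ℝ) ^ (n + 1) * ρ := this.le
        _ = 2 * s n := by simp only [hs, pow_succ]; ring
  calc ∫⁻ y in {y | ρ ≤ ‖x - y‖}, distPow (-β - d) x y ∂μ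
      ≤ ∫⁻ y in ⋃ n, {y | s n ≤ ‖x - y‖ ∧ ‖x - y‖ ≤ 2 * s n},
          distPow (-β - d) x y ∂μ := lintegral_mono_set hcover
    _ ≤ ∑' n, ∫⁻ y in {y | s n ≤ ‖x - y‖ ∧ ‖x - y‖ ≤ 2 * s n},
          distPow (-β - d) x y ∂μ := lintegral_iUnion_le _ _
    _ ≤ ∑' n : ℕ, ENNReal.ofReal (A * 2 ^ d * 2 ^ |(-β)| * ρ ^ (-β) * q ^ n) := by
        refine ENNReal.tsum_le_tsum fun n => (h.lintegral_annulus_le (-β) (hspos n)).trans_eq ?_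
        congr 1
        simp only [hs, hq]
        rw [Real.mul_rpow (by positivity) hρ.le, ← Real.rpow_pow_comm (by norm_num)]
        ring
    _ = ENNReal.ofReal (A * 2 ^ d * 2 ^ |(-β)| * (1 - q)⁻¹ * ρ ^ (-β)) := by
        rw [ofReal_tsum_geometric hq0 hq1 (by positivity)]
        congr 1; ring

end PowerIntegrals

/-! ### Weighted Cauchy–Schwarz inequalities -/

section WeightedCauchySchwarz

theorem sq_lintegral_mul_le {X : Type*} [MeasurableSpace X] {μ : Measure X} {f g : X → ℝ≥0∞}
    (hf : AEMeasurable f μ) (hg : AEMeasurable g μ) :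
    (∫⁻ y, f y * g y ∂μ) ^ 2 ≤ (∫⁻ y, f y ^ 2 ∂μ) * ∫⁻ y, g y ^ 2 ∂μ := by
  have h := ENNReal.lintegral_mul_le_Lp_mul_Lq μ Real.HolderConjugate.two_two hf hg
  simp only [Pi.mul_apply] at h
  calc (∫⁻ y, f y * g y ∂μ) ^ 2
      ≤ ((∫⁻ y, f y ^ (2 : ℝ) ∂μ) ^ (1 / 2 : ℝ) * (∫⁻ y, g y ^ (2 : ℝ) ∂μ) ^ (1 / 2 : ℝ)) ^ 2 := by
        gcongr
    _ = _ := by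
        rw [mul_pow, ← ENNReal.rpow_natCast, ← ENNReal.rpow_natCast, ← ENNReal.rpow_mul,
          ← ENNReal.rpow_mul]
        norm_num

/-- A Schur test: if `∫ p(t, y)² dy ≤ P(t)` and `∫ v(t) P(t) q(t, y)² dt ≤ Q(y)`, then the operator
with kernel `p q` maps `L²(Q)` to `L²(v)`. -/
theorem lintegral_weighted_sq_le {X Y : Type*} [MeasurableSpace X] [MeasurableSpace Y]
    {μ : Measure X} {ν : Measure Y} [SFinite μ] [SFinite ν] {v P : X → ℝ≥0∞} {p q : X → Y → ℝ≥0∞}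
    {G Q : Y → ℝ≥0∞} (hv : Measurable v) (hPm : Measurable P)
    (hp : Measurable (fun z : X × Y => p z.1 z.2))
    (hq : Measurable (fun z : X × Y => q z.1 z.2)) (hG : Measurable G)
    (hP : ∀ᵐ t ∂μ, ∫⁻ y, p t y ^ 2 ∂ν ≤ P t)
    (hQ : ∀ᵐ y ∂ν, ∫⁻ t, v t * P t * q t y ^ 2 ∂μ ≤ Q y) :
    ∫⁻ t, v t * (∫⁻ y, p t y * q t y * G y ∂ν) ^ 2 ∂μ ≤ ∫⁻ y, Q y * G y ^ 2 ∂ν := by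
  have hpt : ∀ t, Measurable (p t) := fun t => hp.comp measurable_prodMk_left
  have hqt : ∀ t, Measurable (q t) := fun t => hq.comp measurable_prodMk_left
  calc ∫⁻ t, v t * (∫⁻ y, p t y * q t y * G y ∂ν) ^ 2 ∂μ
      ≤ ∫⁻ t, ∫⁻ y, v t * P t * q t y ^ 2 * G y ^ 2 ∂ν ∂μ := by
        refine lintegral_mono_ae ?_
        filter_upwards [hP] with t ht
        have h1 : (∫⁻ y, p t y * q t y * G y ∂ν) ^ 2 ≤
            (∫⁻ y, p t y ^ 2 ∂ν) * ∫⁻ y, (q t y * G y) ^ 2 ∂ν := by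
          have := sq_lintegral_mul_le (μ := ν) (hpt t).aemeasurable ((hqt t).mul hG).aemeasurable
          simpa only [Pi.mul_apply, mul_assoc] using this
        calc v t * (∫⁻ y, p t y * q t y * G y ∂ν) ^ 2
            ≤ v t * (P t * ∫⁻ y, (q t y * G y) ^ 2 ∂ν) := by
              gcongr
              exact h1.trans (by gcongr)
          _ = ∫⁻ y, v t * P t * q t y ^ 2 * G y ^ 2 ∂ν := by
              have hm : Measurable (fun y => (q t y * G y) ^ 2) := ((hqt t).mul hG).pow_const 2
              rw [← mul_assoc, ← lintegral_const_mul _ hm]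
              refine lintegral_congr fun y => ?_
              ring
    _ = ∫⁻ y, ∫⁻ t, v t * P t * q t y ^ 2 * G y ^ 2 ∂μ ∂ν := by
        refine lintegral_lintegral_swap (Measurable.aemeasurable ?_)
        simp only [Function.uncurry_def]
        fun_prop
    _ ≤ ∫⁻ y, Q y * G y ^ 2 ∂ν := by
        refine lintegral_mono_ae ?_
        filter_upwards [hQ] with y hy
        rw [lintegral_mul_const]
        · gcongr
        · have : Measurable (fun t => q t y) := hq.comp measurable_prodMk_right
          fun_prop

end WeightedCauchySchwarz

/-! ### Schur tests for powers of the distance -/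

section LocalizedKernels

variable {E : Type*} [NormedAddCommGroup E] [MeasurableSpace E] [BorelSpace E]
  [SecondCountableTopology E]

/-- A weighted `L²` bound for an operator `G ↦ |x - t| ^ θ ∫ |x - y| ^ (π + κ) G(y) dy`, the
integral extending over the section `{y | (t, y) ∈ R}`; the two hypotheses are the Schur conditions
for the splitting `|x - y| ^ π · |x - y| ^ κ` of the kernel. -/
theorem lintegral_distPow_sq_le {μ : Measure E} [SFinite μ] {x : E} (hx : μ {x} = 0)
    {R : Set (E × E)} (hR : MeasurableSet R) {v θ π κ τ l : ℝ} {C₁ C₂ : ℝ≥0∞}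
    (h₁ : ∀ t ≠ x, ∫⁻ y in {y | (t, y) ∈ R}, distPow (2 * π) x y ∂μ ≤ C₁ * distPow τ x t)
    (h₂ : ∀ y ≠ x, ∫⁻ t in {t | (t, y) ∈ R}, distPow (v + 2 * θ + τ) x t ∂μ ≤ C₂ * distPow l x y)
    {G : E → ℝ≥0∞} (hG : Measurable G) :
    ∫⁻ t, distPow v x t *
        (∫⁻ y in {y | (t, y) ∈ R}, distPow θ x t * distPow (π + κ) x y * G y ∂μ) ^ 2 ∂μ ≤
      C₁ * C₂ * ∫⁻ y, distPow (l + 2 * κ) x y * G y ^ 2 ∂μ := by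
  have hne : ∀ᵐ y ∂μ, y ≠ x := by
    rw [ae_iff]; simpa using hx
  set χ : E → E → ℝ≥0∞ := fun t y => R.indicator 1 (t, y) with hχ
  have hχm : Measurable (fun z : E × E => χ z.1 z.2) := measurable_one.indicator hR
  have hχsq : ∀ t y, χ t y ^ 2 = χ t y := by
    intro t y
    by_cases h : (t, y) ∈ R <;> simp [hχ, h]
  have hsec : ∀ t, MeasurableSet {y | (t, y) ∈ R} := fun t => hR.preimage measurable_prodMk_left
  have hsec' : ∀ y, MeasurableSet {t | (t, y) ∈ R} := fun y => hR.preimage measurable_prodMk_right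
  have hset : ∀ t (F : E → ℝ≥0∞),
      ∫⁻ y in {y | (t, y) ∈ R}, F y ∂μ = ∫⁻ y, χ t y * F y ∂μ := by
    intro t F
    rw [← lintegral_indicator (hsec t)]
    refine lintegral_congr fun y => ?_
    by_cases h : (t, y) ∈ R <;> simp [hχ, h]
  have hset' : ∀ y (F : E → ℝ≥0∞),
      ∫⁻ t in {t | (t, y) ∈ R}, F t ∂μ = ∫⁻ t, χ t y * F t ∂μ := by
    intro y F
    rw [← lintegral_indicator (hsec' y)]
    refine lintegral_congr fun t => ?_
    by_cases h : (t, y) ∈ R <;> simp [hχ, h]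
  have key := lintegral_weighted_sq_le (μ := μ) (ν := μ) (v := fun t => distPow v x t)
    (P := fun t => C₁ * distPow (2 * θ + τ) x t)
    (p := fun t y => χ t y * distPow θ x t * distPow π x y)
    (q := fun t y => χ t y * distPow κ x y)
    (Q := fun y => C₁ * C₂ * distPow (l + 2 * κ) x y) (G := G)
    (by fun_prop) (by fun_prop) (by fun_prop) (by fun_prop) hG
    (by
      filter_upwards [hne] with t ht
      calc ∫⁻ y, (χ t y * distPow θ x t * distPow π x y) ^ 2 ∂μ
          = distPow (2 * θ) x t * ∫⁻ y in {y | (t, y) ∈ R}, distPow (2 * π) x y ∂μ := by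
            rw [hset, ← lintegral_const_mul]
            · refine lintegral_congr fun y => ?_
              rw [mul_pow, mul_pow, hχsq, distPow_sq, distPow_sq]; ring
            · have : Measurable (χ t) := hχm.comp measurable_prodMk_left
              fun_prop
        _ ≤ distPow (2 * θ) x t * (C₁ * distPow τ x t) := by gcongr; exact h₁ t ht
        _ = C₁ * distPow (2 * θ + τ) x t := by
            rw [← distPow_mul ht.symm (2 * θ) τ]; ring)
    (by
      filter_upwards [hne] with y hy
      calc ∫⁻ t, distPow v x t * (C₁ * distPow (2 * θ + τ) x t) * (χ t y * distPow κ x y) ^ 2 ∂μ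
          = ∫⁻ t, C₁ * distPow (2 * κ) x y * (χ t y * distPow (v + 2 * θ + τ) x t) ∂μ := by
            refine lintegral_congr_ae ?_
            filter_upwards [hne] with t ht
            rw [mul_pow, hχsq, distPow_sq, add_assoc, ← distPow_mul ht.symm v]; ring
        _ = C₁ * distPow (2 * κ) x y * ∫⁻ t in {t | (t, y) ∈ R}, distPow (v + 2 * θ + τ) x t ∂μ := by
            rw [hset', ← lintegral_const_mul]
            have : Measurable (fun t => χ t y) := hχm.comp measurable_prodMk_right
            fun_prop
        _ ≤ C₁ * distPow (2 * κ) x y * (C₂ * distPow l x y) := by gcongr; exact h₂ y hy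
        _ = C₁ * C₂ * distPow (l + 2 * κ) x y := by
            rw [← distPow_mul hy.symm l]; ring)
  calc _ = ∫⁻ t, distPow v x t * (∫⁻ y, χ t y * distPow θ x t * distPow π x y *
            (χ t y * distPow κ x y) * G y ∂μ) ^ 2 ∂μ := by
        refine lintegral_congr fun t => ?_
        congr 2
        rw [hset]
        refine lintegral_congr_ae ?_
        filter_upwards [hne] with y hy
        rw [← distPow_mul hy.symm π]
        nth_rewrite 1 [← hχsq]
        ring
    _ ≤ _ := key
    _ = _ := by
        rw [← lintegral_const_mul _ (by fun_prop)]
        refine lintegral_congr fun y => ?_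
        ring

/-- The far part of the difference `K f(x) - K f(t)`, in the weighted `L²` norm that defines the
`H^{1/2}` seminorm. -/
theorem exists_lintegral_far_sq_le (d : ℕ) (hd : 1 ≤ d) (A : ℝ) (hA : 0 ≤ A) (α : ℝ) :
    ∃ C : ℝ≥0∞, C ≠ ∞ ∧ ∀ (μ : Measure E) [SFinite μ] (x : E), UpperRegularAt μ d A x →
      ∀ G : E → ℝ≥0∞, Measurable G →
        ∫⁻ t, distPow (-(d + 1)) x t * (∫⁻ y in {y | 2 * ‖x - t‖ ≤ ‖x - y‖},
          distPow 1 x t * distPow (α - d - 1) x y * G y ∂μ) ^ 2 ∂μ ≤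
        C * ∫⁻ y, distPow (2 * α - d - 1) x y * G y ^ 2 ∂μ := by
  obtain ⟨C₁, hC₁, h₁⟩ := exists_lintegral_far_le (E := E) d A hA (β := 1 / 2) (by norm_num)
  obtain ⟨C₂, hC₂, h₂⟩ := exists_lintegral_near_le (E := E) d hd A hA (β := 1 / 2) (by norm_num)
  refine ⟨ENNReal.ofReal C₁ * ENNReal.ofReal C₂,
    ENNReal.mul_ne_top ENNReal.ofReal_ne_top ENNReal.ofReal_ne_top, fun μ _ x hx G hG => ?_⟩
  -- the exponent `α - d - 1` is split so that the integral in `y` converges at infinity and the one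
  -- in `t` at `x`, both with the power `1 / 2` to spare
  have key := lintegral_distPow_sq_le (μ := μ) (hx.measure_singleton hd)
    (R := {z | 2 * ‖x - z.1‖ ≤ ‖x - z.2‖}) (measurableSet_le (by fun_prop) (by fun_prop))
    (v := -(d + 1)) (θ := 1) (π := -d / 2 - 1 / 4) (κ := α - d / 2 - 3 / 4) (τ := -(1 / 2))
    (l := 1 / 2) (C₁ := ENNReal.ofReal C₁) (C₂ := ENNReal.ofReal C₂) ?_ ?_ hG
  · convert! key using 6 <;> ring_nf
  · intro t ht
    have hδ : 0 < ‖x - t‖ := norm_pos_iff.2 (sub_ne_zero.2 ht.symm)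
    calc _ = ∫⁻ y in {y | 2 * ‖x - t‖ ≤ ‖x - y‖}, distPow (-(1 / 2) - d) x y ∂μ := by
          simp only [mem_ofPred_eq]; ring_nf
      _ ≤ ENNReal.ofReal (C₁ * (2 * ‖x - t‖) ^ (-(1 / 2) : ℝ)) := h₁ μ x hx _ (by positivity)
      _ ≤ ENNReal.ofReal C₁ * distPow (-(1 / 2)) x t := by
          rw [distPow, ← ENNReal.ofReal_mul hC₁]
          gcongr ENNReal.ofReal (_ * ?_)
          exact Real.rpow_le_rpow_of_nonpos hδ (by linarith) (by norm_num)
  · intro y hy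
    have hr : 0 < ‖x - y‖ := norm_pos_iff.2 (sub_ne_zero.2 hy.symm)
    calc _ ≤ ∫⁻ t in {t | ‖x - t‖ < ‖x - y‖}, distPow (1 / 2 - d) x t ∂μ := by
          rw [show -((d : ℝ) + 1) + 2 * 1 + -(1 / 2) = 1 / 2 - d by ring]
          refine lintegral_mono_set fun t ht => ?_
          simp only [mem_ofPred_eq] at ht ⊢
          linarith [norm_nonneg (x - t)]
      _ ≤ ENNReal.ofReal (C₂ * ‖x - y‖ ^ (1 / 2 : ℝ)) := h₂ μ x hx _ hr
      _ = _ := by rw [ENNReal.ofReal_mul hC₂, distPow]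

/-- The near part of the difference `K f(x) - K f(t)`, in the weighted `L²` norm that defines the
`H^{1/2}` seminorm. -/
theorem exists_lintegral_near_sq_le (d : ℕ) (hd : 1 ≤ d) (A : ℝ) (hA : 0 ≤ A) (α : ℝ) :
    ∃ C : ℝ≥0∞, C ≠ ∞ ∧ ∀ (μ : Measure E) [SFinite μ] (x : E), UpperRegularAt μ d A x →
      ∀ G : E → ℝ≥0∞, Measurable G →
        ∫⁻ t, distPow (-(d + 1)) x t * (∫⁻ y in {y | ‖x - y‖ < 3 * ‖x - t‖},
          distPow (α - d) x y * G y ∂μ) ^ 2 ∂μ ≤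
        C * ∫⁻ y, distPow (2 * α - d - 1) x y * G y ^ 2 ∂μ := by
  obtain ⟨C₁, hC₁, h₁⟩ := exists_lintegral_near_le (E := E) d hd A hA (β := 1 / 2) (by norm_num)
  obtain ⟨C₂, hC₂, h₂⟩ := exists_lintegral_far_le (E := E) d A hA (β := 1 / 2) (by norm_num)
  refine ⟨ENNReal.ofReal (C₁ * 3 ^ (1 / 2 : ℝ)) * ENNReal.ofReal (C₂ * 3⁻¹ ^ (-(1 / 2) : ℝ)),
    ENNReal.mul_ne_top ENNReal.ofReal_ne_top ENNReal.ofReal_ne_top, fun μ _ x hx G hG => ?_⟩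
  -- here the integral in `y` has to converge at `x` and the one in `t` at infinity
  have key := lintegral_distPow_sq_le (μ := μ) (hx.measure_singleton hd)
    (R := {z | ‖x - z.2‖ < 3 * ‖x - z.1‖}) (measurableSet_lt (by fun_prop) (by fun_prop))
    (v := -(d + 1)) (θ := 0) (π := -d / 2 + 1 / 4) (κ := α - d / 2 - 1 / 4) (τ := 1 / 2)
    (l := -(1 / 2)) (C₁ := ENNReal.ofReal (C₁ * 3 ^ (1 / 2 : ℝ)))
    (C₂ := ENNReal.ofReal (C₂ * 3⁻¹ ^ (-(1 / 2) : ℝ))) ?_ ?_ hG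
  · have h0 : ∀ t, distPow 0 x t = 1 := fun t => by simp [distPow]
    simp only [h0, one_mul] at key
    convert! key using 6 <;> ring_nf
  · intro t ht
    have hδ : 0 < ‖x - t‖ := norm_pos_iff.2 (sub_ne_zero.2 ht.symm)
    calc _ = ∫⁻ y in {y | ‖x - y‖ < 3 * ‖x - t‖}, distPow (1 / 2 - d) x y ∂μ := by
          simp only [mem_ofPred_eq]; ring_nf
      _ ≤ ENNReal.ofReal (C₁ * (3 * ‖x - t‖) ^ (1 / 2 : ℝ)) := h₁ μ x hx _ (by positivity)
      _ = _ := by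
          rw [distPow, ← ENNReal.ofReal_mul (by positivity),
            Real.mul_rpow (by norm_num) hδ.le, mul_assoc]
  · intro y hy
    have hr : 0 < ‖x - y‖ := norm_pos_iff.2 (sub_ne_zero.2 hy.symm)
    calc _ ≤ ∫⁻ t in {t | 3⁻¹ * ‖x - y‖ ≤ ‖x - t‖}, distPow (-(1 / 2) - d) x t ∂μ := by
          rw [show -((d : ℝ) + 1) + 2 * 0 + 1 / 2 = -(1 / 2) - d by ring]
          refine lintegral_mono_set fun t ht => ?_
          simp only [mem_ofPred_eq] at ht ⊢
          linarith
      _ ≤ ENNReal.ofReal (C₂ * (3⁻¹ * ‖x - y‖) ^ (-(1 / 2) : ℝ)) := h₂ μ x hx _ (by positivity)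
      _ = _ := by
          rw [distPow, ← ENNReal.ofReal_mul (by positivity),
            Real.mul_rpow (by norm_num) hr.le, mul_assoc]

/-- The integrals of `|x - y| ^ (α - d)` are bounded uniformly in `x`. -/
theorem exists_lintegral_distPow_le (d : ℕ) (hd : 1 ≤ d) (A : ℝ) (hA : 0 ≤ A) {α : ℝ} (hα : 0 < α)
    (hαd : α ≤ d) (μ : Measure E) [IsFiniteMeasure μ] :
    ∃ P : ℝ≥0∞, P ≠ ∞ ∧ ∀ x, UpperRegularAt μ d A x → ∫⁻ y, distPow (α - d) x y ∂μ ≤ P := by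
  obtain ⟨C, hC, h⟩ := exists_lintegral_near_le (E := E) d hd A hA hα
  refine ⟨ENNReal.ofReal C + μ univ,
    ENNReal.add_ne_top.2 ⟨ENNReal.ofReal_ne_top, measure_ne_top _ _⟩, fun x hx => ?_⟩
  have hm : MeasurableSet {y : E | ‖x - y‖ < 1} := measurableSet_lt (by fun_prop) (by fun_prop)
  rw [← lintegral_add_compl _ hm]
  refine add_le_add ((h μ x hx 1 one_pos).trans_eq (by simp)) ?_
  calc ∫⁻ y in {y : E | ‖x - y‖ < 1}ᶜ, distPow (α - d) x y ∂μ
      ≤ ∫⁻ y in {y : E | ‖x - y‖ < 1}ᶜ, 1 ∂μ := by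
        refine setLIntegral_mono measurable_const fun y hy => ?_
        simp only [mem_compl_iff, mem_ofPred_eq, not_lt] at hy
        rw [distPow, ← ENNReal.ofReal_one]
        exact ENNReal.ofReal_le_ofReal (Real.rpow_le_one_of_one_le_of_nonpos hy (by linarith))
    _ ≤ μ univ := by
        rw [setLIntegral_one]; exact measure_mono (subset_univ _)

/-- The Schur test for the kernel `|x - y| ^ (α - d)` on `L²`. -/
theorem exists_lintegral_sq_le (d : ℕ) (hd : 1 ≤ d) (A : ℝ) (hA : 0 ≤ A) {α : ℝ} (hα : 0 < α)
    (hαd : α ≤ d) (μ : Measure E) [IsFiniteMeasure μ] (hμ : ∀ᵐ x ∂μ, UpperRegularAt μ d A x) :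
    ∃ C : ℝ≥0∞, C ≠ ∞ ∧ ∀ G : E → ℝ≥0∞, Measurable G →
      ∫⁻ x, (∫⁻ y, distPow (α - d) x y * G y ∂μ) ^ 2 ∂μ ≤ C * ∫⁻ y, G y ^ 2 ∂μ := by
  obtain ⟨P, hP, h⟩ := exists_lintegral_distPow_le (E := E) d hd A hA hα hαd μ
  refine ⟨P * P, ENNReal.mul_ne_top hP hP, fun G hG => ?_⟩
  have hsq : ∀ x y : E, distPow ((α - d) / 2) x y ^ 2 = distPow (α - d) x y := fun x y => by
    rw [distPow_sq]; congr 1; ring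
  have key := lintegral_weighted_sq_le (μ := μ) (ν := μ) (v := fun _ => 1) (P := fun _ => P)
    (p := fun x y => distPow ((α - d) / 2) x y) (q := fun x y => distPow ((α - d) / 2) x y)
    (Q := fun _ => P * P) (G := G) (by fun_prop) (by fun_prop) (by fun_prop) (by fun_prop) hG
    (by
      filter_upwards [hμ] with x hx
      simp only [hsq]
      exact h x hx)
    (by
      filter_upwards [hμ] with y hy
      simp only [hsq, one_mul]
      rw [lintegral_const_mul _ (by fun_prop)]
      gcongr
      simp only [fun t => distPow_comm (α - d) t y]
      exact h y hy)
  simp only [one_mul, ← sq, hsq] at key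
  rw [sq, ← lintegral_const_mul _ (by fun_prop)] at *
  exact key

end LocalizedKernels

/-! ### Weakly singular kernels that annihilate differences of constants -/

section SingularKernels

variable {E : Type*} [NormedAddCommGroup E] [MeasurableSpace E] [BorelSpace E]
  [SecondCountableTopology E]

/-- A kernel of size `|x - y| ^ (α - d)`, relative to a set `S` that carries the Ahlfors regular
measure `μ` of dimension `d`. -/
structure IsWeaklySingularKernel (μ : Measure E) (S : Set E) (d : ℕ) (α A B : ℝ)
    (k : E → E → ℝ) : Prop where
  ae_mem : ∀ᵐ x ∂μ, x ∈ S
  upperRegular : ∀ x ∈ S, UpperRegularAt μ d A x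
  nonneg : 0 ≤ B
  aestronglyMeasurable : AEStronglyMeasurable (fun z : E × E => k z.1 z.2) (μ.prod μ)
  aestronglyMeasurable_right : ∀ x ∈ S, AEStronglyMeasurable (k x) μ
  abs_le : ∀ x ∈ S, ∀ y ∈ S, |k x y| ≤ B * ‖x - y‖ ^ (α - d)

/-- The properties of the double layer kernel on which its mapping properties rest: it is weakly
singular, it is Lipschitz in the first variable away from the diagonal with the corresponding
bound, and its integral in the second variable is a constant. -/
structure IsDoubleLayerKernel (μ : Measure E) (S : Set E) (d : ℕ) (α A B c : ℝ)
    (k : E → E → ℝ) : Prop extends IsWeaklySingularKernel μ S d α A B k where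
  abs_sub_le : ∀ x ∈ S, ∀ t ∈ S, ∀ y ∈ S, 2 * ‖x - t‖ ≤ ‖x - y‖ →
    |k x y - k t y| ≤ B * (‖x - t‖ * ‖x - y‖ ^ (α - d - 1))
  integral_eq : ∀ x ∈ S, ∫ y, k x y ∂μ = c

theorem add_sq_le_four_mul (a b : ℝ≥0∞) : (a + b) ^ 2 ≤ 4 * (a ^ 2 + b ^ 2) := by
  rcases le_total a b with h | h
  · calc (a + b) ^ 2 ≤ (b + b) ^ 2 := by gcongr
      _ = 4 * b ^ 2 := by ring
      _ ≤ _ := by gcongr; exact le_add_self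
  · calc (a + b) ^ 2 ≤ (a + a) ^ 2 := by gcongr
      _ = 4 * a ^ 2 := by ring
      _ ≤ _ := by gcongr; exact le_self_add

/-- The contribution to `K f(x) - K f(t)` of the points `y` far from `x`, for `|f(x) - f(y)|`
replaced with `G(x, y)`. -/
def farPart (μ : Measure E) (γ : ℝ) (G : E → E → ℝ≥0∞) (x t : E) : ℝ≥0∞ :=
  ∫⁻ y in {y | 2 * ‖x - t‖ ≤ ‖x - y‖}, distPow 1 x t * distPow (γ - 1) x y * G x y ∂μ

/-- The contribution to `K f(x) - K f(t)` of the points `y` near `x`, for `|f(x) - f(y)|`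
replaced with `G(x, y)`. -/
def nearPart (μ : Measure E) (γ : ℝ) (G : E → E → ℝ≥0∞) (x t : E) : ℝ≥0∞ :=
  ∫⁻ y in {y | ‖x - y‖ < 3 * ‖x - t‖}, distPow γ x y * G x y ∂μ

theorem measurable_setLIntegral_section {μ : Measure E} [SFinite μ] {R : Set ((E × E) × E)}
    (hR : MeasurableSet R) {F : (E × E) × E → ℝ≥0∞} (hF : Measurable F) :
    Measurable (fun z : E × E => ∫⁻ y in {y | (z, y) ∈ R}, F (z, y) ∂μ) := by
  have h : ∀ z : E × E, ∫⁻ y in {y | (z, y) ∈ R}, F (z, y) ∂μ =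
      ∫⁻ y, R.indicator F (z, y) ∂μ := by
    intro z
    have hRz : MeasurableSet {y | (z, y) ∈ R} := hR.preimage measurable_prodMk_left
    rw [← lintegral_indicator hRz]
    refine lintegral_congr fun y => ?_
    by_cases h : (z, y) ∈ R <;> simp [h]
  simp only [h]
  exact (hF.indicator hR).lintegral_prod_right'

theorem measurable_farPart {μ : Measure E} [SFinite μ] (γ : ℝ) {G : E → E → ℝ≥0∞}
    (hG : Measurable (fun z : E × E => G z.1 z.2)) :
    Measurable (fun z : E × E => farPart μ γ G z.1 z.2) := by
  refine measurable_setLIntegral_section (R := {w | 2 * ‖w.1.1 - w.1.2‖ ≤ ‖w.1.1 - w.2‖})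
    (F := fun w => distPow 1 w.1.1 w.1.2 * distPow (γ - 1) w.1.1 w.2 * G w.1.1 w.2)
    (measurableSet_le (by fun_prop) (by fun_prop)) ?_
  have : Measurable (fun w : (E × E) × E => G w.1.1 w.2) :=
    hG.comp (f := fun w : (E × E) × E => (w.1.1, w.2)) (by fun_prop)
  fun_prop

theorem measurable_nearPart {μ : Measure E} [SFinite μ] (γ : ℝ) {G : E → E → ℝ≥0∞}
    (hG : Measurable (fun z : E × E => G z.1 z.2)) :
    Measurable (fun z : E × E => nearPart μ γ G z.1 z.2) := by
  refine measurable_setLIntegral_section (R := {w | ‖w.1.1 - w.2‖ < 3 * ‖w.1.1 - w.1.2‖})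
    (F := fun w => distPow γ w.1.1 w.2 * G w.1.1 w.2)
    (measurableSet_lt (by fun_prop) (by fun_prop)) ?_
  have : Measurable (fun w : (E × E) × E => G w.1.1 w.2) :=
    hG.comp (f := fun w : (E × E) × E => (w.1.1, w.2)) (by fun_prop)
  fun_prop

variable {F : Type*} [NormedAddCommGroup F] [NormedSpace ℝ F] [CompleteSpace F]

namespace IsWeaklySingularKernel

variable {μ : Measure E} {S : Set E} {d : ℕ} {α A B : ℝ} {k : E → E → ℝ}

theorem enorm_le (hk : IsWeaklySingularKernel μ S d α A B k) {x y : E} (hx : x ∈ S) (hy : y ∈ S) :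
    ‖k x y‖ₑ ≤ ENNReal.ofReal B * distPow (α - d) x y := by
  rw [distPow, ← ENNReal.ofReal_mul hk.nonneg, Real.enorm_eq_ofReal_abs]
  exact ENNReal.ofReal_le_ofReal (hk.abs_le x hx y hy)

theorem integrable [IsFiniteMeasure μ] (hk : IsWeaklySingularKernel μ S d α A B k) (hd : 1 ≤ d)
    (hA : 0 ≤ A) (hα : 0 < α) (hαd : α ≤ d) {x : E} (hx : x ∈ S) : Integrable (k x) μ := by
  obtain ⟨P, hP, h⟩ := exists_lintegral_distPow_le (E := E) d hd A hA hα hαd μ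
  refine ⟨hk.aestronglyMeasurable_right x hx, ?_⟩
  refine lt_of_le_of_lt (b := ∫⁻ y, ENNReal.ofReal B * distPow (α - d) x y ∂μ) ?_ ?_
  · refine lintegral_mono_ae ?_
    filter_upwards [hk.ae_mem] with y hy using hk.enorm_le hx hy
  · rw [lintegral_const_mul _ (by fun_prop)]
    exact ENNReal.mul_lt_top ENNReal.ofReal_lt_top
      ((h x (hk.upperRegular x hx)).trans_lt hP.lt_top)

/-- The operator with kernel `k` is bounded on `L²`, even if absolute values are taken inside the
integral. -/
theorem exists_lintegral_sq_le [IsFiniteMeasure μ] (hk : IsWeaklySingularKernel μ S d α A B k)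
    (hd : 1 ≤ d) (hA : 0 ≤ A) (hα : 0 < α) (hαd : α ≤ d) :
    ∃ C : ℝ≥0∞, C ≠ ∞ ∧ ∀ G : E → ℝ≥0∞, Measurable G →
      ∫⁻ x, (∫⁻ y, ‖k x y‖ₑ * G y ∂μ) ^ 2 ∂μ ≤ C * ∫⁻ y, G y ^ 2 ∂μ := by
  obtain ⟨C, hC, h⟩ := NeumannPoincare.exists_lintegral_sq_le d hd A hA hα hαd μ
    (by filter_upwards [hk.ae_mem] with x hx using hk.upperRegular x hx)
  refine ⟨ENNReal.ofReal B ^ 2 * C,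
    ENNReal.mul_ne_top (ENNReal.pow_ne_top ENNReal.ofReal_ne_top) hC, fun G hG => ?_⟩
  calc ∫⁻ x, (∫⁻ y, ‖k x y‖ₑ * G y ∂μ) ^ 2 ∂μ
      ≤ ∫⁻ x, ENNReal.ofReal B ^ 2 * (∫⁻ y, distPow (α - d) x y * G y ∂μ) ^ 2 ∂μ := by
        refine lintegral_mono_ae ?_
        filter_upwards [hk.ae_mem] with x hx
        rw [← mul_pow, ← lintegral_const_mul _ (by fun_prop)]
        refine pow_le_pow_left₀ zero_le (lintegral_mono_ae ?_) 2
        filter_upwards [hk.ae_mem] with y hy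
        rw [← mul_assoc]
        gcongr
        exact hk.enorm_le hx hy
    _ = ENNReal.ofReal B ^ 2 * ∫⁻ x, (∫⁻ y, distPow (α - d) x y * G y ∂μ) ^ 2 ∂μ := by
        have : Measurable fun x => ∫⁻ y, distPow (α - d) x y * G y ∂μ := by
          refine Measurable.lintegral_prod_right' (f := fun z : E × E =>
            distPow (α - d) z.1 z.2 * G z.2) (by fun_prop)
        rw [lintegral_const_mul _ (this.pow_const 2)]
    _ ≤ _ := by
        rw [mul_assoc]; gcongr; exact h G hG

theorem ae_integrable_smul [IsFiniteMeasure μ] (hk : IsWeaklySingularKernel μ S d α A B k)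
    (hd : 1 ≤ d) (hA : 0 ≤ A) (hα : 0 < α) (hαd : α ≤ d) {f : E → F} (hf : StronglyMeasurable f)
    (hf2 : ∫⁻ y, ‖f y‖ₑ ^ 2 ∂μ ≠ ∞) : ∀ᵐ x ∂μ, Integrable (fun y => k x y • f y) μ := by
  obtain ⟨C, hC, h⟩ := hk.exists_lintegral_sq_le hd hA hα hαd
  have hkm : AEMeasurable (fun z : E × E => ‖k z.1 z.2‖ₑ * ‖f z.2‖ₑ) (μ.prod μ) :=
    hk.aestronglyMeasurable.enorm.mul
      (hf.enorm.comp measurable_snd).aemeasurable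
  have hfin : ∀ᵐ x ∂μ, (∫⁻ y, ‖k x y‖ₑ * ‖f y‖ₑ ∂μ) ^ 2 < ∞ :=
    ae_lt_top' (hkm.lintegral_prod_right'.pow_const 2)
      ((h _ hf.enorm).trans_lt (ENNReal.mul_lt_top hC.lt_top hf2.lt_top)).ne
  filter_upwards [hfin, hk.ae_mem] with x hx hxS
  refine ⟨(hk.aestronglyMeasurable_right x hxS).smul hf.aestronglyMeasurable, ?_⟩
  rw [HasFiniteIntegral]
  simp only [enorm_smul]
  by_contra hcon
  rw [not_lt, top_le_iff] at hcon
  rw [hcon] at hx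
  simp at hx

theorem aestronglyMeasurable_integral [SFinite μ] (hk : IsWeaklySingularKernel μ S d α A B k)
    {f : E → F} (hf : StronglyMeasurable f) :
    AEStronglyMeasurable (fun x => ∫ y, k x y • f y ∂μ) μ :=
  AEStronglyMeasurable.integral_prod_right' (f := fun z : E × E => k z.1 z.2 • f z.2)
    (hk.aestronglyMeasurable.smul (hf.comp_measurable measurable_snd).aestronglyMeasurable)

theorem exists_lintegral_enorm_integral_sq_le [IsFiniteMeasure μ]
    (hk : IsWeaklySingularKernel μ S d α A B k)
    (hd : 1 ≤ d) (hA : 0 ≤ A) (hα : 0 < α) (hαd : α ≤ d) :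
    ∃ C : ℝ≥0∞, C ≠ ∞ ∧ ∀ f : E → F, StronglyMeasurable f →
      ∫⁻ x, ‖∫ y, k x y • f y ∂μ‖ₑ ^ 2 ∂μ ≤ C * ∫⁻ y, ‖f y‖ₑ ^ 2 ∂μ := by
  obtain ⟨C, hC, h⟩ := hk.exists_lintegral_sq_le hd hA hα hαd
  refine ⟨C, hC, fun f hf => (lintegral_mono fun x => ?_).trans (h _ hf.enorm)⟩
  gcongr
  refine (enorm_integral_le_lintegral_enorm _).trans_eq ?_
  simp only [enorm_smul]

theorem swap [SFinite μ] (hk : IsWeaklySingularKernel μ S d α A B k)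
    (h : ∀ x ∈ S, AEStronglyMeasurable (fun y => k y x) μ) :
    IsWeaklySingularKernel μ S d α A B (fun x y => k y x) where
  ae_mem := hk.ae_mem
  upperRegular := hk.upperRegular
  nonneg := hk.nonneg
  aestronglyMeasurable := hk.aestronglyMeasurable.prod_swap
  aestronglyMeasurable_right := h
  abs_le x hx y hy := norm_sub_rev x y ▸ hk.abs_le y hy x hx

end IsWeaklySingularKernel

namespace IsDoubleLayerKernel

variable {μ : Measure E} {S : Set E} {d : ℕ} {α A B c : ℝ} {k : E → E → ℝ}

theorem enorm_sub_le (hk : IsDoubleLayerKernel μ S d α A B c k) {x t y : E} (hx : x ∈ S)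
    (ht : t ∈ S) (hy : y ∈ S) (h : 2 * ‖x - t‖ ≤ ‖x - y‖) :
    ‖k x y - k t y‖ₑ ≤ ENNReal.ofReal B * (distPow 1 x t * distPow (α - d - 1) x y) := by
  rw [distPow, distPow, ← ENNReal.ofReal_mul (by positivity), ← ENNReal.ofReal_mul hk.nonneg,
    Real.enorm_eq_ofReal_abs, Real.rpow_one]
  exact ENNReal.ofReal_le_ofReal (hk.abs_sub_le x hx t ht y hy h)

/-- The pointwise estimate of `K f(x) - K f(t)`. As `K` maps constants to constants, it depends on
the differences of values of `f` only. -/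
theorem exists_enorm_sub_le [IsFiniteMeasure μ] (hk : IsDoubleLayerKernel μ S d α A B c k)
    (hd : 1 ≤ d) (hA : 0 ≤ A) (hα : 0 < α) (hαd : α ≤ d) :
    ∃ C : ℝ≥0∞, C ≠ ∞ ∧ ∀ f : E → F, StronglyMeasurable f → ∀ x ∈ S, ∀ t ∈ S,
      Integrable (fun y => k x y • f y) μ → Integrable (fun y => k t y • f y) μ →
      ‖(∫ y, k x y • f y ∂μ) - ∫ y, k t y • f y ∂μ‖ₑ ≤
        C * (farPart μ (α - d) (fun x y => ‖f x - f y‖ₑ) x t +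
          nearPart μ (α - d) (fun x y => ‖f x - f y‖ₑ) x t +
          (nearPart μ (α - d) (fun x y => ‖f x - f y‖ₑ) t x + distPow α x t * ‖f x - f t‖ₑ)) := by
  obtain ⟨C, hC, h⟩ := exists_lintegral_near_le (E := E) d hd A hA hα
  set C' : ℝ≥0∞ := ENNReal.ofReal (C * 3 ^ α)
  refine ⟨ENNReal.ofReal B * (1 + C'), ENNReal.mul_ne_top ENNReal.ofReal_ne_top
    (ENNReal.add_ne_top.2 ⟨ENNReal.one_ne_top, ENNReal.ofReal_ne_top⟩),
    fun f hf x hx t ht hfx hft => ?_⟩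
  set G : E → E → ℝ≥0∞ := fun x y => ‖f x - f y‖ₑ with hG
  have hGm : ∀ x, Measurable (G x) := fun x => (stronglyMeasurable_const.sub hf).enorm
  set R : Set E := {y | 2 * ‖x - t‖ ≤ ‖x - y‖} with hR
  have hRm : MeasurableSet R := measurableSet_le (by fun_prop) (by fun_prop)
  -- the constant `f x` may be subtracted from `f`, because `k x` and `k t` have the same integral
  have e1 : (∫ y, k x y • f y ∂μ) - ∫ y, k t y • f y ∂μ =
      ∫ y, (k x y - k t y) • (f y - f x) ∂μ := by
    have hx1 := hk.integrable hd hA hα hαd hx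
    have ht1 := hk.integrable hd hA hα hαd ht
    have h0 : ∫ y, (k x y - k t y) • f x ∂μ = 0 := by
      rw [integral_smul_const, integral_sub hx1 ht1, hk.integral_eq x hx, hk.integral_eq t ht,
        sub_self, zero_smul]
    rw [← integral_sub hfx hft]
    calc ∫ y, (k x y • f y - k t y • f y) ∂μ
        = ∫ y, (k x y - k t y) • f y ∂μ - ∫ y, (k x y - k t y) • f x ∂μ := by
          rw [h0, sub_zero]; simp only [sub_smul]
      _ = _ := by
          rw [← integral_sub]
          · simp only [smul_sub]
          · simpa only [sub_smul, Pi.sub_def] using hfx.sub hft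
          · exact (hx1.sub ht1).smul_const _
  have hfar : ∫⁻ y in R, ‖k x y - k t y‖ₑ * G x y ∂μ ≤
      ENNReal.ofReal B * farPart μ (α - d) G x t := by
    rw [farPart, ← lintegral_const_mul _ (by fun_prop)]
    refine lintegral_mono_ae ?_
    filter_upwards [ae_restrict_of_ae hk.ae_mem, ae_restrict_mem hRm] with y hy hyR
    rw [← mul_assoc]
    gcongr
    exact hk.enorm_sub_le hx ht hy hyR
  have hnear1 : ∫⁻ y in Rᶜ, ‖k x y‖ₑ * G x y ∂μ ≤
      ENNReal.ofReal B * nearPart μ (α - d) G x t := by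
    rw [nearPart, ← lintegral_const_mul _ (by fun_prop)]
    refine le_trans (b := ∫⁻ y in Rᶜ, ENNReal.ofReal B * (distPow (α - d) x y * G x y) ∂μ)
      (lintegral_mono_ae ?_) (lintegral_mono_set fun y hy => ?_)
    · filter_upwards [ae_restrict_of_ae hk.ae_mem] with y hy
      rw [← mul_assoc]
      gcongr
      exact hk.enorm_le hx hy
    · simp only [hR, mem_compl_iff, mem_ofPred_eq, not_le] at hy ⊢
      linarith [norm_nonneg (x - t)]
  have hsub : Rᶜ ⊆ {y | ‖t - y‖ < 3 * ‖t - x‖} := fun y hy => by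
    simp only [hR, mem_compl_iff, mem_ofPred_eq, not_le] at hy ⊢
    have := norm_sub_le_norm_sub_add_norm_sub t x y
    rw [norm_sub_rev x t] at hy
    linarith
  have hnear2 : ∫⁻ y in Rᶜ, ‖k t y‖ₑ * G x y ∂μ ≤
      ENNReal.ofReal B * (nearPart μ (α - d) G t x + C' * (distPow α x t * G x t)) := by
    calc ∫⁻ y in Rᶜ, ‖k t y‖ₑ * G x y ∂μ
        ≤ ∫⁻ y in Rᶜ, ENNReal.ofReal B * (distPow (α - d) t y * G t y +
            distPow (α - d) t y * G x t) ∂μ := by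
          refine lintegral_mono_ae ?_
          filter_upwards [ae_restrict_of_ae hk.ae_mem] with y hy
          rw [← mul_add, ← mul_assoc]
          refine mul_le_mul' (hk.enorm_le ht hy) ?_
          rw [add_comm]
          simp only [hG]
          calc ‖f x - f y‖ₑ = ‖(f x - f t) + (f t - f y)‖ₑ := by congr 1; abel
            _ ≤ _ := enorm_add_le _ _
      _ ≤ ∫⁻ y in {y | ‖t - y‖ < 3 * ‖t - x‖}, ENNReal.ofReal B * (distPow (α - d) t y * G t y +
            distPow (α - d) t y * G x t) ∂μ := lintegral_mono_set hsub
      _ = ENNReal.ofReal B * (nearPart μ (α - d) G t x +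
            (∫⁻ y in {y | ‖t - y‖ < 3 * ‖t - x‖}, distPow (α - d) t y ∂μ) * G x t) := by
          rw [lintegral_const_mul _ (by fun_prop), lintegral_add_left (by fun_prop),
            lintegral_mul_const _ (by fun_prop), nearPart]
      _ ≤ _ := by
          rw [← mul_assoc C']
          gcongr
          by_cases hxt : t = x
          · subst hxt
            have : {y : E | ‖t - y‖ < 0} = ∅ := by ext y; simp
            simp [this]
          have hδ : 0 < ‖t - x‖ := norm_pos_iff.2 (sub_ne_zero.2 hxt)
          refine (h μ t (hk.upperRegular t ht) _ (by positivity)).trans_eq ?_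
          rw [Real.mul_rpow (by norm_num) hδ.le, ← mul_assoc,
            ENNReal.ofReal_mul' (by positivity), distPow_comm, distPow]
  rw [e1]
  calc ‖∫ y, (k x y - k t y) • (f y - f x) ∂μ‖ₑ
      ≤ ∫⁻ y, ‖k x y - k t y‖ₑ * G x y ∂μ := by
        refine (enorm_integral_le_lintegral_enorm _).trans_eq ?_
        simp only [enorm_smul, hG, enorm_sub_rev (f x)]
    _ = ∫⁻ y in R, ‖k x y - k t y‖ₑ * G x y ∂μ + ∫⁻ y in Rᶜ, ‖k x y - k t y‖ₑ * G x y ∂μ :=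
        (lintegral_add_compl _ hRm).symm
    _ ≤ ∫⁻ y in R, ‖k x y - k t y‖ₑ * G x y ∂μ +
          (∫⁻ y in Rᶜ, ‖k x y‖ₑ * G x y ∂μ + ∫⁻ y in Rᶜ, ‖k t y‖ₑ * G x y ∂μ) := by
        gcongr
        rw [← lintegral_add_left']
        · refine lintegral_mono fun y => ?_
          rw [← add_mul]
          gcongr
          exact _root_.enorm_sub_le
        · exact ((hk.aestronglyMeasurable_right x hx).enorm.mul (hGm x).aemeasurable).restrict
    _ ≤ ENNReal.ofReal B * farPart μ (α - d) G x t + (ENNReal.ofReal B * nearPart μ (α - d) G x t +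
          ENNReal.ofReal B * (nearPart μ (α - d) G t x + C' * (distPow α x t * G x t))) := by
        gcongr
    _ = ENNReal.ofReal B * (1 * farPart μ (α - d) G x t + 1 * nearPart μ (α - d) G x t +
          (1 * nearPart μ (α - d) G t x + C' * (distPow α x t * G x t))) := by ring
    _ ≤ ENNReal.ofReal B * ((1 + C') * farPart μ (α - d) G x t +
          (1 + C') * nearPart μ (α - d) G x t +
          ((1 + C') * nearPart μ (α - d) G t x + (1 + C') * (distPow α x t * G x t))) := by
        gcongr
        all_goals first | exact le_self_add | exact le_add_self
    _ = _ := by ring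

/-- The operator with kernel `k` gains `α` derivatives on the scale of fractional Sobolev spaces:
the `H^{1/2}` seminorm of `K f` is bounded by the seminorm of order `1/2 - α` of `f`. -/
theorem exists_seminorm_le [IsFiniteMeasure μ] (hk : IsDoubleLayerKernel μ S d α A B c k)
    (hd : 1 ≤ d) (hA : 0 ≤ A) (hα : 0 < α) (hαd : α ≤ d) :
    ∃ C : ℝ≥0∞, C ≠ ∞ ∧ ∀ f : E → F, StronglyMeasurable f → ∫⁻ y, ‖f y‖ₑ ^ 2 ∂μ ≠ ∞ →
      ∫⁻ x, ∫⁻ t, distPow (-(d + 1)) x t *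
          ‖(∫ y, k x y • f y ∂μ) - ∫ y, k t y • f y ∂μ‖ₑ ^ 2 ∂μ ∂μ ≤
        C * ∫⁻ x, ∫⁻ t, distPow (2 * α - d - 1) x t * ‖f x - f t‖ₑ ^ 2 ∂μ ∂μ := by
  obtain ⟨C₀, hC₀, h₀⟩ := hk.exists_enorm_sub_le (F := F) hd hA hα hαd
  obtain ⟨C₁, hC₁, h₁⟩ := exists_lintegral_far_sq_le (E := E) d hd A hA α
  obtain ⟨C₂, hC₂, h₂⟩ := exists_lintegral_near_sq_le (E := E) d hd A hA α
  refine ⟨C₀ ^ 2 * 16 * (C₁ + C₂ + (C₂ + 1)), ?_, fun f hf hf2 => ?_⟩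
  · refine ENNReal.mul_ne_top (ENNReal.mul_ne_top (ENNReal.pow_ne_top hC₀) (by norm_num)) ?_
    finiteness
  set G : E → E → ℝ≥0∞ := fun x y => ‖f x - f y‖ₑ with hG
  have hGm : Measurable (fun z : E × E => G z.1 z.2) :=
    ((hf.comp_measurable measurable_fst).sub (hf.comp_measurable measurable_snd)).enorm
  have hG1 : ∀ x, Measurable (G x) := fun x => hGm.comp measurable_prodMk_left
  set I : ℝ≥0∞ := ∫⁻ x, ∫⁻ t, distPow (2 * α - d - 1) x t * G x t ^ 2 ∂μ ∂μ with hI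
  have hfarm := measurable_farPart (μ := μ) (α - d) hGm
  have hnearm := measurable_nearPart (μ := μ) (α - d) hGm
  have hnearm' : Measurable (fun z : E × E => nearPart μ (α - d) G z.2 z.1) :=
    hnearm.comp measurable_swap
  have hIm : Measurable fun x => ∫⁻ t, distPow (2 * α - d - 1) x t * G x t ^ 2 ∂μ :=
    Measurable.lintegral_prod_right' (f := fun z : E × E =>
      distPow (2 * α - d - 1) z.1 z.2 * G z.1 z.2 ^ 2) (by fun_prop)
  set w : E × E → ℝ≥0∞ := fun z => distPow (-(d + 1)) z.1 z.2 with hw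
  have hwm : Measurable w := measurable_distPow _
  have hprod : ∀ H : E × E → ℝ≥0∞, Measurable H →
      ∫⁻ z, H z ∂(μ.prod μ) = ∫⁻ x, ∫⁻ t, H (x, t) ∂μ ∂μ := fun H hH =>
    lintegral_prod _ hH.aemeasurable
  have i1 : ∫⁻ z, w z * farPart μ (α - d) G z.1 z.2 ^ 2 ∂(μ.prod μ) ≤ C₁ * I := by
    rw [hprod _ (by fun_prop), hI, ← lintegral_const_mul _ hIm]
    refine lintegral_mono_ae ?_
    filter_upwards [hk.ae_mem] with x hx
    exact h₁ μ x (hk.upperRegular x hx) (G x) (hG1 x)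
  have i2 : ∫⁻ z, w z * nearPart μ (α - d) G z.1 z.2 ^ 2 ∂(μ.prod μ) ≤ C₂ * I := by
    rw [hprod _ (by fun_prop), hI, ← lintegral_const_mul _ hIm]
    refine lintegral_mono_ae ?_
    filter_upwards [hk.ae_mem] with x hx
    exact h₂ μ x (hk.upperRegular x hx) (G x) (hG1 x)
  have i3 : ∫⁻ z, w z * nearPart μ (α - d) G z.2 z.1 ^ 2 ∂(μ.prod μ) ≤ C₂ * I := by
    refine le_of_eq_of_le ?_ i2
    rw [← lintegral_prod_swap]
    refine lintegral_congr fun z => ?_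
    simp only [hw, Prod.fst_swap, Prod.snd_swap, distPow_comm _ z.2]
  have i4 : ∫⁻ z, w z * (distPow α z.1 z.2 * G z.1 z.2) ^ 2 ∂(μ.prod μ) ≤ 1 * I := by
    rw [hprod _ (by fun_prop), hI, one_mul]
    refine lintegral_mono fun x => lintegral_mono fun t => ?_
    by_cases hxt : x = t
    · subst hxt; simp [hG]
    · simp only [hw]
      rw [mul_pow, distPow_sq, ← mul_assoc, distPow_mul hxt]
      apply le_of_eq
      congr 2; ring
  calc ∫⁻ x, ∫⁻ t, distPow (-(d + 1)) x t *
          ‖(∫ y, k x y • f y ∂μ) - ∫ y, k t y • f y ∂μ‖ₑ ^ 2 ∂μ ∂μ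
      ≤ ∫⁻ x, ∫⁻ t, C₀ ^ 2 * 16 * (w (x, t) * farPart μ (α - d) G x t ^ 2 +
          w (x, t) * nearPart μ (α - d) G x t ^ 2 + (w (x, t) * nearPart μ (α - d) G t x ^ 2 +
          w (x, t) * (distPow α x t * G x t) ^ 2)) ∂μ ∂μ := by
        have hint := hk.ae_integrable_smul hd hA hα hαd hf hf2
        refine lintegral_mono_ae ?_
        filter_upwards [hk.ae_mem, hint] with x hx hxi
        refine lintegral_mono_ae ?_
        filter_upwards [hk.ae_mem, hint] with t ht hti
        calc _ ≤ w (x, t) * (C₀ * (farPart μ (α - d) G x t + nearPart μ (α - d) G x t +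
              (nearPart μ (α - d) G t x + distPow α x t * G x t))) ^ 2 := by
              gcongr
              exact h₀ f hf x hx t ht hxi hti
          _ ≤ w (x, t) * (C₀ ^ 2 * (4 * (4 * (farPart μ (α - d) G x t ^ 2 +
              nearPart μ (α - d) G x t ^ 2) + 4 * (nearPart μ (α - d) G t x ^ 2 +
              (distPow α x t * G x t) ^ 2)))) := by
              rw [mul_pow]
              gcongr
              refine (add_sq_le_four_mul _ _).trans ?_
              gcongr <;> exact add_sq_le_four_mul _ _
          _ = _ := by ring
    _ = ∫⁻ z, C₀ ^ 2 * 16 * (w z * farPart μ (α - d) G z.1 z.2 ^ 2 +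
          w z * nearPart μ (α - d) G z.1 z.2 ^ 2 + (w z * nearPart μ (α - d) G z.2 z.1 ^ 2 +
          w z * (distPow α z.1 z.2 * G z.1 z.2) ^ 2)) ∂(μ.prod μ) := by
        rw [hprod _ (by fun_prop)]
    _ ≤ C₀ ^ 2 * 16 * (C₁ * I + C₂ * I + (C₂ * I + 1 * I)) := by
        rw [lintegral_const_mul _ (by fun_prop), lintegral_add_left (by fun_prop),
          lintegral_add_left (by fun_prop), lintegral_add_left (by fun_prop)]
        gcongr
    _ = _ := by ring

end IsDoubleLayerKernel

end SingularKernels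

/-! ### The splitting of `ℝ^{d+1}` and the Jacobian of a graph parametrization -/

section Splitting

variable {d : ℕ}

/-- The identification of `ℝ^d × ℝ` with `ℝ^{d+1}`. It preserves inner products if `ℝ^d × ℝ` is
given the Euclidean one, see `inner_snocEquiv`, but `ℝ^d × ℝ` carries the maximum norm here. -/
def snocEquiv (d : ℕ) :
    (EuclideanSpace ℝ (Fin d) × ℝ) ≃L[ℝ] EuclideanSpace ℝ (Fin (d + 1)) :=
  LinearEquiv.toContinuousLinearEquiv
    { toFun := fun z => WithLp.toLp 2 (Fin.snoc (α := fun _ => ℝ) (fun i => z.1 i) z.2)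
      invFun := fun x => (headCoords x, x (Fin.last d))
      map_add' := fun z w => by
        ext i
        refine Fin.lastCases ?_ (fun j => ?_) i <;> simp
      map_smul' := fun c z => by
        ext i
        refine Fin.lastCases ?_ (fun j => ?_) i <;> simp
      left_inv := fun z => by
        refine Prod.ext ?_ ?_
        · ext i; simp [headCoords]
        · simp
      right_inv := fun x => by
        ext i
        refine Fin.lastCases ?_ (fun j => ?_) i <;> simp [headCoords] }

@[simp]
theorem snocEquiv_castSucc (z : EuclideanSpace ℝ (Fin d) × ℝ) (i : Fin d) :
    snocEquiv d z i.castSucc = z.1 i := by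
  simp [snocEquiv]

@[simp]
theorem snocEquiv_last (z : EuclideanSpace ℝ (Fin d) × ℝ) :
    snocEquiv d z (Fin.last d) = z.2 := by
  simp [snocEquiv]

@[simp]
theorem headCoords_snocEquiv (z : EuclideanSpace ℝ (Fin d) × ℝ) :
    headCoords (snocEquiv d z) = z.1 := by
  ext i; simp [headCoords]

@[simp]
theorem snocEquiv_headCoords (x : EuclideanSpace ℝ (Fin (d + 1))) :
    snocEquiv d (headCoords x, x (Fin.last d)) = x := (snocEquiv d).apply_symm_apply x

theorem inner_snocEquiv (z w : EuclideanSpace ℝ (Fin d) × ℝ) :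
    inner ℝ (snocEquiv d z) (snocEquiv d w) = inner ℝ z.1 w.1 + z.2 * w.2 := by
  simp only [PiLp.inner_apply, Fin.sum_univ_castSucc, snocEquiv_castSucc, snocEquiv_last]
  simp [mul_comm]

theorem norm_sq_snocEquiv (z : EuclideanSpace ℝ (Fin d) × ℝ) :
    ‖snocEquiv d z‖ ^ 2 = ‖z.1‖ ^ 2 + z.2 ^ 2 := by
  rw [← real_inner_self_eq_norm_sq, inner_snocEquiv, real_inner_self_eq_norm_sq, sq z.2]

theorem norm_fst_le_norm_snocEquiv (z : EuclideanSpace ℝ (Fin d) × ℝ) :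
    ‖z.1‖ ≤ ‖snocEquiv d z‖ :=
  le_of_sq_le_sq (by rw [norm_sq_snocEquiv]; nlinarith [sq_nonneg z.2]) (norm_nonneg _)

theorem measurePreserving_snocEquiv (d : ℕ) :
    MeasurePreserving (snocEquiv d) (volume.prod volume) volume := by
  have h1 := (volume_preserving_piFinSuccAbove (fun _ : Fin (d + 1) => ℝ) (Fin.last d)).symm
  have h2 : MeasurePreserving
      (fun z : EuclideanSpace ℝ (Fin d) × ℝ => (z.2, (WithLp.ofLp z.1 : Fin d → ℝ)))
      (volume.prod volume) (volume.prod volume) :=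
    (Measure.measurePreserving_swap (μ := volume) (ν := volume)).comp
      ((EuclideanSpace.volume_preserving_symm_measurableEquiv_toLp (Fin d)).prod
        (MeasurePreserving.id volume))
  have h3 := (EuclideanSpace.volume_preserving_symm_measurableEquiv_toLp (Fin (d + 1))).symm
  have := h3.comp (h1.comp h2)
  convert! this using 1
  funext z
  ext i
  refine Fin.lastCases ?_ (fun j => ?_) i
  · simp [MeasurableEquiv.piFinSuccAbove, Fin.insertNthEquiv]
  · simp [MeasurableEquiv.piFinSuccAbove, Fin.insertNthEquiv]

open scoped Gradient

/-- The parametrization `u ↦ (u, g(u))` of the graph of `g`. -/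
def graphParam (g : EuclideanSpace ℝ (Fin d) → ℝ) (u : EuclideanSpace ℝ (Fin d)) :
    EuclideanSpace ℝ (Fin (d + 1)) := snocEquiv d (u, g u)

/-- The linear map `u ↦ (u, a · u)`, the derivative of a graph parametrization. -/
def graphLin (a : EuclideanSpace ℝ (Fin d)) :
    EuclideanSpace ℝ (Fin d) →L[ℝ] EuclideanSpace ℝ (Fin (d + 1)) :=
  (snocEquiv d : _ →L[ℝ] _).comp ((ContinuousLinearMap.id ℝ _).prod (innerSL ℝ a))

theorem graphLin_apply (a u : EuclideanSpace ℝ (Fin d)) :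
    graphLin a u = snocEquiv d (u, inner ℝ a u) := rfl

theorem norm_le_norm_graphLin (a u : EuclideanSpace ℝ (Fin d)) : ‖u‖ ≤ ‖graphLin a u‖ :=
  norm_fst_le_norm_snocEquiv (u, inner ℝ a u)

theorem norm_sub_le_norm_graphParam_sub (g : EuclideanSpace ℝ (Fin d) → ℝ)
    (u v : EuclideanSpace ℝ (Fin d)) : ‖u - v‖ ≤ ‖graphParam g u - graphParam g v‖ := by
  have h : graphParam g u - graphParam g v = snocEquiv d (u - v, g u - g v) :=
    (map_sub (snocEquiv d) (u, g u) (v, g v)).symm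
  rw [h]
  exact norm_fst_le_norm_snocEquiv (u - v, g u - g v)

/-- The Gram matrix of the map `u ↦ (u, a · u)` is `1 + a aᵀ`, whose determinant is `1 + |a|²`. -/
theorem normDet_graphLin (a : EuclideanSpace ℝ (Fin d)) :
    (graphLin a : EuclideanSpace ℝ (Fin d) →ₗ[ℝ] EuclideanSpace ℝ (Fin (d + 1))).normDet =
      √(1 + ‖a‖ ^ 2) := by
  have h := LinearMap.normDet_sq_eq_det_gram
    (graphLin a : EuclideanSpace ℝ (Fin d) →ₗ[ℝ] EuclideanSpace ℝ (Fin (d + 1)))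
    (EuclideanSpace.basisFun (Fin d) ℝ)
  have hg : Matrix.gram ℝ (fun i => (graphLin a : EuclideanSpace ℝ (Fin d) →ₗ[ℝ]
      EuclideanSpace ℝ (Fin (d + 1))) (EuclideanSpace.basisFun (Fin d) ℝ i)) =
      1 + Matrix.replicateCol Unit (fun i => a i) * Matrix.replicateRow Unit (fun i => a i) := by
    ext i j
    rw [Matrix.gram_apply, ContinuousLinearMap.coe_coe, graphLin_apply, graphLin_apply,
      inner_snocEquiv]
    simp [Matrix.add_apply, Matrix.one_apply, Matrix.mul_apply, PiLp.inner_apply, eq_comm]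
  rw [hg, Matrix.det_one_add_replicateCol_mul_replicateRow] at h
  rw [eq_comm, Real.sqrt_eq_iff_mul_self_eq (by positivity) (LinearMap.normDet_nonneg _), ← sq]
  simp only [RCLike.ofReal_real_eq_id, id_eq] at h
  rw [h, EuclideanSpace.real_norm_sq_eq]
  simp [dotProduct, sq]

theorem HasStrictFDerivAt.graphParam {g : EuclideanSpace ℝ (Fin d) → ℝ} (hg : ContDiff ℝ 1 g)
    (u : EuclideanSpace ℝ (Fin d)) : HasStrictFDerivAt (graphParam g) (graphLin (∇ g u)) u := by
  have h1 : HasStrictFDerivAt g (innerSL ℝ (∇ g u)) u := by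
    have h2 := hg.contDiffAt.hasStrictFDerivAt (x := u) one_ne_zero
    have h3 : innerSL ℝ (∇ g u) = fderiv ℝ g u := by
      ext v; simp [inner_gradient_left]
    rwa [h3]
  exact (snocEquiv d).hasStrictFDerivAt.comp u ((hasStrictFDerivAt_id u).prodMk h1)

theorem continuous_graphParam {g : EuclideanSpace ℝ (Fin d) → ℝ} (hg : Continuous g) :
    Continuous (graphParam g) := by
  unfold graphParam; fun_prop

theorem continuous_headCoords : Continuous (headCoords (d := d)) := by
  unfold headCoords; fun_prop

theorem continuous_gradient {g : EuclideanSpace ℝ (Fin d) → ℝ} (hg : ContDiff ℝ 1 g) :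
    Continuous (∇ g) :=
  (InnerProductSpace.toDual ℝ _).symm.continuous.comp (hg.continuous_fderiv one_ne_zero)

theorem isClosedEmbedding_graphParam {g : EuclideanSpace ℝ (Fin d) → ℝ} (hg : Continuous g) :
    IsClosedEmbedding (graphParam g) :=
  Function.LeftInverse.isClosedEmbedding (f := headCoords) (fun u => by simp [graphParam])
    continuous_headCoords (continuous_graphParam hg)

end Splitting

/-! ### The area formula for graphs -/

section AreaFormula

/-- Two maps whose distances compare have images whose Hausdorff measures compare. -/
theorem euclideanHausdorffMeasure_image_le_of_dist_le {X Y Z : Type*} [MetricSpace X]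
    [MetricSpace Y] [MeasurableSpace Y] [BorelSpace Y] [MetricSpace Z] [MeasurableSpace Z]
    [BorelSpace Z] {F : X → Y} {H : X → Z} {s : Set X} {K : ℝ≥0}
    (h : ∀ u ∈ s, ∀ v ∈ s, dist (F u) (F v) ≤ K * dist (H u) (H v)) (d : ℕ) :
    (Measure.euclideanHausdorffMeasure d : Measure Y) (F '' s) ≤
      (K : ℝ≥0∞) ^ d * (Measure.euclideanHausdorffMeasure d : Measure Z) (H '' s) := by
  rcases s.eq_empty_or_nonempty with rfl | ⟨x₀, -⟩
  · simp
  have : Nonempty X := ⟨x₀⟩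
  set φ : Z → Y := F ∘ Function.invFunOn H s with hφ
  have hinv : ∀ u ∈ s, Function.invFunOn H s (H u) ∈ s ∧
      H (Function.invFunOn H s (H u)) = H u := fun u hu =>
    ⟨Function.invFunOn_mem ⟨u, hu, rfl⟩, Function.invFunOn_eq ⟨u, hu, rfl⟩⟩
  have hφe : ∀ u ∈ s, φ (H u) = F u := by
    intro u hu
    have h1 := h _ (hinv u hu).1 u hu
    rw [(hinv u hu).2, dist_self, mul_zero] at h1
    exact dist_le_zero.1 h1
  have hlip : LipschitzOnWith K φ (H '' s) := by
    refine LipschitzOnWith.of_dist_le_mul ?_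
    rintro _ ⟨u, hu, rfl⟩ _ ⟨v, hv, rfl⟩
    rw [hφe u hu, hφe v hv]
    exact h u hu v hv
  have him : F '' s = φ '' (H '' s) := by
    rw [image_image]
    exact image_congr fun u hu => (hφe u hu).symm
  have := hlip.hausdorffMeasure_image_le (d := d) d.cast_nonneg
  rw [him, Measure.euclideanHausdorffMeasure_def, Measure.euclideanHausdorffMeasure_def,
    Measure.smul_apply, Measure.smul_apply, ENNReal.smul_def, ENNReal.smul_def, smul_eq_mul,
    smul_eq_mul, mul_left_comm]
  gcongr
  simpa using this

variable {d : ℕ} {g : EuclideanSpace ℝ (Fin d) → ℝ}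

open scoped Gradient

/-- The surface density `√(1 + |∇g|²)` of the graph of `g`. -/
def graphDensity (g : EuclideanSpace ℝ (Fin d) → ℝ) (u : EuclideanSpace ℝ (Fin d)) : ℝ :=
  √(1 + ‖∇ g u‖ ^ 2)

theorem euclideanHausdorffMeasure_graphLin_image (a : EuclideanSpace ℝ (Fin d))
    (s : Set (EuclideanSpace ℝ (Fin d))) :
    (Measure.euclideanHausdorffMeasure d : Measure (EuclideanSpace ℝ (Fin (d + 1))))
      (graphLin a '' s) = ENNReal.ofReal √(1 + ‖a‖ ^ 2) * volume s := by
  have h := LinearMap.euclideanHausdorffMeasure_image_eq_normDet_mul_volume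
    (graphLin a : EuclideanSpace ℝ (Fin d) →ₗ[ℝ] EuclideanSpace ℝ (Fin (d + 1))) s
  rw [normDet_graphLin, finrank_euclideanSpace_fin] at h
  exact h

/-- Near each point the graph parametrization distorts distances in the same way as its
derivative, up to a factor close to `1`. -/
theorem eventually_graph_measure_comparison (hg : ContDiff ℝ 1 g) (u : EuclideanSpace ℝ (Fin d))
    {ε : ℝ≥0} (hε : 0 < ε) :
    ∃ U ∈ 𝓝 u, ∀ s ⊆ U,
      (Measure.euclideanHausdorffMeasure d : Measure (EuclideanSpace ℝ (Fin (d + 1))))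
        (graphParam g '' s) ≤ (1 + ε : ℝ≥0) ^ d * (ENNReal.ofReal (graphDensity g u) * volume s) ∧
      ENNReal.ofReal (graphDensity g u) * volume s ≤ (1 + ε : ℝ≥0) ^ d *
        (Measure.euclideanHausdorffMeasure d : Measure (EuclideanSpace ℝ (Fin (d + 1))))
          (graphParam g '' s) := by
  obtain ⟨U, hU, hA⟩ := (HasStrictFDerivAt.graphParam hg u).approximates_deriv_on_nhds
    (c := ε) (Or.inr hε)
  refine ⟨U, hU, fun s hs => ⟨?_, ?_⟩⟩
  · rw [graphDensity, ← euclideanHausdorffMeasure_graphLin_image]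
    refine euclideanHausdorffMeasure_image_le_of_dist_le (fun v hv w hw => ?_) d
    have h1 := hA v (hs hv) w (hs hw)
    have h2 := norm_le_norm_graphLin (∇ g u) (v - w)
    rw [dist_eq_norm, dist_eq_norm, ← map_sub]
    calc ‖graphParam g v - graphParam g w‖
        ≤ ‖graphLin (∇ g u) (v - w)‖ +
          ‖graphParam g v - graphParam g w - graphLin (∇ g u) (v - w)‖ := by
          rw [add_comm ‖_‖]; exact norm_le_norm_sub_add _ _
      _ ≤ ‖graphLin (∇ g u) (v - w)‖ + ε * ‖graphLin (∇ g u) (v - w)‖ := by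
          gcongr; exact h1.trans (by gcongr)
      _ = _ := by push_cast; ring
  · rw [graphDensity, ← euclideanHausdorffMeasure_graphLin_image]
    refine euclideanHausdorffMeasure_image_le_of_dist_le (fun v hv w hw => ?_) d
    have h1 := hA v (hs hv) w (hs hw)
    have h2 := norm_sub_le_norm_graphParam_sub g v w
    rw [dist_eq_norm, dist_eq_norm, ← map_sub]
    calc ‖graphLin (∇ g u) (v - w)‖
        ≤ ‖graphParam g v - graphParam g w‖ +
          ‖graphParam g v - graphParam g w - graphLin (∇ g u) (v - w)‖ := by
          rw [norm_sub_rev _ (graphLin _ _), add_comm ‖_‖]; exact norm_le_norm_sub_add _ _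
      _ ≤ ‖graphParam g v - graphParam g w‖ + ε * ‖graphParam g v - graphParam g w‖ := by
          gcongr; exact h1.trans (by gcongr)
      _ = _ := by push_cast; ring

theorem graphDensity_pos (u : EuclideanSpace ℝ (Fin d)) : 0 < graphDensity g u := by
  unfold graphDensity; positivity

theorem continuous_graphDensity (hg : ContDiff ℝ 1 g) : Continuous (graphDensity g) := by
  have := continuous_gradient hg
  unfold graphDensity; fun_prop

/-- The **area formula** for the graph of a `C¹` function. The pulled back measure is absolutely
continuous, and by differentiation along balls its density at `u` is that of the linear map that
approximates the parametrization at `u`. -/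
theorem comap_graphParam_euclideanHausdorffMeasure (hg : ContDiff ℝ 1 g) :
    (Measure.euclideanHausdorffMeasure d : Measure (EuclideanSpace ℝ (Fin (d + 1)))).comap
      (graphParam g) = volume.withDensity (fun u => ENNReal.ofReal (graphDensity g u)) := by
  have hemb := (isClosedEmbedding_graphParam hg.continuous).measurableEmbedding
  set ν := (Measure.euclideanHausdorffMeasure d :
    Measure (EuclideanSpace ℝ (Fin (d + 1)))).comap (graphParam g) with hν
  have hνa : ∀ s, ν s = (Measure.euclideanHausdorffMeasure d :
      Measure (EuclideanSpace ℝ (Fin (d + 1)))) (graphParam g '' s) := fun s =>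
    hemb.comap_apply _ s
  have hlf : IsLocallyFiniteMeasure ν := by
    refine ⟨fun u => ?_⟩
    obtain ⟨U, hU, h⟩ := eventually_graph_measure_comparison hg u one_pos
    refine ⟨U ∩ Metric.closedBall u 1, inter_mem hU (Metric.closedBall_mem_nhds _ one_pos), ?_⟩
    rw [hνa]
    refine (h _ inter_subset_left).1.trans_lt ?_
    refine ENNReal.mul_lt_top (ENNReal.pow_lt_top ENNReal.coe_lt_top)
      (ENNReal.mul_lt_top ENNReal.ofReal_lt_top ?_)
    exact (measure_mono inter_subset_right).trans_lt measure_closedBall_lt_top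
  have hac : ν ≪ volume := by
    intro s hs
    refine measure_null_of_locally_null s fun u _ => ?_
    obtain ⟨U, hU, h⟩ := eventually_graph_measure_comparison hg u one_pos
    refine ⟨s ∩ U, inter_mem self_mem_nhdsWithin (nhdsWithin_le_nhds hU), ?_⟩
    rw [hνa]
    refine le_antisymm ((h _ inter_subset_right).1.trans_eq ?_) zero_le
    rw [measure_mono_null inter_subset_left hs, mul_zero, mul_zero]
  rw [← Measure.withDensity_rnDeriv_eq ν volume hac]
  refine withDensity_congr_ae ?_
  filter_upwards [Besicovitch.ae_tendsto_rnDeriv ν volume] with u hu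
  set L := ν.rnDeriv volume u
  set J := ENNReal.ofReal (graphDensity g u)
  have hball : ∀ r > 0, volume (Metric.closedBall u r) ≠ 0 ∧
      volume (Metric.closedBall u r) ≠ ∞ := fun r hr =>
    ⟨(Metric.measure_closedBall_pos _ _ hr).ne', measure_closedBall_lt_top.ne⟩
  have hcmp : ∀ ε : ℝ≥0, 0 < ε → L ≤ (1 + ε : ℝ≥0) ^ d * J ∧ J ≤ (1 + ε : ℝ≥0) ^ d * L := by
    intro ε hε
    obtain ⟨U, hU, h⟩ := eventually_graph_measure_comparison hg u hε
    have hev : ∀ᶠ r in 𝓝[>] (0 : ℝ), 0 < r ∧ Metric.closedBall u r ⊆ U := by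
      obtain ⟨r₀, hr₀, hsub⟩ := Metric.nhds_basis_closedBall.mem_iff.1 hU
      filter_upwards [Ioc_mem_nhdsGT hr₀] with r hr
      exact ⟨hr.1, (Metric.closedBall_subset_closedBall hr.2).trans hsub⟩
    constructor
    · refine le_of_tendsto hu ?_
      filter_upwards [hev] with r hr
      rw [ENNReal.div_le_iff (hball r hr.1).1 (hball r hr.1).2, hνa, mul_assoc]
      exact (h _ hr.2).1
    · refine ge_of_tendsto (ENNReal.Tendsto.const_mul hu
        (Or.inr (ENNReal.pow_ne_top ENNReal.coe_ne_top))) ?_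
      filter_upwards [hev] with r hr
      rw [← mul_div_assoc, ENNReal.le_div_iff_mul_le (Or.inl (hball r hr.1).1)
        (Or.inl (hball r hr.1).2), hνa]
      exact (h _ hr.2).2
  have hlim : ∀ M : ℝ≥0∞, Tendsto (fun ε : ℝ≥0 => ((1 + ε : ℝ≥0) : ℝ≥0∞) ^ d * M) (𝓝[>] 0)
      (𝓝 M) := by
    intro M
    have h1 : Tendsto (fun ε : ℝ≥0 => (((1 + ε) ^ d : ℝ≥0) : ℝ≥0∞)) (𝓝[>] 0) (𝓝 1) := by
      rw [← ENNReal.coe_one, ENNReal.tendsto_coe]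
      have : Tendsto (fun ε : ℝ≥0 => (1 + ε) ^ d) (𝓝 0) (𝓝 ((1 + 0) ^ d)) :=
        Continuous.tendsto (by fun_prop) 0
      simp only [add_zero, one_pow] at this
      exact this.mono_left nhdsWithin_le_nhds
    have h2 := ENNReal.Tendsto.mul_const (b := M) h1 (Or.inl one_ne_zero)
    simpa using h2
  refine le_antisymm (ge_of_tendsto (hlim J) ?_) (ge_of_tendsto (hlim L) ?_)
  · filter_upwards [self_mem_nhdsWithin] with ε hε using (hcmp ε hε).1
  · filter_upwards [self_mem_nhdsWithin] with ε hε using (hcmp ε hε).2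

end AreaFormula

/-! ### Charts of a `C^{1,α}` boundary -/

section Charts

open scoped Gradient

variable {d : ℕ}

theorem headCoords_sub (x y : EuclideanSpace ℝ (Fin (d + 1))) :
    headCoords (x - y) = headCoords x - headCoords y := by
  ext i; simp [headCoords]

theorem norm_headCoords_le (x : EuclideanSpace ℝ (Fin (d + 1))) : ‖headCoords x‖ ≤ ‖x‖ := by
  simpa using norm_fst_le_norm_snocEquiv (headCoords x, x (Fin.last d))

theorem outwardNormal_eq {E : Type*} [NormedAddCommGroup E] [InnerProductSpace ℝ E] {Ω : Set E}
    {x v : E} (h : IsOutwardUnitNormal Ω x v) : outwardNormal Ω x = v := by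
  have h' : ∃ v, IsOutwardUnitNormal Ω x v := ⟨v, h⟩
  rw [outwardNormal, dif_pos h']
  exact IsOutwardUnitNormal.unique h'.choose_spec h

/-- A representation of `Ω` in a ball about `p` as the region above the graph of a `C^{1,α}`
function, in the coordinates given by a linear isometry. -/
structure LocalGraph (Ω : Set (EuclideanSpace ℝ (Fin (d + 1)))) (α : ℝ)
    (p : EuclideanSpace ℝ (Fin (d + 1))) where
  T : EuclideanSpace ℝ (Fin (d + 1)) ≃ₗᵢ[ℝ] EuclideanSpace ℝ (Fin (d + 1))
  g : EuclideanSpace ℝ (Fin d) → ℝ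
  C : ℝ
  r : ℝ
  C_nonneg : 0 ≤ C
  r_pos : 0 < r
  contDiff : ContDiff ℝ 1 g
  holder : ∀ u v, ‖fderiv ℝ g u - fderiv ℝ g v‖ ≤ C * ‖u - v‖ ^ α
  mem_iff : ∀ x ∈ Metric.ball p r, (x ∈ Ω ↔ g (headCoords (T x)) < T x (Fin.last d))

theorem C1HolderDomain.nonempty_localGraph {α : ℝ} (D : C1HolderDomain d α)
    {p : EuclideanSpace ℝ (Fin (d + 1))} (hp : p ∈ frontier D.carrier) :
    Nonempty (LocalGraph D.carrier α p) := by
  obtain ⟨T, g, C, r, hr, hg, hC, h⟩ := D.boundary p hp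
  exact ⟨⟨T, g, |C|, r, abs_nonneg _, hr, hg, fun u v => (hC u v).trans (by
    gcongr; exact le_abs_self C), h⟩⟩

namespace LocalGraph

variable {Ω : Set (EuclideanSpace ℝ (Fin (d + 1)))} {α : ℝ} {p : EuclideanSpace ℝ (Fin (d + 1))}
  (L : LocalGraph Ω α p)

/-- The point of `ℝ^d` over which `x` lies. -/
def base (x : EuclideanSpace ℝ (Fin (d + 1))) : EuclideanSpace ℝ (Fin d) := headCoords (L.T x)

/-- The parametrization of the graph. -/
def param (u : EuclideanSpace ℝ (Fin d)) : EuclideanSpace ℝ (Fin (d + 1)) :=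
  L.T.symm (graphParam L.g u)

/-- The outward normal vector `(∇g, -1)` of the graph, whose length is the surface density. -/
def conormal (u : EuclideanSpace ℝ (Fin d)) : EuclideanSpace ℝ (Fin (d + 1)) :=
  L.T.symm (snocEquiv d (∇ L.g u, -1))

theorem continuous_base : Continuous L.base :=
  continuous_headCoords.comp L.T.continuous

theorem continuous_param : Continuous L.param :=
  L.T.symm.continuous.comp (continuous_graphParam L.contDiff.continuous)

@[simp]
theorem base_param (u : EuclideanSpace ℝ (Fin d)) : L.base (L.param u) = u := by
  simp [base, param, graphParam]

theorem norm_base_sub_le (x y : EuclideanSpace ℝ (Fin (d + 1))) :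
    ‖L.base x - L.base y‖ ≤ ‖x - y‖ := by
  rw [base, base, ← headCoords_sub, ← map_sub]
  exact (norm_headCoords_le _).trans_eq (L.T.norm_map _)

theorem norm_conormal (u : EuclideanSpace ℝ (Fin d)) : ‖L.conormal u‖ = graphDensity L.g u := by
  rw [conormal, LinearIsometryEquiv.norm_map, graphDensity, eq_comm,
    Real.sqrt_eq_iff_mul_self_eq (by positivity) (norm_nonneg _), ← sq, norm_sq_snocEquiv]
  norm_num; ring

theorem one_le_graphDensity (u : EuclideanSpace ℝ (Fin d)) : 1 ≤ graphDensity L.g u := by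
  rw [graphDensity, Real.one_le_sqrt]; nlinarith [sq_nonneg ‖∇ L.g u‖]

theorem isClosedEmbedding_param : IsClosedEmbedding L.param :=
  L.T.symm.toHomeomorph.isClosedEmbedding.comp
    (isClosedEmbedding_graphParam L.contDiff.continuous)

/-- For points `x`, `y` of the graph and `u` the base point of `y` this is the negative of a first
order Taylor remainder of `g`. -/
theorem inner_conormal (x y : EuclideanSpace ℝ (Fin (d + 1))) (u : EuclideanSpace ℝ (Fin d)) :
    inner ℝ (x - y) (L.conormal u) = fderiv ℝ L.g u (L.base x - L.base y) -
      (L.T x (Fin.last d) - L.T y (Fin.last d)) := by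
  rw [conormal, ← L.T.inner_map_map, LinearIsometryEquiv.apply_symm_apply, map_sub]
  conv_lhs => rw [← snocEquiv_headCoords (L.T x - L.T y)]
  rw [inner_snocEquiv, headCoords_sub, real_inner_comm, inner_gradient_left, base, base]
  simp; ring

theorem param_base_of_eq {x : EuclideanSpace ℝ (Fin (d + 1))}
    (h : L.g (L.base x) = L.T x (Fin.last d)) : L.param (L.base x) = x := by
  rw [param, graphParam, h, base, snocEquiv_headCoords, LinearIsometryEquiv.symm_apply_apply]

/-- In the ball of the chart the boundary is the graph. -/
theorem mem_frontier_iff (hΩ : IsOpen Ω) {x : EuclideanSpace ℝ (Fin (d + 1))}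
    (hx : x ∈ Metric.ball p L.r) :
    x ∈ frontier Ω ↔ L.g (L.base x) = L.T x (Fin.last d) := by
  have hlast : Continuous (fun x => L.T x (Fin.last d)) := by fun_prop
  have hgc : Continuous (fun x => L.g (L.base x)) := L.contDiff.continuous.comp L.continuous_base
  constructor
  · intro hxf
    have hnot : x ∉ Ω := by
      rw [hΩ.frontier_eq] at hxf
      exact hxf.2
    have hle : L.T x (Fin.last d) ≤ L.g (L.base x) := by
      by_contra h
      exact hnot ((L.mem_iff x hx).2 (not_le.1 h))
    refine le_antisymm ?_ hle
    by_contra h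
    have hopen : {y | L.T y (Fin.last d) < L.g (L.base y)} ∩ Metric.ball p L.r ∈ 𝓝 x :=
      ((isOpen_lt hlast hgc).inter Metric.isOpen_ball).mem_nhds ⟨not_le.1 h, hx⟩
    obtain ⟨y, hy, hyΩ⟩ := mem_closure_iff_nhds.1 (frontier_subset_closure hxf) _ hopen
    exact lt_asymm hy.1 ((L.mem_iff y hy.2).1 hyΩ)
  · intro hxe
    rw [hΩ.frontier_eq]
    refine ⟨?_, fun h => (((L.mem_iff x hx).1 h).ne hxe)⟩
    -- The points above `x` in the direction of the last coordinate belong to `Ω`.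
    set e := L.T.symm (snocEquiv d (0, 1)) with he
    have hTe : ∀ t : ℝ, L.T (x + t • e) = L.T x + t • snocEquiv d (0, 1) := fun t => by
      rw [map_add, map_smul, he, LinearIsometryEquiv.apply_symm_apply]
    have hb : ∀ t : ℝ, L.base (x + t • e) = L.base x := fun t => by
      rw [base, hTe, base]
      ext i; simp [headCoords]
    have hl : ∀ t : ℝ, L.T (x + t • e) (Fin.last d) = L.T x (Fin.last d) + t := fun t => by
      rw [hTe]; simp
    have hcont : Tendsto (fun t : ℝ => x + t • e) (𝓝[>] 0) (𝓝 x) := by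
      have : Tendsto (fun t : ℝ => x + t • e) (𝓝 0) (𝓝 (x + (0 : ℝ) • e)) := by
        apply Continuous.tendsto; fun_prop
      rw [zero_smul, add_zero] at this
      exact this.mono_left nhdsWithin_le_nhds
    refine mem_closure_of_tendsto hcont ?_
    filter_upwards [hcont.eventually (Metric.isOpen_ball.mem_nhds hx), self_mem_nhdsWithin]
      with t ht (ht0 : 0 < t)
    rw [L.mem_iff _ ht]
    change L.g (L.base (x + t • e)) < _
    rw [hb, hl, hxe]
    linarith

/-- The normalized vector `(∇g, -1)` is the outward unit normal vector, by the differentiability of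
`g`. -/
theorem isOutwardUnitNormal (hΩ : IsOpen Ω) {x : EuclideanSpace ℝ (Fin (d + 1))}
    (hx : x ∈ Metric.ball p L.r) (hxf : x ∈ frontier Ω) :
    IsOutwardUnitNormal Ω x ((graphDensity L.g (L.base x))⁻¹ • L.conormal (L.base x)) := by
  set J := graphDensity L.g (L.base x) with hJ
  have hJ1 : 1 ≤ J := L.one_le_graphDensity _
  refine ⟨?_, fun ε hε => ?_⟩
  · rw [norm_smul, norm_conormal, norm_inv, Real.norm_of_nonneg (by linarith),
      inv_mul_cancel₀ (by linarith)]
  have hder := ((L.contDiff.differentiable one_ne_zero (L.base x)).hasFDerivAt.isLittleO.def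
    hε)
  have hev := L.continuous_base.continuousAt.eventually hder
  filter_upwards [hev, Metric.isOpen_ball.mem_nhds hx] with y hy hyb
  have hin := L.inner_conormal y x (L.base x)
  have hxe := (L.mem_frontier_iff hΩ hx).1 hxf
  have hmem := L.mem_iff y hyb
  change _ ↔ L.g (L.base y) < _ at hmem
  have h1 : |L.g (L.base y) - L.T y (Fin.last d) - inner ℝ (y - x) (L.conormal (L.base x))| ≤
      ε * ‖y - x‖ := by
    calc _ = ‖L.g (L.base y) - L.g (L.base x) -
          fderiv ℝ L.g (L.base x) (L.base y - L.base x)‖ := by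
          rw [Real.norm_eq_abs, hin, hxe]; congr 1; ring
      _ ≤ ε * ‖L.base y - L.base x‖ := hy
      _ ≤ _ := by gcongr; exact L.norm_base_sub_le y x
  rw [abs_le] at h1
  rw [inner_smul_right]
  have hyx : 0 ≤ ε * ‖y - x‖ := by positivity
  have hscale : ∀ a : ℝ, J * (J⁻¹ * a) = a := fun a => by field_simp
  set a := inner ℝ (y - x) (L.conormal (L.base x))
  constructor
  · intro h
    rw [hmem]
    have := mul_lt_mul_of_pos_left h (by linarith : 0 < J)
    rw [hscale] at this
    nlinarith
  · intro h hyΩ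
    have h2 := hmem.1 hyΩ
    have := mul_lt_mul_of_pos_left h (by linarith : 0 < J)
    rw [hscale] at this
    nlinarith

theorem conormal_holder (u v : EuclideanSpace ℝ (Fin d)) :
    ‖L.conormal u - L.conormal v‖ ≤ L.C * ‖u - v‖ ^ α := by
  have h : L.conormal u - L.conormal v = L.T.symm (snocEquiv d (∇ L.g u - ∇ L.g v, 0)) := by
    rw [conormal, conormal, ← map_sub L.T.symm, ← map_sub (snocEquiv d), Prod.mk_sub_mk, sub_self]
  have h2 : ‖snocEquiv d (∇ L.g u - ∇ L.g v, 0)‖ = ‖∇ L.g u - ∇ L.g v‖ := by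
    rw [← sq_eq_sq₀ (norm_nonneg _) (norm_nonneg _), norm_sq_snocEquiv]; simp
  rw [h, LinearIsometryEquiv.norm_map, h2, gradient, gradient, ← map_sub,
    LinearIsometryEquiv.norm_map]
  exact L.holder u v

/-- The remainder of the first order Taylor expansion of a `C^{1,α}` function. -/
theorem abs_taylor_le (hα : 0 ≤ α) (u v : EuclideanSpace ℝ (Fin d)) :
    |L.g u - L.g v - fderiv ℝ L.g v (u - v)| ≤ L.C * ‖u - v‖ ^ α * ‖u - v‖ := by
  refine Convex.norm_image_sub_le_of_norm_fderiv_le' (𝕜 := ℝ) (f := L.g) (s := segment ℝ v u)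
    (fun z _ => L.contDiff.differentiable one_ne_zero z) (fun z hz => ?_) (convex_segment v u)
    (left_mem_segment ℝ v u) (right_mem_segment ℝ v u)
  refine (L.holder z v).trans ?_
  have : ‖z - v‖ ≤ ‖u - v‖ := norm_sub_le_of_mem_segment hz
  have hC := L.C_nonneg
  gcongr

end LocalGraph

end Charts

/-! ### The surface measure and the normal vector -/

section SurfaceGeometry

open scoped Gradient

variable {d : ℕ}

namespace LocalGraph

variable {Ω : Set (EuclideanSpace ℝ (Fin (d + 1)))} {α : ℝ} {p : EuclideanSpace ℝ (Fin (d + 1))}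
  (L : LocalGraph Ω α p)

/-- The surface measure of the graph in the coordinates of `ℝ^d`. -/
def chartMeasure : Measure (EuclideanSpace ℝ (Fin d)) :=
  volume.withDensity (fun u => ENNReal.ofReal (graphDensity L.g u))

theorem map_param_chartMeasure :
    L.chartMeasure.map L.param =
      (Measure.euclideanHausdorffMeasure d).restrict (range L.param) := by
  have hemb := L.isClosedEmbedding_param.measurableEmbedding
  have hemb' := (isClosedEmbedding_graphParam L.contDiff.continuous).measurableEmbedding
  ext s hs
  rw [hemb.map_apply, chartMeasure, ← comap_graphParam_euclideanHausdorffMeasure L.contDiff,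
    hemb'.comap_apply, Measure.restrict_apply hs, inter_comm, ← image_preimage_eq_range_inter,
    ← L.T.symm.isometry.euclideanHausdorffMeasure_image, image_image]
  rfl

theorem frontier_inter_ball (hΩ : IsOpen Ω) :
    frontier Ω ∩ Metric.ball p L.r = range L.param ∩ Metric.ball p L.r := by
  ext x
  constructor
  · rintro ⟨h1, h2⟩
    exact ⟨⟨L.base x, L.param_base_of_eq ((L.mem_frontier_iff hΩ h2).1 h1)⟩, h2⟩
  · rintro ⟨⟨u, rfl⟩, h2⟩
    refine ⟨(L.mem_frontier_iff hΩ h2).2 ?_, h2⟩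
    rw [base_param]
    simp [param, graphParam]

/-- In a ball the surface measure is the image of the measure of the chart. -/
theorem restrict_ball (hΩ : IsOpen Ω) {s : Set (EuclideanSpace ℝ (Fin (d + 1)))}
    (hs : s ⊆ Metric.ball p L.r) (hsm : MeasurableSet s) :
    ((Measure.euclideanHausdorffMeasure d).restrict (frontier Ω)).restrict s =
      (L.chartMeasure.map L.param).restrict s := by
  rw [map_param_chartMeasure, Measure.restrict_restrict hsm, Measure.restrict_restrict hsm]
  congr 1
  have h := L.frontier_inter_ball hΩ
  ext x
  have hx : x ∈ Metric.ball p L.r → (x ∈ frontier Ω ↔ x ∈ range L.param) := fun hxb => by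
    simpa [hxb] using congrArg (x ∈ ·) h
  constructor <;> rintro ⟨h1, h2⟩ <;> have := hx (hs h1) <;> tauto

theorem surface_apply (hΩ : IsOpen Ω) {s : Set (EuclideanSpace ℝ (Fin (d + 1)))}
    (hs : s ⊆ Metric.ball p L.r) (hsm : MeasurableSet s) :
    ((Measure.euclideanHausdorffMeasure d).restrict (frontier Ω)) s =
      ∫⁻ u in L.param ⁻¹' s, ENNReal.ofReal (graphDensity L.g u) := by
  have h := congrArg (fun ν => ν s) (L.restrict_ball hΩ hs hsm)
  simp only [Measure.restrict_apply_self] at h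
  rw [h, L.isClosedEmbedding_param.measurableEmbedding.map_apply, chartMeasure,
    withDensity_apply _ (hsm.preimage L.continuous_param.measurable)]

/-- An integral over `∂Ω` of a function that vanishes outside the ball of the chart. -/
theorem integral_surface {F : Type*} [NormedAddCommGroup F] [NormedSpace ℝ F] (hΩ : IsOpen Ω)
    {h : EuclideanSpace ℝ (Fin (d + 1)) → F} (hh : ∀ x ∉ Metric.ball p L.r, h x = 0) :
    ∫ x, h x ∂((Measure.euclideanHausdorffMeasure d).restrict (frontier Ω)) =
      ∫ u, graphDensity L.g u • h (L.param u) := by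
  have hc := continuous_graphDensity L.contDiff
  rw [← setIntegral_eq_integral_of_forall_compl_eq_zero hh,
    L.restrict_ball hΩ Subset.rfl measurableSet_ball,
    setIntegral_eq_integral_of_forall_compl_eq_zero hh,
    L.isClosedEmbedding_param.measurableEmbedding.integral_map, chartMeasure,
    integral_withDensity_eq_integral_toReal_smul (by fun_prop) (by simp)]
  simp only [ENNReal.toReal_ofReal (graphDensity_pos _).le]

end LocalGraph

/-- A property that depends monotonically on constants and that holds locally on a compact set holds
there with uniform constants. -/
theorem exists_uniform_of_locally {X : Type*} [TopologicalSpace X] {S : Set X} (hS : IsCompact S)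
    {P : ℝ → ℝ → X → Prop}
    (mono : ∀ {δ δ' C C' : ℝ} {x : X}, δ' ≤ δ → C ≤ C' → P δ C x → P δ' C' x)
    (h : ∀ p ∈ S, ∃ U ∈ 𝓝 p, ∃ δ > 0, ∃ C ≥ 0, ∀ x ∈ S, x ∈ U → P δ C x) :
    ∃ δ > 0, ∃ C ≥ 0, ∀ x ∈ S, P δ C x := by
  refine hS.induction_on (p := fun s => ∃ δ > 0, ∃ C ≥ 0, ∀ x ∈ s, P δ C x) ?_ ?_ ?_ ?_
  · exact ⟨1, one_pos, 0, le_rfl, by simp⟩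
  · rintro s t hst ⟨δ, hδ, C, hC, h⟩
    exact ⟨δ, hδ, C, hC, fun x hx => h x (hst hx)⟩
  · rintro s t ⟨δ, hδ, C, hC, h⟩ ⟨δ', hδ', C', hC', h'⟩
    refine ⟨min δ δ', lt_min hδ hδ', max C C', hC.trans (le_max_left _ _), ?_⟩
    rintro x (hx | hx)
    · exact mono (min_le_left _ _) (le_max_left _ _) (h x hx)
    · exact mono (min_le_right _ _) (le_max_right _ _) (h' x hx)
  · intro p hp
    obtain ⟨U, hU, δ, hδ, C, hC, h⟩ := h p hp
    exact ⟨S ∩ U, inter_mem self_mem_nhdsWithin (nhdsWithin_le_nhds hU), δ, hδ, C, hC,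
      fun x hx => h x hx.1 hx.2⟩

/-- A bound by a power of the distance that holds near each point of a compact set holds globally,
if the left-hand side is bounded. -/
theorem exists_forall_le_rpow_of_locally {E : Type*} [NormedAddCommGroup E] {S : Set E}
    (hS : IsCompact S) {Q : E → E → ℝ} {β M : ℝ} (hβ : 0 ≤ β)
    (hM : ∀ x ∈ S, ∀ y ∈ S, Q x y ≤ M)
    (h : ∀ p ∈ S, ∃ r > 0, ∃ C ≥ 0, ∀ x ∈ S, ∀ y ∈ S, x ∈ Metric.ball p r → y ∈ Metric.ball p r →
      Q x y ≤ C * ‖x - y‖ ^ β) :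
    ∃ C ≥ 0, ∀ x ∈ S, ∀ y ∈ S, Q x y ≤ C * ‖x - y‖ ^ β := by
  obtain ⟨δ, hδ, C, hC, hu⟩ := exists_uniform_of_locally hS
    (P := fun δ C x => ∀ y ∈ S, ‖x - y‖ < δ → Q x y ≤ C * ‖x - y‖ ^ β)
    (fun {δ δ' C C' x} hδ hC h y hy hxy => (h y hy (hxy.trans_le hδ)).trans (by gcongr))
    (fun p hp => by
      obtain ⟨r, hr, C, hC, h⟩ := h p hp
      refine ⟨Metric.ball p (r / 2), Metric.ball_mem_nhds _ (half_pos hr), r / 2, half_pos hr, C, hC,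
        fun x hx hxp y hy hxy => h x hx y hy (Metric.ball_subset_ball (by linarith) hxp) ?_⟩
      rw [Metric.mem_ball] at hxp ⊢
      rw [← dist_eq_norm, dist_comm] at hxy
      linarith [dist_triangle y x p])
  refine ⟨max C (|M| * (δ ^ β)⁻¹), hC.trans (le_max_left _ _), fun x hx y hy => ?_⟩
  rcases lt_or_ge ‖x - y‖ δ with hlt | hge
  · exact (hu x hx y hy hlt).trans (by gcongr; exact le_max_left _ _)
  · have h1 : 1 ≤ (δ ^ β)⁻¹ * ‖x - y‖ ^ β := by
      rw [inv_mul_eq_div, one_le_div (by positivity)]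
      gcongr
    calc Q x y ≤ |M| * 1 := by rw [mul_one]; exact (hM x hx y hy).trans (le_abs_self M)
      _ ≤ |M| * ((δ ^ β)⁻¹ * ‖x - y‖ ^ β) := by gcongr
      _ = |M| * (δ ^ β)⁻¹ * ‖x - y‖ ^ β := by ring
      _ ≤ _ := by gcongr; exact le_max_right _ _

/-- Normalization of vectors of length at least one is `2`-Lipschitz. -/
theorem norm_normalize_sub_le {E : Type*} [NormedAddCommGroup E] [NormedSpace ℝ E] {a b : E}
    (ha : 1 ≤ ‖a‖) (hb : 1 ≤ ‖b‖) : ‖‖a‖⁻¹ • a - ‖b‖⁻¹ • b‖ ≤ 2 * ‖a - b‖ := by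
  have ha0 : 0 < ‖a‖ := by linarith
  have hb0 : 0 < ‖b‖ := by linarith
  have e : ‖a‖⁻¹ • a - ‖b‖⁻¹ • b = ‖a‖⁻¹ • (a - b) + (‖a‖⁻¹ * (‖b‖ - ‖a‖) * ‖b‖⁻¹) • b := by
    rw [smul_sub, sub_add, ← sub_smul]
    congr 2
    field_simp
    ring
  rw [e]
  calc _ ≤ ‖a‖⁻¹ * ‖a - b‖ + ‖a‖⁻¹ * |‖b‖ - ‖a‖| := by
        refine (norm_add_le _ _).trans (add_le_add (by rw [norm_smul, norm_inv, norm_norm]) ?_)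
        rw [norm_smul, Real.norm_eq_abs, abs_mul, abs_mul, abs_inv, abs_inv, abs_norm, abs_norm,
          mul_assoc, inv_mul_cancel₀ hb0.ne', mul_one]
    _ ≤ 1 * ‖a - b‖ + 1 * ‖a - b‖ := by
        have h1 : ‖a‖⁻¹ ≤ 1 := inv_le_one_of_one_le₀ ha
        have h2 : |‖b‖ - ‖a‖| ≤ ‖a - b‖ := by
          rw [norm_sub_rev]; exact abs_norm_sub_norm_le b a
        gcongr
    _ = _ := by ring

namespace C1HolderDomain

variable {α : ℝ} (D : C1HolderDomain d α)

theorem isCompact_frontier : IsCompact (frontier D.carrier) :=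
  Metric.isCompact_of_isClosed_isBounded isClosed_frontier
    (D.isBounded.closure.subset frontier_subset_closure)

theorem normal_eq {p x : EuclideanSpace ℝ (Fin (d + 1))} (L : LocalGraph D.carrier α p)
    (hx : x ∈ Metric.ball p L.r) (hxf : x ∈ frontier D.carrier) :
    D.normal x = (graphDensity L.g (L.base x))⁻¹ • L.conormal (L.base x) :=
  outwardNormal_eq (L.isOutwardUnitNormal D.isOpen hx hxf)

theorem isOutwardUnitNormal_normal {x : EuclideanSpace ℝ (Fin (d + 1))}
    (hx : x ∈ frontier D.carrier) : IsOutwardUnitNormal D.carrier x (D.normal x) := by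
  obtain ⟨L⟩ := D.nonempty_localGraph hx
  have hb := Metric.mem_ball_self (x := x) L.r_pos
  rw [D.normal_eq L hb hx]
  exact L.isOutwardUnitNormal D.isOpen hb hx

theorem norm_normal {x : EuclideanSpace ℝ (Fin (d + 1))} (hx : x ∈ frontier D.carrier) :
    ‖D.normal x‖ = 1 := (D.isOutwardUnitNormal_normal hx).1

theorem ae_mem_frontier : ∀ᵐ x ∂D.surfaceMeasure, x ∈ frontier D.carrier :=
  ae_restrict_mem isClosed_frontier.measurableSet

/-- The normal vector is Hölder continuous of exponent `α`. -/
theorem exists_norm_normal_sub_le (hα : 0 ≤ α) :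
    ∃ C ≥ 0, ∀ x ∈ frontier D.carrier, ∀ y ∈ frontier D.carrier,
      ‖D.normal x - D.normal y‖ ≤ C * ‖x - y‖ ^ α := by
  refine exists_forall_le_rpow_of_locally D.isCompact_frontier (M := 2) hα (fun x hx y hy => ?_)
    (fun p hp => ?_)
  · refine (norm_sub_le _ _).trans ?_
    rw [D.norm_normal hx, D.norm_normal hy]; norm_num
  · obtain ⟨L⟩ := D.nonempty_localGraph hp
    have hC := L.C_nonneg
    refine ⟨L.r, L.r_pos, 2 * L.C, by positivity, fun x hx y hy hxb hyb => ?_⟩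
    rw [D.normal_eq L hxb hx, D.normal_eq L hyb hy, ← L.norm_conormal, ← L.norm_conormal]
    refine (norm_normalize_sub_le ?_ ?_).trans ?_
    · rw [L.norm_conormal]; exact L.one_le_graphDensity _
    · rw [L.norm_conormal]; exact L.one_le_graphDensity _
    · rw [mul_assoc]
      gcongr
      refine (L.conormal_holder _ _).trans ?_
      gcongr
      exact L.norm_base_sub_le x y

/-- The cancellation that makes the kernel weakly singular: the boundary leaves its tangent plane at
`y` by `O(|x - y| ^ (1 + α))` only. -/
theorem exists_abs_inner_normal_le (hα : 0 ≤ α) :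
    ∃ C ≥ 0, ∀ x ∈ frontier D.carrier, ∀ y ∈ frontier D.carrier,
      |inner ℝ (x - y) (D.normal y)| ≤ C * ‖x - y‖ ^ (1 + α) := by
  refine exists_forall_le_rpow_of_locally D.isCompact_frontier
    (M := Metric.diam (frontier D.carrier)) (by positivity) (fun x hx y hy => ?_) (fun p hp => ?_)
  · refine (abs_real_inner_le_norm _ _).trans ?_
    rw [D.norm_normal hy, mul_one, ← dist_eq_norm]
    exact Metric.dist_le_diam_of_mem D.isCompact_frontier.isBounded hx hy
  · obtain ⟨L⟩ := D.nonempty_localGraph hp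
    have hC := L.C_nonneg
    refine ⟨L.r, L.r_pos, L.C, hC, fun x hx y hy hxb hyb => ?_⟩
    have hJ := L.one_le_graphDensity (L.base y)
    rw [D.normal_eq L hyb hy, inner_smul_right, L.inner_conormal, abs_mul, abs_inv,
      abs_of_pos (graphDensity_pos _), ← (L.mem_frontier_iff D.isOpen hxb).1 hx,
      ← (L.mem_frontier_iff D.isOpen hyb).1 hy, abs_sub_comm]
    calc _ ≤ 1 * (L.C * ‖L.base x - L.base y‖ ^ α * ‖L.base x - L.base y‖) := by
          gcongr
          · exact inv_le_one_of_one_le₀ hJ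
          · exact L.abs_taylor_le hα _ _
      _ ≤ L.C * ‖x - y‖ ^ α * ‖x - y‖ := by
          rw [one_mul]
          have := L.norm_base_sub_le x y
          gcongr
      _ = L.C * ‖x - y‖ ^ (1 + α) := by
          rw [Real.rpow_one_add' (norm_nonneg _) (by positivity)]; ring

theorem continuousOn_normal (hα : 0 < α) : ContinuousOn D.normal (frontier D.carrier) := by
  obtain ⟨C, hC, h⟩ := D.exists_norm_normal_sub_le hα.le
  intro x hx
  rw [ContinuousWithinAt, tendsto_iff_norm_sub_tendsto_zero]
  have hlim : Tendsto (fun y => C * ‖y - x‖ ^ α) (𝓝[frontier D.carrier] x) (𝓝 0) := by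
    have : ContinuousAt (fun y => C * ‖y - x‖ ^ α) x := by
      refine ContinuousAt.mul continuousAt_const (ContinuousAt.rpow_const (by fun_prop) (Or.inr hα.le))
    have h0 := this.tendsto
    simp only [sub_self, norm_zero, Real.zero_rpow hα.ne', mul_zero] at h0
    exact h0.mono_left nhdsWithin_le_nhds
  refine squeeze_zero' (Eventually.of_forall fun _ => norm_nonneg _) ?_ hlim
  filter_upwards [self_mem_nhdsWithin] with y hy using h y hy x hx

theorem aestronglyMeasurable_normal (hα : 0 < α) :
    AEStronglyMeasurable D.normal D.surfaceMeasure :=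
  (D.continuousOn_normal hα).aestronglyMeasurable isClosed_frontier.measurableSet

/-- The surface measure is upper Ahlfors regular of dimension `d`. -/
theorem exists_upperRegularAt :
    ∃ A ≥ 0, ∀ x ∈ frontier D.carrier, UpperRegularAt D.surfaceMeasure d A x := by
  obtain ⟨δ, hδ, A, hA, hu⟩ := exists_uniform_of_locally D.isCompact_frontier
    (P := fun δ A x => ∀ ρ > 0, ρ < δ →
      D.surfaceMeasure (Metric.closedBall x ρ) ≤ ENNReal.ofReal (A * ρ ^ d))
    (fun {δ δ' A A' x} hδ hA h ρ hρ hρδ => (h ρ hρ (hρδ.trans_le hδ)).trans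
      (ENNReal.ofReal_le_ofReal (by gcongr)))
    (fun p hp => by
      obtain ⟨L⟩ := D.nonempty_localGraph hp
      have hr := L.r_pos
      obtain ⟨M, hM⟩ := (isCompact_closedBall (L.base p) L.r).exists_bound_of_continuousOn
        (continuous_graphDensity L.contDiff).continuousOn
      have hM0 : 0 ≤ M := (norm_nonneg _).trans (hM _ (Metric.mem_closedBall_self hr.le))
      refine ⟨Metric.ball p (L.r / 2), Metric.ball_mem_nhds _ (half_pos hr), L.r / 2, half_pos hr,
        M * volume.real (Metric.ball (0 : EuclideanSpace ℝ (Fin d)) 1), by positivity,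
        fun x hx hxp ρ hρ hρδ => ?_⟩
      have hsub : Metric.closedBall x ρ ⊆ Metric.ball p L.r :=
        Metric.closedBall_subset_ball' (by rw [Metric.mem_ball] at hxp; linarith)
      have hpre : L.param ⁻¹' Metric.closedBall x ρ ⊆ Metric.closedBall (L.base x) ρ := by
        intro u hu
        rw [mem_preimage, Metric.mem_closedBall, dist_eq_norm] at hu
        rw [Metric.mem_closedBall, dist_eq_norm]
        have := L.norm_base_sub_le (L.param u) x
        rw [L.base_param] at this
        linarith
      have hsub2 : Metric.closedBall (L.base x) ρ ⊆ Metric.closedBall (L.base p) L.r := by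
        refine Metric.closedBall_subset_closedBall' ?_
        have := L.norm_base_sub_le x p
        rw [Metric.mem_ball, dist_eq_norm] at hxp
        rw [dist_eq_norm]
        linarith
      rw [surfaceMeasure, L.surface_apply D.isOpen hsub Metric.isClosed_closedBall.measurableSet]
      calc ∫⁻ u in L.param ⁻¹' Metric.closedBall x ρ, ENNReal.ofReal (graphDensity L.g u)
          ≤ ∫⁻ u in Metric.closedBall (L.base x) ρ, ENNReal.ofReal (graphDensity L.g u) :=
            lintegral_mono_set hpre
        _ ≤ ∫⁻ u in Metric.closedBall (L.base x) ρ, ENNReal.ofReal M := by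
            refine setLIntegral_mono measurable_const fun u hu => ENNReal.ofReal_le_ofReal ?_
            exact (le_abs_self _).trans (hM u (hsub2 hu))
        _ = ENNReal.ofReal M * volume (Metric.closedBall (L.base x) ρ) := setLIntegral_const _ _
        _ = _ := by
            rw [Measure.addHaar_closedBall volume _ hρ.le, finrank_euclideanSpace_fin,
              ← ENNReal.ofReal_toReal (measure_ball_lt_top (x := (0 : EuclideanSpace ℝ (Fin d)))
                (μ := volume) (r := 1)).ne, ← ENNReal.ofReal_mul (by positivity),
              ← ENNReal.ofReal_mul hM0, Measure.real]
            congr 1; ring)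
  set m := D.surfaceMeasure.real univ with hm
  refine ⟨max A (m * (δ ^ d)⁻¹), hA.trans (le_max_left _ _), fun x hx ρ hρ => ?_⟩
  rcases lt_or_ge ρ δ with hlt | hge
  · exact (hu x hx ρ hρ hlt).trans (ENNReal.ofReal_le_ofReal (by gcongr; exact le_max_left _ _))
  · have h1 : 1 ≤ (δ ^ d)⁻¹ * ρ ^ d := by
      rw [inv_mul_eq_div, one_le_div (by positivity)]
      gcongr
    calc D.surfaceMeasure (Metric.closedBall x ρ) ≤ D.surfaceMeasure univ :=
          measure_mono (subset_univ _)
      _ = ENNReal.ofReal (m * 1) := by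
          rw [mul_one, hm, Measure.real, ENNReal.ofReal_toReal (measure_ne_top _ _)]
      _ ≤ ENNReal.ofReal (max A (m * (δ ^ d)⁻¹) * ρ ^ d) := by
          refine ENNReal.ofReal_le_ofReal ?_
          calc m * 1 ≤ m * ((δ ^ d)⁻¹ * ρ ^ d) := by gcongr
            _ = m * (δ ^ d)⁻¹ * ρ ^ d := by ring
            _ ≤ _ := by gcongr; exact le_max_right _ _

/-- The surface measure is lower Ahlfors regular of dimension `d`. -/
theorem exists_lowerRegular :
    ∃ δ > 0, ∃ K ≥ 0, ∀ x ∈ frontier D.carrier, ∀ ρ > 0, ρ < δ →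
      ENNReal.ofReal (ρ ^ d) ≤
        ENNReal.ofReal K * D.surfaceMeasure (Metric.closedBall x ρ) := by
  refine exists_uniform_of_locally D.isCompact_frontier
    (P := fun δ K x => ∀ ρ > 0, ρ < δ →
      ENNReal.ofReal (ρ ^ d) ≤ ENNReal.ofReal K * D.surfaceMeasure (Metric.closedBall x ρ))
    (fun {δ δ' K K' x} hδ hK h ρ hρ hρδ => (h ρ hρ (hρδ.trans_le hδ)).trans (by gcongr))
    (fun p hp => ?_)
  obtain ⟨L⟩ := D.nonempty_localGraph hp
  have hr := L.r_pos
  set ω := volume.real (Metric.ball (0 : EuclideanSpace ℝ (Fin d)) 1) with hω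
  have hω0 : 0 < ω := ENNReal.toReal_pos (Metric.measure_ball_pos _ _ one_pos).ne'
    measure_ball_lt_top.ne
  obtain ⟨K, s, hs, hK⟩ :=
    (HasStrictFDerivAt.graphParam L.contDiff (L.base p)).exists_lipschitzOnWith
  obtain ⟨η, hη, hηs⟩ := Metric.mem_nhds_iff.1 hs
  set δ := min (L.r / 2) (η / 2) with hδ
  have hδ0 : 0 < δ := lt_min (half_pos hr) (half_pos hη)
  refine ⟨Metric.ball p δ, Metric.ball_mem_nhds _ hδ0, δ, hδ0,
    (K + 1) ^ d * ω⁻¹, by positivity, fun x hx hxp ρ hρ hρδ => ?_⟩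
  have hδ1 : δ ≤ L.r / 2 := min_le_left _ _
  have hδ2 : δ ≤ η / 2 := min_le_right _ _
  rw [Metric.mem_ball] at hxp
  have hxb : x ∈ Metric.ball p L.r := by rw [Metric.mem_ball]; linarith
  have hsub : Metric.closedBall x ρ ⊆ Metric.ball p L.r :=
    Metric.closedBall_subset_ball' (by linarith)
  have hbase : dist (L.base x) (L.base p) < η / 2 := by
    rw [dist_eq_norm] at hxp ⊢
    linarith [L.norm_base_sub_le x p]
  have hK1 : (0 : ℝ) < K + 1 := by positivity
  have hpre : Metric.closedBall (L.base x) (ρ / (K + 1)) ⊆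
      L.param ⁻¹' Metric.closedBall x ρ := by
    intro u hu
    rw [Metric.mem_closedBall] at hu
    have hle : ρ / (K + 1) ≤ ρ := div_le_self hρ.le (by linarith [K.coe_nonneg])
    have hus : u ∈ s := hηs (by
      rw [Metric.mem_ball]
      linarith [dist_triangle u (L.base x) (L.base p)])
    have hxs : L.base x ∈ s := hηs (by rw [Metric.mem_ball]; linarith)
    have h1 := hK.dist_le_mul u hus _ hxs
    rw [mem_preimage, Metric.mem_closedBall]
    calc dist (L.param u) x = dist (L.param u) (L.param (L.base x)) := by
          rw [L.param_base_of_eq ((L.mem_frontier_iff D.isOpen hxb).1 hx)]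
      _ = dist (graphParam L.g u) (graphParam L.g (L.base x)) := L.T.symm.dist_map _ _
      _ ≤ K * dist u (L.base x) := h1
      _ ≤ (K + 1) * (ρ / (K + 1)) := by gcongr; linarith
      _ = ρ := by field_simp
  rw [surfaceMeasure, L.surface_apply D.isOpen hsub Metric.isClosed_closedBall.measurableSet]
  have hlow : ENNReal.ofReal ((ρ / (K + 1)) ^ d * ω) ≤
      ∫⁻ u in L.param ⁻¹' Metric.closedBall x ρ, ENNReal.ofReal (graphDensity L.g u) := by
    calc ENNReal.ofReal ((ρ / (K + 1)) ^ d * ω)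
        = volume (Metric.closedBall (L.base x) (ρ / (K + 1))) := by
          rw [Measure.addHaar_closedBall volume _ (by positivity), finrank_euclideanSpace_fin,
            ENNReal.ofReal_mul (by positivity), hω, Measure.real,
            ENNReal.ofReal_toReal measure_ball_lt_top.ne]
      _ = ∫⁻ u in Metric.closedBall (L.base x) (ρ / (K + 1)), 1 := (setLIntegral_one _).symm
      _ ≤ ∫⁻ u in Metric.closedBall (L.base x) (ρ / (K + 1)),
            ENNReal.ofReal (graphDensity L.g u) := by
          refine lintegral_mono fun u => ?_
          rw [← ENNReal.ofReal_one]
          exact ENNReal.ofReal_le_ofReal (L.one_le_graphDensity u)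
      _ ≤ _ := lintegral_mono_set hpre
  calc ENNReal.ofReal (ρ ^ d)
      = ENNReal.ofReal ((K + 1) ^ d * ω⁻¹) * ENNReal.ofReal ((ρ / (K + 1)) ^ d * ω) := by
        rw [← ENNReal.ofReal_mul (by positivity)]
        congr 1
        rw [div_pow]
        field_simp
    _ ≤ _ := by gcongr

end C1HolderDomain

end SurfaceGeometry

/-! ### The Gauss–Green formula -/

section GaussGreenGraph

variable {V : Type*} [NormedAddCommGroup V] [NormedSpace ℝ V] [FiniteDimensional ℝ V]
  [MeasurableSpace V] [BorelSpace V]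

theorem integral_fderiv_eq_zero {μ : Measure V} [μ.IsAddHaarMeasure] {f : V → ℝ}
    (hf : ContDiff ℝ 1 f) (hc : HasCompactSupport f) (v : V) : ∫ x, fderiv ℝ f x v ∂μ = 0 := by
  have hd : Continuous (fun x => fderiv ℝ f x v) :=
    (hf.continuous_fderiv one_ne_zero).clm_apply continuous_const
  have h := integral_bilinear_hasFDerivAt_right_eq_neg_left_of_integrable (μ := μ)
    (f := fun _ : V => (1 : ℝ)) (f' := fun _ => 0) (g := f) (g' := fderiv ℝ f) (v := v)
    (B := ContinuousLinearMap.mul ℝ ℝ) (by simp)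
    (by simpa using hd.integrable_of_hasCompactSupport (hc.fderiv_apply (𝕜 := ℝ) v))
    (by simpa using hf.continuous.integrable_of_hasCompactSupport hc)
    (fun x _ => hasFDerivAt_const _ _)
    (fun x _ => (hf.differentiable one_ne_zero x).hasFDerivAt)
  simpa using h

theorem hasCompactSupport_slice {X Y Z : Type*} [TopologicalSpace X] [TopologicalSpace Y] [Zero Z]
    [T2Space X] [T2Space Y] {f : X × Y → Z} (hf : HasCompactSupport f) :
    (∀ x, HasCompactSupport (fun y => f (x, y))) ∧ ∀ y, HasCompactSupport (fun x => f (x, y)) := by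
  refine ⟨fun x => HasCompactSupport.intro (hf.image continuous_snd) fun y hy => ?_,
    fun y => HasCompactSupport.intro (hf.image continuous_fst) fun x hx => ?_⟩
  · by_contra h
    exact hy ⟨(x, y), subset_tsupport _ h, rfl⟩
  · by_contra h
    exact hx ⟨(x, y), subset_tsupport _ h, rfl⟩

variable [SecondCountableTopology V] {μ : Measure V} [μ.IsAddHaarMeasure]

/-- The Gauss–Green formula in a half-space. -/
theorem integral_halfSpace_fderiv {G : V × ℝ → ℝ} (hG : ContDiff ℝ 1 G) (hc : HasCompactSupport G)
    {b : V → ℝ} (hb : Continuous b) (a : V) :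
    ∫ z in {z : V × ℝ | 0 < z.2}, fderiv ℝ G z (a, b z.1) ∂(μ.prod volume) =
      -∫ u, b u * G (u, 0) ∂μ := by
  have hset : {z : V × ℝ | 0 < z.2} = univ ×ˢ Ioi 0 := by ext; simp
  have hdc : Continuous (fun z => fderiv ℝ G z) := hG.continuous_fderiv one_ne_zero
  have hdiff : ∀ z, HasFDerivAt G (fderiv ℝ G z) z := fun z =>
    (hG.differentiable one_ne_zero z).hasFDerivAt
  set k₁ : V × ℝ → ℝ := fun z => fderiv ℝ G z (a, 0) with hk₁
  set k₂ : V × ℝ → ℝ := fun z => b z.1 * fderiv ℝ G z (0, 1) with hk₂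
  have hsplit : ∀ z, fderiv ℝ G z (a, b z.1) = k₁ z + k₂ z := by
    intro z
    have : (a, b z.1) = (a, (0 : ℝ)) + b z.1 • ((0 : V), (1 : ℝ)) := by simp
    rw [this, map_add, map_smul, smul_eq_mul]
  have hi₁ : Integrable k₁ (μ.prod volume) :=
    (hdc.clm_apply continuous_const).integrable_of_hasCompactSupport (hc.fderiv_apply (𝕜 := ℝ) _)
  have hi₂ : Integrable k₂ (μ.prod volume) := by
    refine Continuous.integrable_of_hasCompactSupport ?_ (hc.fderiv_apply (𝕜 := ℝ) _).mul_left
    exact (hb.comp continuous_fst).mul (hdc.clm_apply continuous_const)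
  have hr : (μ.prod volume).restrict {z : V × ℝ | 0 < z.2} =
      μ.prod (volume.restrict (Ioi 0)) := by
    rw [hset, ← Measure.prod_restrict, Measure.restrict_univ]
  have e₁ : ∫ z in {z : V × ℝ | 0 < z.2}, k₁ z ∂(μ.prod volume) = 0 := by
    have hi := hi₁.restrict (s := {z : V × ℝ | 0 < z.2})
    rw [hr] at hi ⊢
    rw [integral_prod_symm _ hi]
    refine (integral_congr_ae (Eventually.of_forall fun t => ?_)).trans (integral_zero _ _)
    have h1 : ContDiff ℝ 1 (fun u => G (u, t)) := hG.comp (by fun_prop)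
    have h2 : ∀ u, fderiv ℝ (fun u => G (u, t)) u a = k₁ (u, t) := by
      intro u
      have : HasFDerivAt (fun u : V => (u, t)) ((ContinuousLinearMap.id ℝ V).prod 0) u :=
        (hasFDerivAt_id u).prodMk (hasFDerivAt_const t u)
      have := ((hdiff (u, t)).comp u this).fderiv
      simp only [Function.comp_def] at this
      rw [this]
      simp [hk₁]
    simp only [← h2]
    exact integral_fderiv_eq_zero h1 ((hasCompactSupport_slice hc).2 t) a
  have e₂ : ∫ z in {z : V × ℝ | 0 < z.2}, k₂ z ∂(μ.prod volume) = -∫ u, b u * G (u, 0) ∂μ := by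
    have hi := hi₂.restrict (s := {z : V × ℝ | 0 < z.2})
    rw [hr] at hi ⊢
    rw [integral_prod _ hi, ← integral_neg]
    refine integral_congr_ae (Eventually.of_forall fun u => ?_)
    have h1 : ContDiff ℝ 1 (fun t => G (u, t)) := hG.comp (by fun_prop)
    have h2 : ∀ t, deriv (fun t => G (u, t)) t = fderiv ℝ G (u, t) (0, 1) := by
      intro t
      have : HasDerivAt (fun t : ℝ => (u, t)) ((0 : V), (1 : ℝ)) t :=
        (hasDerivAt_const t u).prodMk (hasDerivAt_id t)
      exact ((hdiff (u, t)).comp_hasDerivAt t this).deriv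
    simp only [hk₂, ← h2]
    rw [integral_const_mul, ((hasCompactSupport_slice hc).1 u).integral_Ioi_deriv_eq h1 0]
    ring
  simp only [hsplit]
  rw [integral_add hi₁.restrict hi₂.restrict, e₁, e₂, zero_add]

/-- The Gauss–Green formula in the region above a graph. -/
theorem integral_epigraph_fderiv {H : V × ℝ → ℝ} (hH : ContDiff ℝ 1 H) (hc : HasCompactSupport H)
    {g : V → ℝ} (hg : ContDiff ℝ 1 g) (a : V) (b : ℝ) :
    ∫ z in {z : V × ℝ | g z.1 < z.2}, fderiv ℝ H z (a, b) ∂(μ.prod volume) =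
      ∫ u, H (u, g u) * (fderiv ℝ g u a - b) ∂μ := by
  set S : V × ℝ → V × ℝ := fun z => (z.1, g z.1 + z.2) with hS
  have hSd : ContDiff ℝ 1 S := contDiff_fst.prodMk ((hg.comp contDiff_fst).add contDiff_snd)
  have hSm : MeasurePreserving S (μ.prod volume) (μ.prod volume) :=
    (MeasurePreserving.id μ).skew_product (g := fun u t => g u + t)
      (((hg.continuous.comp continuous_fst).add continuous_snd).measurable)
      (Eventually.of_forall fun u => (measurePreserving_add_left volume (g u)).map_eq)
  have hSe : MeasurableEmbedding S := by
    have hinv : Function.LeftInverse (fun z : V × ℝ => (z.1, z.2 - g z.1)) S := fun z => by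
      simp [hS]
    refine (hinv.isClosedEmbedding ?_ hSd.continuous).measurableEmbedding
    have := hg.continuous
    fun_prop
  have hGc : HasCompactSupport (H ∘ S) := by
    refine HasCompactSupport.intro (K := (fun z : V × ℝ => (z.1, z.2 - g z.1)) '' tsupport H)
      (hc.image (by have := hg.continuous; fun_prop)) fun z hz => ?_
    by_contra h
    exact hz ⟨S z, subset_tsupport _ h, by simp [hS]⟩
  have key := integral_halfSpace_fderiv (μ := μ) (hH.comp hSd) hGc
    (b := fun u => b - fderiv ℝ g u a)
    (continuous_const.sub ((hg.continuous_fderiv one_ne_zero).clm_apply continuous_const)) a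
  have hder : ∀ z, fderiv ℝ (H ∘ S) z (a, b - fderiv ℝ g z.1 a) = fderiv ℝ H (S z) (a, b) := by
    intro z
    rw [fderiv_comp z (hH.differentiable one_ne_zero _) (hSd.differentiable one_ne_zero _)]
    have hSf : HasFDerivAt S ((ContinuousLinearMap.fst ℝ V ℝ).prod
        ((fderiv ℝ g z.1).comp (ContinuousLinearMap.fst ℝ V ℝ) +
          ContinuousLinearMap.snd ℝ V ℝ)) z :=
      hasFDerivAt_fst.prodMk
        (((hg.differentiable one_ne_zero z.1).hasFDerivAt.comp z hasFDerivAt_fst).add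
          hasFDerivAt_snd)
    rw [hSf.fderiv]
    simp
  have hpre : {z : V × ℝ | 0 < z.2} = S ⁻¹' {z : V × ℝ | g z.1 < z.2} := by
    ext z; simp [hS]
  rw [← hSm.setIntegral_preimage_emb hSe, ← hpre]
  simp only [hder] at key
  rw [key, ← integral_neg]
  refine integral_congr_ae (Eventually.of_forall fun u => ?_)
  simp only [Function.comp_apply, hS, add_zero]
  ring

end GaussGreenGraph

section GaussGreenDomain

open scoped Gradient

variable {d : ℕ}

/-- The Gauss–Green formula for functions supported in the ball of a chart. -/
theorem LocalGraph.gaussGreen {Ω : Set (EuclideanSpace ℝ (Fin (d + 1)))} (hΩ : IsOpen Ω) {α : ℝ}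
    {p : EuclideanSpace ℝ (Fin (d + 1))} (L : LocalGraph Ω α p)
    {h : EuclideanSpace ℝ (Fin (d + 1)) → ℝ} (hh : ContDiff ℝ 1 h) (hc : HasCompactSupport h)
    (hs : tsupport h ⊆ Metric.ball p L.r) (e : EuclideanSpace ℝ (Fin (d + 1))) :
    ∫ x in Ω, fderiv ℝ h x e =
      ∫ x, h x * inner ℝ e ((graphDensity L.g (L.base x))⁻¹ • L.conormal (L.base x))
        ∂((Measure.euclideanHausdorffMeasure d).restrict (frontier Ω)) := by
  set ψ : (EuclideanSpace ℝ (Fin d) × ℝ) ≃L[ℝ] EuclideanSpace ℝ (Fin (d + 1)) :=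
    (snocEquiv d).trans L.T.symm.toContinuousLinearEquiv with hψ
  have hψa : ∀ z, ψ z = L.T.symm (snocEquiv d z) := fun z => rfl
  have hψm : MeasurePreserving ψ (volume.prod volume) volume :=
    L.T.symm.measurePreserving.comp (measurePreserving_snocEquiv d)
  have hψe : MeasurableEmbedding ψ := ψ.toHomeomorph.measurableEmbedding
  obtain ⟨⟨a, b⟩, rfl⟩ := ψ.surjective e
  have hHc : HasCompactSupport (h ∘ ψ) := hc.comp_homeomorph ψ.toHomeomorph
  have key := integral_epigraph_fderiv (μ := volume) (hh.comp ψ.contDiff) hHc L.contDiff a b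
  have hder : ∀ z, fderiv ℝ (h ∘ ψ) z (a, b) = fderiv ℝ h (ψ z) (ψ (a, b)) := by
    intro z
    rw [fderiv_comp z (hh.differentiable one_ne_zero _) ψ.differentiableAt, ψ.fderiv]
    rfl
  have hzero : ∀ x ∉ Metric.ball p L.r, h x = 0 := fun x hx =>
    image_eq_zero_of_notMem_tsupport fun h' => hx (hs h')
  have hzero' : ∀ x ∉ Metric.ball p L.r, fderiv ℝ h x = 0 := fun x hx =>
    image_eq_zero_of_notMem_tsupport fun h' => hx (hs (tsupport_fderiv_subset ℝ h'))
  have hlast : Continuous (fun x => L.T x (Fin.last d)) := by fun_prop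
  have hgc : Continuous (fun x => L.g (L.base x)) := L.contDiff.continuous.comp L.continuous_base
  have hEpi : MeasurableSet {x | L.g (L.base x) < L.T x (Fin.last d)} :=
    (isOpen_lt hgc hlast).measurableSet
  have e1 : ∫ x in Ω, fderiv ℝ h x (ψ (a, b)) =
      ∫ x in {x | L.g (L.base x) < L.T x (Fin.last d)}, fderiv ℝ h x (ψ (a, b)) := by
    rw [← integral_indicator hΩ.measurableSet, ← integral_indicator hEpi]
    refine integral_congr_ae (Eventually.of_forall fun x => ?_)
    by_cases hx : x ∈ Metric.ball p L.r
    · have := L.mem_iff x hx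
      change _ ↔ x ∈ {x | L.g (L.base x) < L.T x (Fin.last d)} at this
      by_cases h1 : x ∈ Ω
      · simp only [indicator_of_mem h1, indicator_of_mem (this.1 h1)]
      · simp only [indicator_of_notMem h1, indicator_of_notMem (fun h2 => h1 (this.2 h2))]
    · simp [indicator, hzero' x hx]
  have e2 : {z : EuclideanSpace ℝ (Fin d) × ℝ | L.g z.1 < z.2} =
      ψ ⁻¹' {x | L.g (L.base x) < L.T x (Fin.last d)} := by
    ext z
    simp [hψa, LocalGraph.base]
  rw [e1, ← hψm.setIntegral_preimage_emb hψe, ← e2]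
  simp only [hder] at key
  rw [key, L.integral_surface hΩ (fun x hx => by rw [hzero x hx, zero_mul])]
  refine integral_congr_ae (Eventually.of_forall fun u => ?_)
  have hJ := (graphDensity_pos (g := L.g) u).ne'
  have hin : inner ℝ (ψ (a, b)) (L.conormal u) = fderiv ℝ L.g u a - b := by
    rw [hψa, LocalGraph.conormal, LinearIsometryEquiv.inner_map_map, inner_snocEquiv,
      real_inner_comm, inner_gradient_left]
    ring
  simp only [L.base_param, inner_smul_right, hin, smul_eq_mul, Function.comp_apply]
  have : ψ (u, L.g u) = L.param u := rfl
  rw [this]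
  field_simp

namespace C1HolderDomain

variable {α : ℝ} (D : C1HolderDomain d α)

theorem isCompact_closure : IsCompact (closure D.carrier) := D.isBounded.isCompact_closure

theorem integrable_mul_inner_normal (hα : 0 < α) {h : EuclideanSpace ℝ (Fin (d + 1)) → ℝ}
    (hh : Continuous h) (e : EuclideanSpace ℝ (Fin (d + 1))) :
    Integrable (fun x => h x * inner ℝ e (D.normal x)) D.surfaceMeasure := by
  have hc : ContinuousOn (fun x => h x * inner ℝ e (D.normal x)) (frontier D.carrier) :=
    hh.continuousOn.mul (continuousOn_const.inner (D.continuousOn_normal hα))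
  have := hc.integrableOn_compact (μ := D.surfaceMeasure) D.isCompact_frontier
  rwa [IntegrableOn, surfaceMeasure, Measure.restrict_restrict isClosed_frontier.measurableSet,
    inter_self] at this

theorem integrableOn_fderiv {h : EuclideanSpace ℝ (Fin (d + 1)) → ℝ}
    (hh : ContDiff ℝ 1 h) (e : EuclideanSpace ℝ (Fin (d + 1))) :
    IntegrableOn (fun x => fderiv ℝ h x e) D.carrier := by
  have hc : Continuous (fun x => fderiv ℝ h x e) :=
    (hh.continuous_fderiv one_ne_zero).clm_apply continuous_const
  exact (hc.continuousOn.integrableOn_compact D.isCompact_closure).mono_set subset_closure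

/-- The **Gauss–Green formula** for a bounded domain with `C^{1,α}` boundary. -/
theorem gaussGreen (hα : 0 < α) {h : EuclideanSpace ℝ (Fin (d + 1)) → ℝ} (hh : ContDiff ℝ 1 h)
    (e : EuclideanSpace ℝ (Fin (d + 1))) :
    ∫ x in D.carrier, fderiv ℝ h x e = ∫ x, h x * inner ℝ e (D.normal x) ∂D.surfaceMeasure := by
  -- a cutoff function `χ` with the property that the formula holds for the products `χ h`; those of
  -- two sets are combined to `χ + χ' (1 - χ)`
  have main : ∃ χ : EuclideanSpace ℝ (Fin (d + 1)) → ℝ, ContDiff ℝ 1 χ ∧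
      (∀ x ∈ closure D.carrier, χ =ᶠ[𝓝 x] 1) ∧
      ∀ h : EuclideanSpace ℝ (Fin (d + 1)) → ℝ, ContDiff ℝ 1 h →
        ∫ x in D.carrier, fderiv ℝ (χ * h) x e =
          ∫ x, (χ * h) x * inner ℝ e (D.normal x) ∂D.surfaceMeasure := by
    refine D.isCompact_closure.induction_on (p := fun s => ∃ χ : EuclideanSpace ℝ (Fin (d + 1)) → ℝ,
      ContDiff ℝ 1 χ ∧ (∀ x ∈ s, χ =ᶠ[𝓝 x] 1) ∧
      ∀ h : EuclideanSpace ℝ (Fin (d + 1)) → ℝ, ContDiff ℝ 1 h →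
        ∫ x in D.carrier, fderiv ℝ (χ * h) x e =
          ∫ x, (χ * h) x * inner ℝ e (D.normal x) ∂D.surfaceMeasure) ?_ ?_ ?_ ?_
    · refine ⟨0, contDiff_const, by simp, fun h _ => ?_⟩
      simp
    · rintro s t hst ⟨χ, h1, h2, h3⟩
      exact ⟨χ, h1, fun x hx => h2 x (hst hx), h3⟩
    · rintro s t ⟨χ, h1, h2, h3⟩ ⟨χ', h1', h2', h3'⟩
      refine ⟨χ + χ' * (1 - χ), h1.add (h1'.mul (contDiff_const.sub h1)), ?_, fun h hh => ?_⟩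
      · rintro x (hx | hx)
        · filter_upwards [h2 x hx] with y hy
          simp [hy]
        · filter_upwards [h2' x hx] with y hy
          simp [hy]
      · have hh2 : ContDiff ℝ 1 ((1 - χ) * h) := (contDiff_const.sub h1).mul hh
        have c1 : ContDiff ℝ 1 (χ * h) := h1.mul hh
        have c2 : ContDiff ℝ 1 (χ' * ((1 - χ) * h)) := h1'.mul hh2
        have e0 : (χ + χ' * (1 - χ)) * h = χ * h + χ' * ((1 - χ) * h) := by ring
        have e1 : ∀ x, fderiv ℝ (χ * h + χ' * ((1 - χ) * h)) x e =
            fderiv ℝ (χ * h) x e + fderiv ℝ (χ' * ((1 - χ) * h)) x e := fun x => by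
          rw [fderiv_add (c1.differentiable one_ne_zero x) (c2.differentiable one_ne_zero x)]
          rfl
        rw [e0]
        simp only [e1, Pi.add_apply, add_mul]
        rw [integral_add (D.integrableOn_fderiv c1 e) (D.integrableOn_fderiv c2 e),
          integral_add (D.integrable_mul_inner_normal hα c1.continuous e)
            (D.integrable_mul_inner_normal hα c2.continuous e), h3 h hh, h3' _ hh2]
    · intro p hp
      have hbump : ∀ r > 0, ∃ χ : EuclideanSpace ℝ (Fin (d + 1)) → ℝ, ContDiff ℝ 1 χ ∧
          HasCompactSupport χ ∧ tsupport χ ⊆ Metric.ball p r ∧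
          ∀ x ∈ Metric.ball p (r / 4), χ =ᶠ[𝓝 x] 1 := by
        intro r hr
        let χ : ContDiffBump p := ⟨r / 4, r / 2, by positivity, by linarith⟩
        refine ⟨χ, χ.contDiff, χ.hasCompactSupport, ?_, fun x hx => ?_⟩
        · rw [χ.tsupport_eq]
          exact Metric.closedBall_subset_ball (by simp only [χ]; linarith)
        · filter_upwards [Metric.isOpen_ball.mem_nhds hx] with y hy
          exact χ.one_of_mem_closedBall (Metric.ball_subset_closedBall hy)
      by_cases hpΩ : p ∈ D.carrier
      · obtain ⟨r, hr, hsub⟩ := Metric.mem_nhds_iff.1 (D.isOpen.mem_nhds hpΩ)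
        obtain ⟨χ, h1, h2, h3, h4⟩ := hbump r hr
        refine ⟨Metric.ball p (r / 4), mem_nhdsWithin_of_mem_nhds
          (Metric.ball_mem_nhds _ (by positivity)), χ, h1, h4, fun h hh => ?_⟩
        have c1 : ContDiff ℝ 1 (χ * h) := h1.mul hh
        have hz : ∀ x ∉ D.carrier, (χ * h) x = 0 := fun x hx => by
          rw [Pi.mul_apply, image_eq_zero_of_notMem_tsupport fun h' => hx (hsub (h3 h')), zero_mul]
        have hz' : ∀ x ∉ D.carrier, fderiv ℝ (χ * h) x e = 0 := fun x hx => by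
          rw [image_eq_zero_of_notMem_tsupport (f := fderiv ℝ (χ * h)) fun h' => hx (hsub (h3
            (closure_mono (Function.support_mul_subset_left χ h)
              (tsupport_fderiv_subset ℝ h'))))]
          rfl
        rw [setIntegral_eq_integral_of_forall_compl_eq_zero hz',
          integral_fderiv_eq_zero c1 h2.mul_right, eq_comm]
        refine (integral_congr_ae ?_).trans (integral_zero _ _)
        filter_upwards [D.ae_mem_frontier] with x hx
        rw [D.isOpen.frontier_eq] at hx
        rw [hz x hx.2, zero_mul]
      · have hpf : p ∈ frontier D.carrier := by
          rw [D.isOpen.frontier_eq]; exact ⟨hp, hpΩ⟩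
        obtain ⟨L⟩ := D.nonempty_localGraph hpf
        obtain ⟨χ, h1, h2, h3, h4⟩ := hbump L.r L.r_pos
        refine ⟨Metric.ball p (L.r / 4), mem_nhdsWithin_of_mem_nhds
          (Metric.ball_mem_nhds _ (by have := L.r_pos; positivity)), χ, h1, h4, fun h hh => ?_⟩
        have c1 : ContDiff ℝ 1 (χ * h) := h1.mul hh
        have hsub : tsupport (χ * h) ⊆ Metric.ball p L.r :=
          (closure_mono (Function.support_mul_subset_left χ h)).trans h3
        rw [L.gaussGreen D.isOpen c1 h2.mul_right hsub]
        refine integral_congr_ae ?_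
        filter_upwards [D.ae_mem_frontier] with x hx
        by_cases hxb : x ∈ Metric.ball p L.r
        · rw [D.normal_eq L hxb hx]
        · rw [image_eq_zero_of_notMem_tsupport fun h' => hxb (hsub h'), zero_mul, zero_mul]
  obtain ⟨χ, h1, h2, h3⟩ := main
  have e1 : ∀ x ∈ D.carrier, fderiv ℝ h x e = fderiv ℝ (χ * h) x e := fun x hx => by
    have : χ * h =ᶠ[𝓝 x] h := by
      filter_upwards [h2 x (subset_closure hx)] with y hy
      simp [hy]
    rw [this.fderiv_eq]
  rw [setIntegral_congr_fun D.isOpen.measurableSet e1, h3 h hh]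
  refine integral_congr_ae ?_
  filter_upwards [D.ae_mem_frontier] with x hx
  have := (h2 x (frontier_subset_closure hx)).self_of_nhds
  simp [this]

end C1HolderDomain

end GaussGreenDomain

/-! ### The solid angle -/

section SolidAngle

variable {d : ℕ}

/-- The smooth approximation `(|y - x|² + ε²) ^ q` of `|y - x| ^ (2 q)`. -/
def smoothPow (q ε : ℝ) (x y : EuclideanSpace ℝ (Fin (d + 1))) : ℝ := (‖y - x‖ ^ 2 + ε ^ 2) ^ q

theorem hasFDerivAt_smoothPow (q : ℝ) {ε : ℝ} (hε : 0 < ε) (x y : EuclideanSpace ℝ (Fin (d + 1))) :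
    HasFDerivAt (smoothPow q ε x)
      ((2 * q * smoothPow (q - 1) ε x y) • innerSL ℝ (y - x)) y := by
  have h1 : HasFDerivAt (fun y : EuclideanSpace ℝ (Fin (d + 1)) => ‖y - x‖ ^ 2 + ε ^ 2)
      (2 • innerSL ℝ (y - x)) y := by
    have := (((hasFDerivAt_id y).sub_const x).norm_sq).add_const (ε ^ 2)
    simpa using this
  have h2 := h1.rpow_const (p := q) (Or.inl (by positivity))
  refine h2.congr_fderiv ?_
  rw [smoothPow, ← Nat.cast_smul_eq_nsmul ℝ, smul_smul]
  congr 1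
  push_cast; ring

theorem contDiff_smoothPow (q : ℝ) {ε : ℝ} (hε : 0 < ε) (x : EuclideanSpace ℝ (Fin (d + 1))) :
    ContDiff ℝ 1 (smoothPow q ε x) := by
  unfold smoothPow
  refine ContDiff.rpow_const_of_ne ?_ fun y => by positivity
  exact ((contDiff_id.sub contDiff_const).norm_sq ℝ).add contDiff_const

/-- The divergence of `(y - x) (|y - x|² + ε²) ^ (-(d + 1) / 2)`, as a function of
`z = (y - x) / ε` and up to the factor `ε ^ (-(d + 1))`. -/
def solidAngleDensity (z : EuclideanSpace ℝ (Fin (d + 1))) : ℝ :=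
  (d + 1) * (1 + ‖z‖ ^ 2) ^ (-((d + 3 : ℝ) / 2))

theorem integrable_solidAngleDensity :
    Integrable (solidAngleDensity (d := d)) := by
  unfold solidAngleDensity
  have := integrable_rpow_neg_one_add_norm_sq (E := EuclideanSpace ℝ (Fin (d + 1)))
    (μ := volume) (r := d + 3) (by rw [finrank_euclideanSpace_fin]; push_cast; linarith)
  refine Integrable.const_mul ?_ _
  rwa [show -((d : ℝ) + 3) / 2 = -(((d : ℝ) + 3) / 2) by ring] at this

theorem sum_fderiv_eq {ε : ℝ} (hε : 0 < ε) (x y : EuclideanSpace ℝ (Fin (d + 1))) :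
    ∑ i : Fin (d + 1), fderiv ℝ (fun y : EuclideanSpace ℝ (Fin (d + 1)) =>
        (y - x) i * smoothPow (-((d + 1 : ℝ) / 2)) ε x y) y (EuclideanSpace.single i 1) =
      (ε ^ (d + 1))⁻¹ * solidAngleDensity (ε⁻¹ • (y - x)) := by
  set q : ℝ := -((d + 1 : ℝ) / 2) with hq
  have hD : ∀ i : Fin (d + 1), fderiv ℝ (fun y : EuclideanSpace ℝ (Fin (d + 1)) =>
        (y - x) i * smoothPow q ε x y) y (EuclideanSpace.single i 1) =
      smoothPow q ε x y + 2 * q * smoothPow (q - 1) ε x y * ((y - x) i * (y - x) i) := by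
    intro i
    have h1 : HasFDerivAt (fun y : EuclideanSpace ℝ (Fin (d + 1)) => (y - x) i)
        (EuclideanSpace.proj i : EuclideanSpace ℝ (Fin (d + 1)) →L[ℝ] ℝ) y := by
      exact ((EuclideanSpace.proj i : EuclideanSpace ℝ (Fin (d + 1)) →L[ℝ] ℝ).hasFDerivAt.comp y
        ((hasFDerivAt_id y).sub_const x)).congr_fderiv (ContinuousLinearMap.comp_id _)
    rw [(h1.fun_mul (hasFDerivAt_smoothPow q hε x y)).fderiv]
    simp [EuclideanSpace.inner_single_right]
    ring
  simp only [hD]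
  rw [Finset.sum_add_distrib, ← Finset.mul_sum]
  have hn : ∑ i, (y - x) i * (y - x) i = ‖y - x‖ ^ 2 := by
    rw [EuclideanSpace.real_norm_sq_eq]
    simp only [sq]
  rw [hn]
  set R := ‖y - x‖ ^ 2 with hR
  have hR0 : 0 ≤ R := by positivity
  have hpos : 0 < R + ε ^ 2 := by positivity
  have h1 : smoothPow q ε x y = (R + ε ^ 2) * (R + ε ^ 2) ^ (q - 1) := by
    rw [smoothPow, ← hR, ← Real.rpow_one_add' hpos.le (by rw [hq]; intro h; linarith [d.cast_nonneg (α := ℝ)])]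
    congr 1; ring
  have h2 : (1 + ‖ε⁻¹ • (y - x)‖ ^ 2) = (ε ^ 2)⁻¹ * (R + ε ^ 2) := by
    rw [norm_smul, mul_pow, norm_inv, Real.norm_of_nonneg hε.le, ← hR]
    field_simp
    ring
  have h3 : ((ε ^ 2)⁻¹ : ℝ) ^ (-((d + 3 : ℝ) / 2)) = ε ^ (d + 1) * ε ^ 2 := by
    rw [Real.inv_rpow (by positivity), ← Real.rpow_neg (by positivity), neg_neg,
      ← pow_add, ← Real.rpow_natCast ε 2, ← Real.rpow_mul hε.le, ← Real.rpow_natCast]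
    congr 1; push_cast; ring
  have hq1 : q - 1 = -((d + 3 : ℝ) / 2) := by rw [hq]; ring
  rw [solidAngleDensity, h2, Real.mul_rpow (by positivity) hpos.le, h3, h1, smoothPow, ← hR, hq1]
  simp only [Finset.sum_const, Finset.card_univ, Fintype.card_fin, nsmul_eq_mul]
  push_cast
  field_simp
  rw [hq]; ring

namespace C1HolderDomain

variable {α : ℝ} (D : C1HolderDomain d α)

/-- The Gauss–Green formula for the field `(y - x) (|y - x|² + ε²) ^ (-(d + 1) / 2)`, in the blown up
coordinates `z = (y - x) / ε`. -/
theorem flux_smoothPow (hα : 0 < α) {ε : ℝ} (hε : 0 < ε) (x : EuclideanSpace ℝ (Fin (d + 1))) :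
    ∫ y, smoothPow (-((d + 1 : ℝ) / 2)) ε x y * inner ℝ (y - x) (D.normal y) ∂D.surfaceMeasure =
      ∫ z in {z | x + ε • z ∈ D.carrier}, solidAngleDensity z := by
  set q : ℝ := -((d + 1 : ℝ) / 2) with hq
  set h : Fin (d + 1) → EuclideanSpace ℝ (Fin (d + 1)) → ℝ := fun i y =>
    (y - x) i * smoothPow q ε x y with hh
  have hhd : ∀ i, ContDiff ℝ 1 (h i) := fun i => by
    refine ContDiff.mul ?_ (contDiff_smoothPow q hε x)
    exact (EuclideanSpace.proj i : EuclideanSpace ℝ (Fin (d + 1)) →L[ℝ] ℝ).contDiff.comp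
      (contDiff_id.sub contDiff_const)
  calc ∫ y, smoothPow q ε x y * inner ℝ (y - x) (D.normal y) ∂D.surfaceMeasure
      = ∫ y, ∑ i, h i y * inner ℝ (EuclideanSpace.single i 1) (D.normal y) ∂D.surfaceMeasure := by
        refine integral_congr_ae (Eventually.of_forall fun y => ?_)
        simp only [hh, PiLp.inner_apply (y - x), Finset.mul_sum]
        refine Finset.sum_congr rfl fun i _ => ?_
        simp [EuclideanSpace.inner_single_left]
        ring
    _ = ∑ i, ∫ y, h i y * inner ℝ (EuclideanSpace.single i 1) (D.normal y) ∂D.surfaceMeasure :=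
        integral_finsetSum _ fun i _ => D.integrable_mul_inner_normal hα (hhd i).continuous _
    _ = ∑ i, ∫ y in D.carrier, fderiv ℝ (h i) y (EuclideanSpace.single i 1) := by
        simp only [D.gaussGreen hα (hhd _)]
    _ = ∫ y in D.carrier, ∑ i, fderiv ℝ (h i) y (EuclideanSpace.single i 1) :=
        (integral_finsetSum _ fun i _ => D.integrableOn_fderiv (hhd i) _).symm
    _ = ∫ y in D.carrier, (ε ^ (d + 1))⁻¹ * solidAngleDensity (ε⁻¹ • (y - x)) := by
        simp only [hh, hq, sum_fderiv_eq hε]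
    _ = ∫ y, D.carrier.indicator
          (fun y => (ε ^ (d + 1))⁻¹ * solidAngleDensity (ε⁻¹ • (y - x))) y :=
        (integral_indicator D.isOpen.measurableSet).symm
    _ = ∫ y, D.carrier.indicator
          (fun y => (ε ^ (d + 1))⁻¹ * solidAngleDensity (ε⁻¹ • (y - x))) (x + y) :=
        (integral_add_left_eq_self _ x).symm
    _ = (ε ^ (d + 1)) * ∫ z, D.carrier.indicator
          (fun y => (ε ^ (d + 1))⁻¹ * solidAngleDensity (ε⁻¹ • (y - x))) (x + ε • z) := by
        rw [Measure.integral_comp_smul volume (fun z => D.carrier.indicator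
          (fun y => (ε ^ (d + 1))⁻¹ * solidAngleDensity (ε⁻¹ • (y - x))) (x + z)) ε,
          finrank_euclideanSpace_fin, abs_of_pos (by positivity), smul_eq_mul, ← mul_assoc,
          mul_inv_cancel₀ (by positivity), one_mul]
    _ = ∫ z, {z | x + ε • z ∈ D.carrier}.indicator solidAngleDensity z := by
        rw [← integral_const_mul]
        refine integral_congr_ae (Eventually.of_forall fun z => ?_)
        by_cases hz : x + ε • z ∈ D.carrier
        · simp only [indicator_of_mem hz]
          rw [indicator_of_mem (by exact hz), add_sub_cancel_left, smul_smul,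
            inv_mul_cancel₀ hε.ne', one_smul, ← mul_assoc, mul_inv_cancel₀ (by positivity), one_mul]
        · simp only [indicator_of_notMem hz]
          rw [indicator_of_notMem (by exact hz), mul_zero]
    _ = _ := integral_indicator (D.isOpen.measurableSet.preimage (by fun_prop))

theorem ae_inner_ne_zero {v : EuclideanSpace ℝ (Fin (d + 1))} (hv : v ≠ 0) :
    ∀ᵐ z : EuclideanSpace ℝ (Fin (d + 1)), inner ℝ z v ≠ 0 := by
  have h : (ℝ ∙ v)ᗮ ≠ ⊤ := fun h => hv <| by
    have : v ∈ (ℝ ∙ v)ᗮ := h ▸ Submodule.mem_top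
    exact inner_self_eq_zero.1 (Submodule.mem_orthogonal_singleton_iff_inner_right.1 this)
  have h0 := Measure.addHaar_submodule volume _ h
  rw [ae_iff]
  refine measure_mono_null (fun z hz => ?_) h0
  exact Submodule.mem_orthogonal_singleton_iff_inner_left.2 (not_not.1 hz)

/-- A half space through the origin carries half of the integral of an even function. -/
theorem integral_halfSpace_solidAngleDensity {v : EuclideanSpace ℝ (Fin (d + 1))} (hv : v ≠ 0) :
    ∫ z in {z | inner ℝ z v < 0}, solidAngleDensity z = 2⁻¹ * ∫ z, solidAngleDensity (d := d) z := by
  have hneg : MeasurableSet {z | inner ℝ z v < 0} :=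
    measurableSet_lt (by fun_prop) measurable_const
  have hpos : MeasurableSet {z | 0 < inner ℝ z v} :=
    measurableSet_lt measurable_const (by fun_prop)
  have hsymm : ∫ z in {z | 0 < inner ℝ z v}, solidAngleDensity z =
      ∫ z in {z | inner ℝ z v < 0}, solidAngleDensity (d := d) z := by
    rw [← integral_indicator hneg, ← integral_indicator hpos, ← integral_neg_eq_self]
    refine integral_congr_ae (Eventually.of_forall fun z => ?_)
    simp [indicator, solidAngleDensity]
  have hint := integrable_solidAngleDensity (d := d)
  have h1 := integral_add_compl hneg hint
  have h2 : ∫ z in {z | inner ℝ z v < 0}ᶜ, solidAngleDensity (d := d) z =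
      ∫ z in {z | 0 < inner ℝ z v}, solidAngleDensity z := by
    refine setIntegral_congr_set ?_
    filter_upwards [ae_inner_ne_zero hv] with z hz
    apply propext
    change ¬ (inner ℝ z v < 0) ↔ 0 < inner ℝ z v
    rw [not_lt]
    exact ⟨fun h => lt_of_le_of_ne h (Ne.symm hz), le_of_lt⟩
  rw [h2, hsymm] at h1
  linarith

end C1HolderDomain

end SolidAngle

/-! ### The kernel of the double layer potential -/

theorem abs_inv_pow_sub_inv_pow_le (n : ℕ) {R S : ℝ} (hR : 0 < R) (hRS : R ≤ 2 * S) :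
    |(R ^ n)⁻¹ - (S ^ n)⁻¹| ≤ n * 2 ^ n * (|R - S| * (R ^ (n + 1))⁻¹) := by
  have hS : 0 < S := by linarith
  rcases n with _ | n
  · simp
  have h1 : |R⁻¹ - S⁻¹| ≤ 2 * (|R - S| * (R ^ 2)⁻¹) := by
    rw [inv_sub_inv hR.ne' hS.ne', abs_div, abs_of_pos (mul_pos hR hS), abs_sub_comm,
      div_le_iff₀ (mul_pos hR hS)]
    have : 2 * (|R - S| * (R ^ 2)⁻¹) * (R * S) = |R - S| * (2 * S / R) := by field_simp
    rw [this]
    exact le_mul_of_one_le_right (abs_nonneg _) ((one_le_div hR).2 hRS)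
  have h2 : max |R⁻¹| |S⁻¹| ≤ 2 * R⁻¹ := by
    rw [abs_of_pos (inv_pos.2 hR), abs_of_pos (inv_pos.2 hS)]
    refine max_le (by linarith [inv_pos.2 hR]) ?_
    rw [← div_eq_mul_inv, le_div_iff₀ hR, inv_mul_le_iff₀ hS]
    linarith
  rw [← inv_pow, ← inv_pow]
  refine (abs_pow_sub_pow_le _ _ _).trans ?_
  calc |R⁻¹ - S⁻¹| * ((n + 1 : ℕ) : ℝ) * max |R⁻¹| |S⁻¹| ^ (n + 1 - 1)
      ≤ 2 * (|R - S| * (R ^ 2)⁻¹) * ((n + 1 : ℕ) : ℝ) * (2 * R⁻¹) ^ n := by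
        rw [Nat.add_sub_cancel]
        gcongr
    _ = _ := by
        rw [mul_pow, inv_pow]
        field_simp
        ring

namespace C1HolderDomain

variable {d : ℕ} {α : ℝ} (D : C1HolderDomain d α)

theorem kernelKStar_eq (x y : EuclideanSpace ℝ (Fin (d + 1))) :
    D.kernelKStar x y = D.kernelK y x := by
  rw [kernelKStar, kernelK, norm_sub_rev, ← neg_sub y x, inner_neg_left]
  ring

theorem aestronglyMeasurable_kernelK (hα : 0 < α) (x : EuclideanSpace ℝ (Fin (d + 1))) :
    AEStronglyMeasurable (D.kernelK x) D.surfaceMeasure := by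
  unfold kernelK
  have h := D.aestronglyMeasurable_normal hα
  have h1 : Measurable fun y => ‖x - y‖ ^ (d + 1) := by fun_prop
  have h2 : AEStronglyMeasurable (fun y => x - y) D.surfaceMeasure := by fun_prop
  simp only [div_eq_mul_inv]
  exact (((h2.inner h).mul h1.inv.aestronglyMeasurable).const_mul _).neg

theorem aestronglyMeasurable_uncurry_kernelK (hα : 0 < α) :
    AEStronglyMeasurable
      (fun z : EuclideanSpace ℝ (Fin (d + 1)) × EuclideanSpace ℝ (Fin (d + 1)) => D.kernelK z.1 z.2)
      (D.surfaceMeasure.prod D.surfaceMeasure) := by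
  unfold kernelK
  have h := (D.aestronglyMeasurable_normal hα).comp_snd (μ := D.surfaceMeasure)
  have h1 : Measurable fun z : EuclideanSpace ℝ (Fin (d + 1)) × EuclideanSpace ℝ (Fin (d + 1)) =>
    ‖z.1 - z.2‖ ^ (d + 1) := by fun_prop
  have h2 : AEStronglyMeasurable
      (fun z : EuclideanSpace ℝ (Fin (d + 1)) × EuclideanSpace ℝ (Fin (d + 1)) => z.1 - z.2)
      (D.surfaceMeasure.prod D.surfaceMeasure) := by fun_prop
  simp only [div_eq_mul_inv]
  exact (((h2.inner h).mul h1.inv.aestronglyMeasurable).const_mul _).neg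

theorem exists_abs_kernelK_le (hα : 0 ≤ α) :
    ∃ B ≥ 0, ∀ x ∈ frontier D.carrier, ∀ y ∈ frontier D.carrier,
      |D.kernelK x y| ≤ B * ‖x - y‖ ^ (α - d) := by
  obtain ⟨C, hC, h⟩ := D.exists_abs_inner_normal_le hα
  refine ⟨|1 / sphereArea d| * C, by positivity, fun x hx y hy => ?_⟩
  rcases eq_or_ne x y with rfl | hxy
  · simp only [kernelK, sub_self, inner_zero_left, zero_div, mul_zero, neg_zero, abs_zero]
    positivity
  have hp : 0 < ‖x - y‖ := norm_pos_iff.2 (sub_ne_zero.2 hxy)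
  rw [kernelK, abs_neg, abs_mul, mul_assoc, abs_div (inner ℝ _ _),
    abs_of_pos (pow_pos hp (d + 1))]
  refine mul_le_mul_of_nonneg_left ?_ (abs_nonneg _)
  rw [div_le_iff₀ (pow_pos hp _), mul_assoc, ← Real.rpow_natCast, ← Real.rpow_add hp]
  refine (h x hx y hy).trans_eq ?_
  congr 2
  push_cast; ring

theorem integrable_kernelK (hd : 1 ≤ d) (hα : 0 < α) (hαd : α ≤ d)
    {x : EuclideanSpace ℝ (Fin (d + 1))} (hx : x ∈ frontier D.carrier) :
    Integrable (D.kernelK x) D.surfaceMeasure := by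
  obtain ⟨B, hB, h⟩ := D.exists_abs_kernelK_le hα.le
  obtain ⟨A, hA, hreg⟩ := D.exists_upperRegularAt
  have hk : IsWeaklySingularKernel D.surfaceMeasure (frontier D.carrier) d α A B D.kernelK :=
    ⟨D.ae_mem_frontier, hreg, hB, D.aestronglyMeasurable_uncurry_kernelK hα,
      fun x _ => D.aestronglyMeasurable_kernelK hα x, h⟩
  exact hk.integrable hd hA hα hαd hx

/-- As `ε → 0` the regularized flux through `∂Ω` tends to the integral of the kernel of `K`. -/
theorem tendsto_flux_smoothPow (hd : 1 ≤ d) (hα : 0 < α) (hαd : α ≤ d)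
    {x : EuclideanSpace ℝ (Fin (d + 1))} (hx : x ∈ frontier D.carrier)
    (hω : sphereArea d ≠ 0) :
    Tendsto (fun ε : ℝ => ∫ y, smoothPow (-((d + 1 : ℝ) / 2)) ε x y *
        inner ℝ (y - x) (D.normal y) ∂D.surfaceMeasure) (𝓝[>] 0)
      (𝓝 (∫ y, sphereArea d * D.kernelK x y ∂D.surfaceMeasure)) := by
  have hk : ∀ y, sphereArea d * D.kernelK x y =
      (‖y - x‖ ^ (d + 1))⁻¹ * inner ℝ (y - x) (D.normal y) := fun y => by
    rw [kernelK, norm_sub_rev, ← neg_sub y x, inner_neg_left]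
    field_simp
  have hpow : ∀ y, (‖y - x‖ ^ 2) ^ (-((d + 1 : ℝ) / 2)) = (‖y - x‖ ^ (d + 1))⁻¹ := fun y => by
    rw [Real.rpow_neg (by positivity), ← Real.rpow_natCast, ← Real.rpow_mul (norm_nonneg _),
      ← Real.rpow_natCast]
    congr 2; push_cast; ring
  have hi := (D.integrable_kernelK hd hα hαd hx).const_mul (sphereArea d)
  refine tendsto_integral_filter_of_dominated_convergence (fun y => ‖sphereArea d * D.kernelK x y‖)
    ?_ ?_ hi.norm ?_
  · filter_upwards [self_mem_nhdsWithin] with ε hε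
    have h2 : AEStronglyMeasurable (fun y => y - x) D.surfaceMeasure := by fun_prop
    exact (contDiff_smoothPow _ hε x).continuous.aestronglyMeasurable.mul
      (h2.inner (D.aestronglyMeasurable_normal hα))
  · filter_upwards [self_mem_nhdsWithin] with ε hε
    refine Eventually.of_forall fun y => ?_
    rw [hk]
    rcases eq_or_ne y x with rfl | hxy
    · simp
    have hp : 0 < ‖y - x‖ := norm_pos_iff.2 (sub_ne_zero.2 hxy)
    rw [norm_mul, norm_mul]
    refine mul_le_mul_of_nonneg_right ?_ (norm_nonneg _)
    rw [← hpow, smoothPow, Real.norm_of_nonneg (by positivity), Real.norm_of_nonneg (by positivity)]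
    refine Real.rpow_le_rpow_of_nonpos (by positivity) (by nlinarith [sq_nonneg ε]) ?_
    have : (0 : ℝ) ≤ d := d.cast_nonneg
    linarith
  · refine Eventually.of_forall fun y => ?_
    rw [hk]
    rcases eq_or_ne y x with rfl | hxy
    · simp
    have hp : 0 < ‖y - x‖ := norm_pos_iff.2 (sub_ne_zero.2 hxy)
    refine Tendsto.mul_const _ ?_
    rw [← hpow]
    refine Tendsto.mono_left ?_ nhdsWithin_le_nhds
    unfold smoothPow
    refine Tendsto.rpow_const ?_ (Or.inl (by positivity))
    have : Tendsto (fun ε : ℝ => ‖y - x‖ ^ 2 + ε ^ 2) (𝓝 0) (𝓝 (‖y - x‖ ^ 2 + 0 ^ 2)) :=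
      Continuous.tendsto (by fun_prop) _
    simpa using this

/-- Blown up at a boundary point, the domain becomes the half space below its tangent plane. -/
theorem tendsto_integral_solidAngleDensity {x : EuclideanSpace ℝ (Fin (d + 1))}
    (hx : x ∈ frontier D.carrier) :
    Tendsto (fun ε : ℝ => ∫ z in {z | x + ε • z ∈ D.carrier}, solidAngleDensity z) (𝓝[>] 0)
      (𝓝 (2⁻¹ * ∫ z, solidAngleDensity (d := d) z)) := by
  obtain ⟨hv, hN⟩ := D.isOutwardUnitNormal_normal hx
  set v := D.normal x with hvdef
  have hv0 : v ≠ 0 := by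
    intro h; rw [h, norm_zero] at hv; exact zero_ne_one hv
  rw [← integral_halfSpace_solidAngleDensity hv0,
    ← integral_indicator (measurableSet_lt (by fun_prop) measurable_const)]
  have hm : ∀ ε : ℝ, MeasurableSet {z | x + ε • z ∈ D.carrier} := fun ε =>
    D.isOpen.measurableSet.preimage (by fun_prop)
  simp only [← integral_indicator (hm _)]
  have hint := integrable_solidAngleDensity (d := d)
  refine tendsto_integral_filter_of_dominated_convergence (fun z => ‖solidAngleDensity z‖)
    (Eventually.of_forall fun ε => hint.aestronglyMeasurable.indicator (hm ε))
    (Eventually.of_forall fun ε => Eventually.of_forall fun z => norm_indicator_le_norm_self _ _)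
    hint.norm ?_
  filter_upwards [ae_inner_ne_zero hv0] with z hz
  have hz0 : 0 < ‖z‖ := norm_pos_iff.2 (by rintro rfl; simp at hz)
  have hlim : Tendsto (fun ε : ℝ => x + ε • z) (𝓝[>] 0) (𝓝 x) := by
    have : Tendsto (fun t : ℝ => x + t • z) (𝓝 0) (𝓝 (x + (0 : ℝ) • z)) := by
      apply Continuous.tendsto; fun_prop
    rw [zero_smul, add_zero] at this
    exact this.mono_left nhdsWithin_le_nhds
  have hη : 0 < |inner ℝ z v| / (2 * ‖z‖) := by positivity
  refine Tendsto.congr' ?_ tendsto_const_nhds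
  filter_upwards [hlim.eventually (hN _ hη), self_mem_nhdsWithin] with ε h hε
  have hε : 0 < ε := hε
  have hs : |inner ℝ z v| / (2 * ‖z‖) * (ε * ‖z‖) = ε * (|inner ℝ z v| / 2) := by field_simp
  rw [add_sub_cancel_left, real_inner_smul_left, norm_smul, Real.norm_of_nonneg hε.le, hs] at h
  rcases lt_or_gt_of_ne hz with hneg | hpos
  · rw [abs_of_neg hneg] at h
    rw [indicator_of_mem (by exact hneg), indicator_of_mem (by exact h.1 (by nlinarith))]
  · rw [abs_of_pos hpos] at h
    rw [indicator_of_notMem (by exact not_lt.2 hpos.le),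
      indicator_of_notMem (by exact h.2 (by nlinarith))]

/-- The boundary is seen under the same solid angle from each of its points. -/
theorem exists_integral_kernelK_eq (hd : 1 ≤ d) (hα : 0 < α) (hαd : α ≤ d) :
    ∃ c, ∀ x ∈ frontier D.carrier, ∫ y, D.kernelK x y ∂D.surfaceMeasure = c := by
  by_cases hω : sphereArea d = 0
  · exact ⟨0, fun x _ => by simp [kernelK, hω]⟩
  refine ⟨(sphereArea d)⁻¹ * (2⁻¹ * ∫ z, solidAngleDensity (d := d) z), fun x hx => ?_⟩
  have h1 := D.tendsto_flux_smoothPow hd hα hαd hx hω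
  have h2 := tendsto_nhds_unique (h1.congr' ?_) (D.tendsto_integral_solidAngleDensity hx)
  · rw [← h2, integral_const_mul, inv_mul_cancel_left₀ hω]
  · filter_upwards [self_mem_nhdsWithin] with ε hε
    exact D.flux_smoothPow hα hε x

/-- The kernel is Lipschitz in the first variable away from the diagonal. In the difference of the
numerators, `(x - t) · ν_y` is small because `ν_y` is close to `ν_t`, to which `x - t` is nearly
orthogonal. -/
theorem exists_abs_kernelK_sub_le (hα : 0 ≤ α) :
    ∃ B ≥ 0, ∀ x ∈ frontier D.carrier, ∀ t ∈ frontier D.carrier, ∀ y ∈ frontier D.carrier,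
      2 * ‖x - t‖ ≤ ‖x - y‖ →
        |D.kernelK x y - D.kernelK t y| ≤ B * (‖x - t‖ * ‖x - y‖ ^ (α - d - 1)) := by
  obtain ⟨C, hC, h⟩ := D.exists_abs_inner_normal_le hα
  obtain ⟨N, hN, hν⟩ := D.exists_norm_normal_sub_le hα
  set n := d + 1 with hn
  refine ⟨|1 / sphereArea d| * ((C + N * 2 ^ α) + C * 2 ^ (1 + α) * (n * 2 ^ n)),
    by positivity, fun x hx t ht y hy hxt => ?_⟩
  rcases eq_or_ne x t with rfl | hne
  · simp
  have hxt0 : 0 < ‖x - t‖ := norm_pos_iff.2 (sub_ne_zero.2 hne)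
  set R := ‖x - y‖ with hR
  set S := ‖t - y‖ with hS
  have hR0 : 0 < R := by linarith
  have hRS : |R - S| ≤ ‖x - t‖ := by
    refine (abs_norm_sub_norm_le _ _).trans_eq ?_
    congr 1; abel
  obtain ⟨hRS1, hRS2⟩ := abs_le.1 hRS
  have hS1 : S ≤ 2 * R := by linarith
  have hS2 : R ≤ 2 * S := by linarith
  have hkey : D.kernelK x y - D.kernelK t y = -(1 / sphereArea d *
      (inner ℝ (x - t) (D.normal y) * (R ^ n)⁻¹ +
        inner ℝ (t - y) (D.normal y) * ((R ^ n)⁻¹ - (S ^ n)⁻¹))) := by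
    have : inner ℝ (x - y) (D.normal y) =
        inner ℝ (x - t) (D.normal y) + inner ℝ (t - y) (D.normal y) := by
      rw [← inner_add_left]; congr 1; abel
    rw [kernelK, kernelK, this, ← hR, ← hS]
    simp only [div_eq_mul_inv]
    ring
  have h1 : |inner ℝ (x - t) (D.normal y)| ≤ (C + N * 2 ^ α) * (‖x - t‖ * R ^ α) := by
    have e : inner ℝ (x - t) (D.normal y) =
        inner ℝ (x - t) (D.normal t) + inner ℝ (x - t) (D.normal y - D.normal t) := by
      rw [← inner_add_right]; congr 1; abel
    have e1 : |inner ℝ (x - t) (D.normal t)| ≤ C * (‖x - t‖ * R ^ α) := by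
      refine (h x hx t ht).trans ?_
      rw [Real.rpow_add hxt0, Real.rpow_one]
      gcongr
      linarith
    have e2 : |inner ℝ (x - t) (D.normal y - D.normal t)| ≤ N * 2 ^ α * (‖x - t‖ * R ^ α) := by
      refine (abs_real_inner_le_norm _ _).trans ?_
      have : ‖D.normal y - D.normal t‖ ≤ N * (2 * R) ^ α := by
        rw [norm_sub_rev]
        refine (hν t ht y hy).trans ?_
        gcongr
      rw [Real.mul_rpow (by positivity) hR0.le] at this
      calc ‖x - t‖ * ‖D.normal y - D.normal t‖ ≤ ‖x - t‖ * (N * (2 ^ α * R ^ α)) := by gcongr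
        _ = _ := by ring
    rw [e]
    refine (abs_add_le _ _).trans ?_
    linarith
  have h2 : |inner ℝ (t - y) (D.normal y)| ≤ C * 2 ^ (1 + α) * R ^ (1 + α) := by
    refine (h t ht y hy).trans ?_
    rw [mul_assoc, ← Real.mul_rpow (by positivity) hR0.le]
    gcongr
  have h3 : |(R ^ n)⁻¹ - (S ^ n)⁻¹| ≤ n * 2 ^ n * (‖x - t‖ * (R ^ (n + 1))⁻¹) :=
    (abs_inv_pow_sub_inv_pow_le n hR0 hS2).trans (by gcongr)
  have p1 : R ^ α * (R ^ n)⁻¹ = R ^ (α - d - 1) := by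
    rw [← Real.rpow_natCast, ← Real.rpow_neg hR0.le, ← Real.rpow_add hR0, hn]
    congr 1; push_cast; ring
  have p2 : R ^ (1 + α) * (R ^ (n + 1))⁻¹ = R ^ (α - d - 1) := by
    rw [← Real.rpow_natCast, ← Real.rpow_neg hR0.le, ← Real.rpow_add hR0, hn]
    congr 1; push_cast; ring
  rw [hkey, abs_neg, abs_mul, mul_assoc]
  refine mul_le_mul_of_nonneg_left ?_ (abs_nonneg _)
  refine (abs_add_le _ _).trans ?_
  rw [abs_mul, abs_mul, abs_of_pos (inv_pos.2 (pow_pos hR0 n)), add_mul]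
  refine add_le_add ?_ ?_
  · calc |inner ℝ (x - t) (D.normal y)| * (R ^ n)⁻¹
        ≤ (C + N * 2 ^ α) * (‖x - t‖ * R ^ α) * (R ^ n)⁻¹ := by gcongr
      _ = _ := by rw [← p1]; ring
  · calc |inner ℝ (t - y) (D.normal y)| * |(R ^ n)⁻¹ - (S ^ n)⁻¹|
        ≤ (C * 2 ^ (1 + α) * R ^ (1 + α)) * (n * 2 ^ n * (‖x - t‖ * (R ^ (n + 1))⁻¹)) := by gcongr
      _ = _ := by rw [← p2]; ring

theorem exists_isDoubleLayerKernel (hd : 1 ≤ d) (hα : 0 < α) (hαd : α ≤ d) :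
    ∃ A ≥ 0, ∃ B c, IsDoubleLayerKernel D.surfaceMeasure (frontier D.carrier) d α A B c D.kernelK := by
  obtain ⟨A, hA, hreg⟩ := D.exists_upperRegularAt
  obtain ⟨B, hB, h⟩ := D.exists_abs_kernelK_le hα.le
  obtain ⟨B', hB', h'⟩ := D.exists_abs_kernelK_sub_le hα.le
  obtain ⟨c, hc⟩ := D.exists_integral_kernelK_eq hd hα hαd
  refine ⟨A, hA, max B B', c, ⟨D.ae_mem_frontier, hreg, hB.trans (le_max_left _ _),
    D.aestronglyMeasurable_uncurry_kernelK hα, fun x _ => D.aestronglyMeasurable_kernelK hα x,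
    fun x hx y hy => (h x hx y hy).trans ?_⟩,
    fun x hx t ht y hy hxt => (h' x hx t ht y hy hxt).trans ?_, hc⟩
  · gcongr; exact le_max_left _ _
  · gcongr; exact le_max_right _ _

variable {D} in
theorem isWeaklySingularKernel_kernelKStar {A B : ℝ} (hk : IsWeaklySingularKernel D.surfaceMeasure
    (frontier D.carrier) d α A B D.kernelK) :
    IsWeaklySingularKernel D.surfaceMeasure (frontier D.carrier) d α A B D.kernelKStar := by
  have h := hk.swap fun x _ => by
    unfold kernelK
    exact Measurable.aestronglyMeasurable (by fun_prop)
  simpa only [← kernelKStar_eq] using h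

end C1HolderDomain

/-! ### Compactness by approximation -/

section Compactness

variable {𝕜 X Y : Type*} [RCLike 𝕜] [NormedAddCommGroup X] [NormedSpace 𝕜 X]
  [NormedAddCommGroup Y] [NormedSpace 𝕜 Y]

/-- Up to a small multiple of the norm, `‖T f‖` is controlled by finitely many continuous linear
functionals. For complete `Y` this means that `T` is compact. -/
def IsFinitelyControlled (T : X →L[𝕜] Y) : Prop :=
  ∀ ε > 0, ∃ (n : ℕ) (S : X →L[𝕜] (Fin n → 𝕜)), ∀ f, ‖T f‖ ≤ ε * ‖f‖ + ‖S f‖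

theorem IsFinitelyControlled.isCompactOperator [CompleteSpace Y] {T : X →L[𝕜] Y}
    (hT : IsFinitelyControlled T) : IsCompactOperator T := by
  refine (isCompactOperator_iff_isCompact_closure_image_closedBall (T : X →ₗ[𝕜] Y) one_pos).2 ?_
  refine TotallyBounded.isCompact_of_isClosed (TotallyBounded.closure ?_) isClosed_closure
  rw [Metric.totallyBounded_iff]
  intro ε hε
  obtain ⟨n, S, hS⟩ := hT (ε / 4) (by positivity)
  have hb : TotallyBounded (S '' Metric.closedBall 0 1) :=
    (S.lipschitz.isBounded_image Metric.isBounded_closedBall).isCompact_closure.totallyBounded.subset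
      subset_closure
  obtain ⟨t, hts, htf, htc⟩ := Metric.finite_approx_of_totallyBounded hb (ε / 4) (by positivity)
  have hts' : ∀ z ∈ t, ∃ f ∈ Metric.closedBall (0 : X) 1, S f = z := fun z hz => hts hz
  choose! g hg using hts'
  refine ⟨(fun z => T (g z)) '' t, htf.image _, ?_⟩
  rintro _ ⟨f, hf, rfl⟩
  obtain ⟨z, hz, hfz⟩ := mem_iUnion₂.1 (htc ⟨f, hf, rfl⟩)
  refine mem_iUnion₂.2 ⟨T (g z), ⟨z, hz, rfl⟩, ?_⟩
  obtain ⟨hg1, hg2⟩ := hg z hz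
  have h1 := hS (f - g z)
  rw [map_sub, map_sub, hg2] at h1
  have h2 : ‖f - g z‖ ≤ 2 := by
    refine (norm_sub_le _ _).trans ?_
    rw [mem_closedBall_zero_iff] at hf hg1
    linarith
  rw [Metric.mem_ball, dist_eq_norm] at hfz
  change dist (T f) (T (g z)) < ε
  rw [dist_eq_norm]
  nlinarith

/-- Schauder's theorem: the transpose of a compact operator is compact. -/
theorem isFinitelyControlled_precomp {T : X →L[𝕜] Y} (hT : IsCompactOperator T) :
    IsFinitelyControlled (T.precomp 𝕜 : StrongDual 𝕜 Y →L[𝕜] StrongDual 𝕜 X) := by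
  intro ε hε
  have hb := ((isCompactOperator_iff_isCompact_closure_image_closedBall
    (T : X →ₗ[𝕜] Y) one_pos).1 hT).totallyBounded.subset subset_closure
  obtain ⟨t, htf, htc⟩ := Metric.totallyBounded_iff.1 hb ε hε
  obtain ⟨n, y, hy⟩ := htf.fin_param
  refine ⟨n, ContinuousLinearMap.pi fun i => ContinuousLinearMap.apply 𝕜 𝕜 (y i), fun φ => ?_⟩
  refine ContinuousLinearMap.opNorm_le_of_unit_norm (by positivity) fun f hf => ?_
  obtain ⟨z, hz, hfz⟩ := mem_iUnion₂.1 (htc ⟨f, by simp [hf], rfl⟩)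
  obtain ⟨i, rfl⟩ : z ∈ range y := by rw [hy.2]; exact hz
  have h1 : ‖φ (y i)‖ ≤ ‖(ContinuousLinearMap.pi fun i => ContinuousLinearMap.apply 𝕜 𝕜 (y i) :
      StrongDual 𝕜 Y →L[𝕜] (Fin n → 𝕜)) φ‖ :=
    norm_le_pi_norm ((ContinuousLinearMap.pi fun i => ContinuousLinearMap.apply 𝕜 𝕜 (y i) :
      StrongDual 𝕜 Y →L[𝕜] (Fin n → 𝕜)) φ) i
  have h2 : ‖φ (T f - y i)‖ ≤ ε * ‖φ‖ := by
    refine (φ.le_opNorm _).trans ?_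
    rw [mul_comm]
    gcongr
    rw [Metric.mem_ball, dist_eq_norm] at hfz
    exact hfz.le
  calc ‖φ (T f)‖ = ‖φ (T f - y i) + φ (y i)‖ := by rw [← map_add, sub_add_cancel]
    _ ≤ _ := (norm_add_le _ _).trans (add_le_add h2 h1)

end Compactness

/-! ### Weakly singular integral operators on `L²` -/

section SquareIntegrable

theorem eLpNorm_two_sq {X F : Type*} [MeasurableSpace X] [NormedAddCommGroup F] (μ : Measure X)
    (f : X → F) : eLpNorm f 2 μ ^ 2 = ∫⁻ x, ‖f x‖ₑ ^ 2 ∂μ := by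
  have := eLpNorm_nnreal_pow_eq_lintegral (f := f) (μ := μ) (p := 2) two_ne_zero
  simpa only [NNReal.coe_ofNat, ENNReal.coe_ofNat, ENNReal.rpow_ofNat] using this

theorem enorm_sq_eq_lintegral {X F : Type*} [MeasurableSpace X] [NormedAddCommGroup F]
    {μ : Measure X} (f : Lp F 2 μ) : ‖f‖ₑ ^ 2 = ∫⁻ x, ‖f x‖ₑ ^ 2 ∂μ := by
  rw [Lp.enorm_def, eLpNorm_two_sq]

theorem lintegral_enorm_sq_ne_top {X F : Type*} [MeasurableSpace X] [NormedAddCommGroup F]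
    {μ : Measure X} (f : Lp F 2 μ) : ∫⁻ x, ‖f x‖ₑ ^ 2 ∂μ ≠ ∞ := by
  rw [← enorm_sq_eq_lintegral]; finiteness

theorem memLp_two_of_lintegral_ne_top {X F : Type*} [MeasurableSpace X] [NormedAddCommGroup F]
    {μ : Measure X} {f : X → F} (hf : AEStronglyMeasurable f μ) (h : ∫⁻ x, ‖f x‖ₑ ^ 2 ∂μ ≠ ∞) :
    MemLp f 2 μ := by
  refine ⟨hf, ?_⟩
  rw [← eLpNorm_two_sq] at h
  exact lt_top_iff_ne_top.2 fun hh => h (by simp [hh])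

theorem norm_le_of_enorm_sq_le {U V W : Type*} [NormedAddCommGroup U] [NormedAddCommGroup V]
    [NormedAddCommGroup W] {u : U} {v : V} {w : W} {p q : ℝ} (hp : 0 ≤ p) (hq : 0 ≤ q)
    (h : ‖u‖ₑ ^ 2 ≤ ENNReal.ofReal p * ‖v‖ₑ ^ 2 + ENNReal.ofReal q * ‖w‖ₑ ^ 2) :
    ‖u‖ ≤ √p * ‖v‖ + √q * ‖w‖ := by
  simp only [← ofReal_norm] at h
  rw [← ENNReal.ofReal_pow (norm_nonneg _), ← ENNReal.ofReal_pow (norm_nonneg _),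
    ← ENNReal.ofReal_pow (norm_nonneg _), ← ENNReal.ofReal_mul hp, ← ENNReal.ofReal_mul hq,
    ← ENNReal.ofReal_add (by positivity) (by positivity),
    ENNReal.ofReal_le_ofReal_iff (by positivity)] at h
  refine le_of_sq_le_sq ?_ (by positivity)
  have h1 := Real.sq_sqrt hp
  have h2 := Real.sq_sqrt hq
  have h3 : 0 ≤ √p * ‖v‖ * (√q * ‖w‖) := by positivity
  calc ‖u‖ ^ 2 ≤ p * ‖v‖ ^ 2 + q * ‖w‖ ^ 2 := h
    _ = (√p * ‖v‖) ^ 2 + (√q * ‖w‖) ^ 2 := by rw [mul_pow, mul_pow, h1, h2]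
    _ ≤ _ := by nlinarith

end SquareIntegrable

namespace IsWeaklySingularKernel

variable {E : Type*} [NormedAddCommGroup E] [MeasurableSpace E] [BorelSpace E]
  [SecondCountableTopology E] {𝕜 : Type*} [RCLike 𝕜]
  {μ : Measure E} [IsFiniteMeasure μ] {S : Set E} {d : ℕ} {α A B : ℝ} {k : E → E → ℝ}

/-- A weakly singular kernel defines a bounded operator on `L²`. -/
theorem exists_operator (hk : IsWeaklySingularKernel μ S d α A B k) (hd : 1 ≤ d) (hA : 0 ≤ A)
    (hα : 0 < α) (hαd : α ≤ d) :
    ∃ T : Lp 𝕜 2 μ →L[𝕜] Lp 𝕜 2 μ, ∀ f, T f =ᵐ[μ] fun x => ∫ y, k x y • f y ∂μ := by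
  obtain ⟨C, hC, h⟩ := hk.exists_lintegral_enorm_integral_sq_le (F := 𝕜) hd hA hα hαd
  have hm : ∀ f : Lp 𝕜 2 μ, MemLp (fun x => ∫ y, k x y • f y ∂μ) 2 μ := fun f =>
    memLp_two_of_lintegral_ne_top (hk.aestronglyMeasurable_integral (Lp.stronglyMeasurable f))
      ((h f (Lp.stronglyMeasurable f)).trans_lt
        (ENNReal.mul_lt_top hC.lt_top (lintegral_enorm_sq_ne_top f).lt_top)).ne
  let T : Lp 𝕜 2 μ →ₗ[𝕜] Lp 𝕜 2 μ :=
    { toFun f := (hm f).toLp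
      map_add' f g := by
        rw [← MemLp.toLp_add, MemLp.toLp_eq_toLp_iff]
        filter_upwards [hk.ae_integrable_smul hd hA hα hαd (Lp.stronglyMeasurable f)
          (lintegral_enorm_sq_ne_top f), hk.ae_integrable_smul hd hA hα hαd
          (Lp.stronglyMeasurable g) (lintegral_enorm_sq_ne_top g)] with x hx hx'
        rw [Pi.add_apply, ← integral_add hx hx']
        refine integral_congr_ae ?_
        filter_upwards [Lp.coeFn_add f g] with y hy
        rw [hy, Pi.add_apply, smul_add]
      map_smul' a f := by
        rw [RingHom.id_apply, ← MemLp.toLp_const_smul, MemLp.toLp_eq_toLp_iff]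
        refine Eventually.of_forall fun x => ?_
        rw [Pi.smul_apply]
        dsimp only
        rw [← integral_smul]
        refine integral_congr_ae ?_
        filter_upwards [Lp.coeFn_smul a f] with y hy
        rw [hy, Pi.smul_apply, smul_comm] }
  have hT : ∀ f, T f =ᵐ[μ] fun x => ∫ y, k x y • f y ∂μ := fun f => (hm f).coeFn_toLp
  refine ⟨T.mkContinuousOfExistsBound ⟨√C.toReal, fun f => ?_⟩, hT⟩
  have : ‖T f‖ ≤ √C.toReal * ‖f‖ + √0 * ‖f‖ := by
    refine norm_le_of_enorm_sq_le ENNReal.toReal_nonneg le_rfl ?_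
    rw [ENNReal.ofReal_toReal hC, ENNReal.ofReal_zero, zero_mul, add_zero, enorm_sq_eq_lintegral,
      enorm_sq_eq_lintegral]
    refine le_trans (le_of_eq ?_) (h f (Lp.stronglyMeasurable f))
    refine lintegral_congr_ae ?_
    filter_upwards [hT f] with x hx
    rw [hx]
  simpa using this

/-- The operators with kernels `k(x, y)` and `k(y, x)` are transposes of each other. -/
theorem integral_mul_integral_smul (hk : IsWeaklySingularKernel μ S d α A B k) (hd : 1 ≤ d)
    (hA : 0 ≤ A) (hα : 0 < α) (hαd : α ≤ d) (f g : Lp 𝕜 2 μ) :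
    ∫ x, g x * ∫ y, k x y • f y ∂μ ∂μ = ∫ y, (∫ x, k x y • g x ∂μ) * f y ∂μ := by
  obtain ⟨C, hC, h⟩ := hk.exists_lintegral_sq_le hd hA hα hαd
  have hf := Lp.stronglyMeasurable f
  have hg := Lp.stronglyMeasurable g
  have hkm : AEMeasurable (fun z : E × E => ‖k z.1 z.2‖ₑ * ‖f z.2‖ₑ) (μ.prod μ) :=
    hk.aestronglyMeasurable.enorm.mul (hf.enorm.comp measurable_snd).aemeasurable
  have hint : Integrable (Function.uncurry fun x y => g x * k x y • f y) (μ.prod μ) := by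
    have hm : AEStronglyMeasurable (Function.uncurry fun x y => g x * k x y • f y) (μ.prod μ) :=
      (hg.comp_measurable measurable_fst).aestronglyMeasurable.mul
        (hk.aestronglyMeasurable.smul (hf.comp_measurable measurable_snd).aestronglyMeasurable)
    refine ⟨hm, ?_⟩
    rw [HasFiniteIntegral, lintegral_prod _ hm.enorm]
    have e : ∀ x, ∫⁻ y, ‖Function.uncurry (fun x y => g x * k x y • f y) (x, y)‖ₑ ∂μ =
        ‖g x‖ₑ * ∫⁻ y, ‖k x y‖ₑ * ‖f y‖ₑ ∂μ := fun x => by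
      rw [← lintegral_const_mul' _ _ enorm_ne_top]
      refine lintegral_congr fun y => ?_
      simp only [Function.uncurry, enorm_mul, enorm_smul]
    simp only [e]
    have hcs := sq_lintegral_mul_le hg.enorm.aemeasurable hkm.lintegral_prod_right'
    have hfin : (∫⁻ x, ‖g x‖ₑ * ∫⁻ y, ‖k x y‖ₑ * ‖f y‖ₑ ∂μ ∂μ) ^ 2 < ∞ :=
      hcs.trans_lt (ENNReal.mul_lt_top (lintegral_enorm_sq_ne_top g).lt_top
        ((h _ hf.enorm).trans_lt
          (ENNReal.mul_lt_top hC.lt_top (lintegral_enorm_sq_ne_top f).lt_top)))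
    by_contra hcon
    rw [not_lt, top_le_iff] at hcon
    rw [hcon] at hfin
    simp at hfin
  calc ∫ x, g x * ∫ y, k x y • f y ∂μ ∂μ = ∫ x, ∫ y, g x * k x y • f y ∂μ ∂μ := by
        simp only [integral_const_mul]
    _ = ∫ y, ∫ x, g x * k x y • f y ∂μ ∂μ := integral_integral_swap hint
    _ = _ := by
        refine integral_congr_ae (Eventually.of_forall fun y => ?_)
        dsimp only
        rw [← integral_mul_const]
        refine integral_congr_ae (Eventually.of_forall fun x => ?_)
        simp only [mul_smul_comm, smul_mul_assoc]

end IsWeaklySingularKernel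

namespace C1HolderDomain

variable {d : ℕ} {α : ℝ} (D : C1HolderDomain d α) {𝕜 : Type*} [RCLike 𝕜]

theorem hasPrincipalValue_of_integrable {F : EuclideanSpace ℝ (Fin (d + 1)) → 𝕜}
    {x : EuclideanSpace ℝ (Fin (d + 1))} (hF : Integrable F D.surfaceMeasure)
    (hx : D.surfaceMeasure {x} = 0) : D.HasPrincipalValue F x (∫ y, F y ∂D.surfaceMeasure) := by
  refine ⟨fun ε _ => hF.integrableOn, ?_⟩
  have hm : ∀ ε : ℝ, MeasurableSet {y | ε < ‖x - y‖} := fun ε =>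
    measurableSet_lt measurable_const (by fun_prop)
  simp only [← integral_indicator (hm _)]
  refine tendsto_integral_filter_of_dominated_convergence (fun y => ‖F y‖)
    (Eventually.of_forall fun ε => hF.aestronglyMeasurable.indicator (hm ε))
    (Eventually.of_forall fun ε => Eventually.of_forall fun z => norm_indicator_le_norm_self _ _)
    hF.norm ?_
  have hne : ∀ᵐ y ∂D.surfaceMeasure, y ≠ x := by
    rw [ae_iff]; simpa using hx
  filter_upwards [hne] with y hy
  have hp : 0 < ‖x - y‖ := norm_pos_iff.2 (sub_ne_zero.2 hy.symm)
  refine Tendsto.congr' ?_ tendsto_const_nhds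
  filter_upwards [nhdsWithin_le_nhds (Iio_mem_nhds hp)] with ε hε
  rw [indicator_of_mem (by exact hε)]

/-- Weakly singular integrals converge absolutely, and so also as principal values. -/
theorem ae_hasPrincipalValue {k : EuclideanSpace ℝ (Fin (d + 1)) → EuclideanSpace ℝ (Fin (d + 1)) → ℝ}
    {A B : ℝ} (hk : IsWeaklySingularKernel D.surfaceMeasure (frontier D.carrier) d α A B k)
    (hd : 1 ≤ d) (hA : 0 ≤ A) (hα : 0 < α) (hαd : α ≤ d) (f : D.L2 𝕜) :
    ∀ᵐ x ∂D.surfaceMeasure, D.HasPrincipalValue (fun y => k x y • f y) x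
      (∫ y, k x y • f y ∂D.surfaceMeasure) := by
  filter_upwards [hk.ae_integrable_smul hd hA hα hαd (Lp.stronglyMeasurable f)
    (lintegral_enorm_sq_ne_top f), hk.ae_mem] with x hx hxS
  exact D.hasPrincipalValue_of_integrable hx ((hk.upperRegular x hxS).measure_singleton hd)

end C1HolderDomain

namespace C1HolderDomain

variable {d : ℕ} {α : ℝ} (D : C1HolderDomain d α) {𝕜 : Type*} [RCLike 𝕜]

/-! ### The space `H^{1/2}` -/

theorem enorm_diffQuotient_sq (f : EuclideanSpace ℝ (Fin (d + 1)) → 𝕜)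
    (x t : EuclideanSpace ℝ (Fin (d + 1))) :
    ‖diffQuotient f (x, t)‖ₑ ^ 2 = distPow (-(d + 1)) x t * ‖f x - f t‖ₑ ^ 2 := by
  rw [diffQuotient, enorm_smul, mul_pow]
  congr 1
  rw [distPow, Real.enorm_of_nonneg (by positivity), ← ENNReal.ofReal_pow (by positivity), inv_pow,
    Real.sq_sqrt (by positivity), Real.rpow_neg (norm_nonneg _), ← Real.rpow_natCast]
  push_cast; rfl

theorem aestronglyMeasurable_diffQuotient {f : EuclideanSpace ℝ (Fin (d + 1)) → 𝕜}
    (hf : AEStronglyMeasurable f D.surfaceMeasure) :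
    AEStronglyMeasurable (diffQuotient f) (D.surfaceMeasure.prod D.surfaceMeasure) := by
  unfold diffQuotient
  have h : Measurable fun z : EuclideanSpace ℝ (Fin (d + 1)) × EuclideanSpace ℝ (Fin (d + 1)) =>
    (√(‖z.1 - z.2‖ ^ (d + 1)))⁻¹ := by fun_prop
  exact h.aestronglyMeasurable.smul (hf.comp_fst.sub hf.comp_snd)

/-- The square of the Gagliardo seminorm of `H^{1/2}`. -/
def seminormSq (f : EuclideanSpace ℝ (Fin (d + 1)) → 𝕜) : ℝ≥0∞ :=
  ∫⁻ x, ∫⁻ t, distPow (-(d + 1)) x t * ‖f x - f t‖ₑ ^ 2 ∂D.surfaceMeasure ∂D.surfaceMeasure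

theorem lintegral_enorm_diffQuotient_sq {f : EuclideanSpace ℝ (Fin (d + 1)) → 𝕜}
    (hf : AEStronglyMeasurable f D.surfaceMeasure) :
    ∫⁻ z, ‖diffQuotient f z‖ₑ ^ 2 ∂(D.surfaceMeasure.prod D.surfaceMeasure) = D.seminormSq f := by
  rw [lintegral_prod _ ((D.aestronglyMeasurable_diffQuotient hf).enorm.pow_const 2)]
  simp only [enorm_diffQuotient_sq, seminormSq]

theorem seminormSq_congr {f g : EuclideanSpace ℝ (Fin (d + 1)) → 𝕜}
    (h : f =ᵐ[D.surfaceMeasure] g) : D.seminormSq f = D.seminormSq g := by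
  unfold seminormSq
  refine lintegral_congr_ae ?_
  filter_upwards [h] with x hx
  refine lintegral_congr_ae ?_
  filter_upwards [h] with t ht
  rw [hx, ht]

theorem memLp_diffQuotient_iff {f : EuclideanSpace ℝ (Fin (d + 1)) → 𝕜}
    (hf : AEStronglyMeasurable f D.surfaceMeasure) :
    MemLp (diffQuotient f) 2 (D.surfaceMeasure.prod D.surfaceMeasure) ↔ D.seminormSq f ≠ ∞ := by
  rw [← D.lintegral_enorm_diffQuotient_sq hf]
  refine ⟨fun h => ?_, memLp_two_of_lintegral_ne_top (D.aestronglyMeasurable_diffQuotient hf)⟩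
  rw [← eLpNorm_two_sq]
  exact ENNReal.pow_ne_top h.2.ne

namespace SobolevHalf

variable {D}

theorem enorm_sq_eq (f : D.SobolevHalf 𝕜) :
    ‖f‖ₑ ^ 2 = ‖toL2 D 𝕜 f‖ₑ ^ 2 + D.seminormSq (toL2 D 𝕜 f) := by
  have h0 : ‖f‖ ^ 2 = ‖(graphMap D 𝕜 f).fst‖ ^ 2 + ‖(graphMap D 𝕜 f).snd‖ ^ 2 :=
    WithLp.prod_norm_sq_eq_of_L2 (graphMap D 𝕜 f)
  have h1 : ‖(graphMap D 𝕜 f).snd‖ₑ ^ 2 = D.seminormSq (toL2 D 𝕜 f) := by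
    rw [enorm_sq_eq_lintegral, ← D.lintegral_enorm_diffQuotient_sq (Lp.aestronglyMeasurable _)]
    refine lintegral_congr_ae ?_
    filter_upwards [MemLp.coeFn_toLp f.2] with z hz
    change ‖(MemLp.toLp (diffQuotient ⇑f.1) f.2) z‖ₑ ^ 2 = _
    rw [hz]; rfl
  rw [← h1]
  have h2 : (graphMap D 𝕜 f).fst = toL2 D 𝕜 f := rfl
  rw [← h2]
  simp only [← ofReal_norm]
  rw [← ENNReal.ofReal_pow (norm_nonneg _), ← ENNReal.ofReal_pow (norm_nonneg _),
    ← ENNReal.ofReal_pow (norm_nonneg _), h0, ENNReal.ofReal_add (by positivity) (by positivity)]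

theorem seminormSq_le (f : D.SobolevHalf 𝕜) : D.seminormSq (toL2 D 𝕜 f) ≤ ‖f‖ₑ ^ 2 := by
  rw [enorm_sq_eq]; exact le_add_self

instance : CompleteSpace (D.SobolevHalf 𝕜) := by
  have hiso : Isometry (graphMap D 𝕜) := AddMonoidHomClass.isometry_of_norm _ fun _ => rfl
  refine Metric.complete_of_cauchySeq_tendsto fun u hu => ?_
  obtain ⟨a, ha⟩ := cauchySeq_tendsto_of_complete
    (hiso.uniformContinuous.comp_cauchySeq hu)
  have h1 : Tendsto (fun n => toL2 D 𝕜 (u n)) atTop (𝓝 a.fst) :=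
    ((WithLp.prod_continuous_ofLp 2 _ _).fst.tendsto a).comp ha
  have h2 : Tendsto (fun n => (graphMap D 𝕜 (u n)).snd) atTop (𝓝 a.snd) :=
    ((WithLp.prod_continuous_ofLp 2 _ _).snd.tendsto a).comp ha
  obtain ⟨ns, hns, h3⟩ := (tendstoInMeasure_of_tendsto_Lp h1).exists_seq_tendsto_ae
  obtain ⟨ms, hms, h4⟩ := (tendstoInMeasure_of_tendsto_Lp
    (h2.comp hns.tendsto_atTop)).exists_seq_tendsto_ae
  have h5 : ∀ᵐ z ∂(D.surfaceMeasure.prod D.surfaceMeasure), ∀ n,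
      (graphMap D 𝕜 (u n)).snd z = diffQuotient (toL2 D 𝕜 (u n)) z :=
    ae_all_iff.2 fun n => MemLp.coeFn_toLp (u n).2
  have hae : diffQuotient ⇑a.fst =ᵐ[D.surfaceMeasure.prod D.surfaceMeasure] a.snd := by
    filter_upwards [Measure.quasiMeasurePreserving_fst.ae h3,
      Measure.quasiMeasurePreserving_snd.ae h3, h4, h5] with z hz1 hz2 hz3 hz4
    refine tendsto_nhds_unique ?_ hz3
    have : Tendsto (fun i => diffQuotient (toL2 D 𝕜 (u (ns (ms i)))) z) atTop
        (𝓝 (diffQuotient ⇑a.fst z)) :=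
      ((hz1.comp hms.tendsto_atTop).sub (hz2.comp hms.tendsto_atTop)).const_smul _
    refine this.congr fun i => ?_
    exact (hz4 _).symm
  have hmem : MemLp (diffQuotient ⇑a.fst) 2 (D.surfaceMeasure.prod D.surfaceMeasure) :=
    (memLp_congr_ae hae).2 (Lp.memLp a.snd)
  let f : D.SobolevHalf 𝕜 := ⟨a.fst, hmem⟩
  have hf : graphMap D 𝕜 f = a := by
    apply WithLp.ofLp_injective
    refine Prod.ext rfl ?_
    refine Lp.ext ?_
    exact (MemLp.coeFn_toLp hmem).trans hae
  refine ⟨f, hiso.isEmbedding.isInducing.tendsto_nhds_iff.2 ?_⟩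
  rw [hf]
  exact ha

end SobolevHalf

/-! ### The compact embedding of `H^{1/2}` in `L²` -/

theorem enorm_sub_average_sq_le {X : Type*} [MeasurableSpace X] {μ : Measure X} [IsFiniteMeasure μ]
    (f : Lp 𝕜 2 μ) (x : X) {s : Set X} (hs0 : μ s ≠ 0) :
    ‖f x - (μ.real s)⁻¹ • ∫ y in s, f y ∂μ‖ₑ ^ 2 ≤
      (μ s)⁻¹ * ∫⁻ y in s, ‖f x - f y‖ₑ ^ 2 ∂μ := by
  have hst : μ s ≠ ∞ := measure_ne_top _ _
  have hr : μ.real s ≠ 0 := (ENNReal.toReal_pos hs0 hst).ne'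
  have hfi : IntegrableOn f s μ := ((Lp.memLp f).integrable one_le_two).integrableOn
  have e : f x - (μ.real s)⁻¹ • ∫ y in s, f y ∂μ = (μ.real s)⁻¹ • ∫ y in s, (f x - f y) ∂μ := by
    rw [integral_sub (integrable_const _) hfi, setIntegral_const, smul_sub, smul_smul,
      inv_mul_cancel₀ hr, one_smul]
  have hm : AEMeasurable (fun y => ‖f x - f y‖ₑ) (μ.restrict s) :=
    (aestronglyMeasurable_const.sub hfi.aestronglyMeasurable).enorm
  have hcs := sq_lintegral_mul_le (μ := μ.restrict s) (aemeasurable_const (b := 1)) hm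
  simp only [one_mul, one_pow, lintegral_const, Measure.restrict_apply_univ] at hcs
  have hinv : ‖(μ.real s)⁻¹‖ₑ = (μ s)⁻¹ := by
    rw [Real.enorm_of_nonneg (by positivity), ENNReal.ofReal_inv_of_pos
      (lt_of_le_of_ne measureReal_nonneg hr.symm),
      ofReal_measureReal]
  rw [e, enorm_smul, mul_pow, hinv]
  calc (μ s)⁻¹ ^ 2 * ‖∫ y in s, (f x - f y) ∂μ‖ₑ ^ 2
      ≤ (μ s)⁻¹ ^ 2 * (μ s * ∫⁻ y in s, ‖f x - f y‖ₑ ^ 2 ∂μ) := by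
        gcongr
        exact (pow_le_pow_left₀ zero_le (enorm_integral_le_lintegral_enorm _) 2).trans hcs
    _ = (μ s)⁻¹ * ((μ s)⁻¹ * μ s) * ∫⁻ y in s, ‖f x - f y‖ₑ ^ 2 ∂μ := by ring
    _ = _ := by rw [ENNReal.inv_mul_cancel hs0 hst, mul_one]

/-- On a ball the distance to the average is controlled by the Gagliardo seminorm. The lower
Ahlfors regularity of the surface measure enters here. -/
theorem exists_enorm_sub_average_sq_le :
    ∃ δ > 0, ∃ C ≥ 0, ∀ ρ > 0, ρ < δ → ∀ p ∈ frontier D.carrier,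
      D.surfaceMeasure (Metric.closedBall p ρ) ≠ 0 ∧ ∀ (f : D.L2 𝕜), ∀ x ∈ Metric.closedBall p ρ,
        ‖f x - (D.surfaceMeasure.real (Metric.closedBall p ρ))⁻¹ •
            ∫ y in Metric.closedBall p ρ, f y ∂D.surfaceMeasure‖ₑ ^ 2 ≤
          ENNReal.ofReal (C * ρ) *
            ∫⁻ y, distPow (-(d + 1)) x y * ‖f x - f y‖ₑ ^ 2 ∂D.surfaceMeasure := by
  obtain ⟨δ, hδ, K, hK, hlow⟩ := D.exists_lowerRegular
  refine ⟨δ, hδ, 2 ^ (d + 1) * K, by positivity, fun ρ hρ hρδ p hp => ?_⟩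
  set σ := D.surfaceMeasure with hσ
  have hl := hlow p hp ρ hρ hρδ
  have h0 : σ (Metric.closedBall p ρ) ≠ 0 := fun h => by
    rw [h, mul_zero] at hl
    exact absurd hl (not_le.2 (ENNReal.ofReal_pos.2 (by positivity)))
  refine ⟨h0, fun f x hx => (enorm_sub_average_sq_le f x h0).trans ?_⟩
  have hpt : ∀ y ∈ Metric.closedBall p ρ, ‖f x - f y‖ₑ ^ 2 ≤
      ENNReal.ofReal ((2 * ρ) ^ (d + 1)) * (distPow (-(d + 1)) x y * ‖f x - f y‖ₑ ^ 2) := by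
    intro y hy
    rcases eq_or_ne x y with rfl | hxy
    · simp
    have hpos : 0 < ‖x - y‖ := norm_pos_iff.2 (sub_ne_zero.2 hxy)
    have hle : ‖x - y‖ ≤ 2 * ρ := by
      rw [← dist_eq_norm]
      have := dist_triangle_right x y p
      rw [Metric.mem_closedBall] at hx hy
      linarith
    rw [← mul_assoc]
    refine le_mul_of_one_le_left' ?_
    rw [distPow, ← ENNReal.ofReal_mul (by positivity), ENNReal.one_le_ofReal,
      Real.rpow_neg hpos.le, ← div_eq_mul_inv, one_le_div (by positivity)]
    have : ‖x - y‖ ^ ((d : ℝ) + 1) = ‖x - y‖ ^ (d + 1) := by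
      rw [← Real.rpow_natCast]; push_cast; rfl
    rw [this]
    gcongr
  have hsplit : ENNReal.ofReal ((2 * ρ) ^ (d + 1)) ≤
      ENNReal.ofReal (2 ^ (d + 1) * K * ρ) * σ (Metric.closedBall p ρ) := by
    calc ENNReal.ofReal ((2 * ρ) ^ (d + 1))
        = ENNReal.ofReal (2 ^ (d + 1) * ρ) * ENNReal.ofReal (ρ ^ d) := by
          rw [← ENNReal.ofReal_mul (by positivity)]; congr 1; ring
      _ ≤ ENNReal.ofReal (2 ^ (d + 1) * ρ) * (ENNReal.ofReal K * σ (Metric.closedBall p ρ)) := by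
          gcongr
      _ = _ := by
          rw [← mul_assoc, ← ENNReal.ofReal_mul (by positivity)]; congr 2; ring
  calc (σ (Metric.closedBall p ρ))⁻¹ * ∫⁻ y in Metric.closedBall p ρ, ‖f x - f y‖ₑ ^ 2 ∂σ
      ≤ (σ (Metric.closedBall p ρ))⁻¹ * ∫⁻ y in Metric.closedBall p ρ,
          ENNReal.ofReal ((2 * ρ) ^ (d + 1)) *
            (distPow (-(d + 1)) x y * ‖f x - f y‖ₑ ^ 2) ∂σ := by
        gcongr 1
        exact setLIntegral_mono' measurableSet_closedBall hpt
    _ ≤ (σ (Metric.closedBall p ρ))⁻¹ * (ENNReal.ofReal ((2 * ρ) ^ (d + 1)) * ∫⁻ y,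
            (distPow (-(d + 1)) x y * ‖f x - f y‖ₑ ^ 2) ∂σ) := by
        rw [lintegral_const_mul' _ _ ENNReal.ofReal_ne_top]
        gcongr
        exact Measure.restrict_le_self
    _ ≤ (σ (Metric.closedBall p ρ))⁻¹ * (ENNReal.ofReal (2 ^ (d + 1) * K * ρ) *
          σ (Metric.closedBall p ρ) * ∫⁻ y,
            (distPow (-(d + 1)) x y * ‖f x - f y‖ₑ ^ 2) ∂σ) := by
        gcongr
    _ = (σ (Metric.closedBall p ρ))⁻¹ * σ (Metric.closedBall p ρ) *
          (ENNReal.ofReal (2 ^ (d + 1) * K * ρ) * ∫⁻ y,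
            (distPow (-(d + 1)) x y * ‖f x - f y‖ₑ ^ 2) ∂σ) := by ring
    _ = _ := by rw [ENNReal.inv_mul_cancel h0 (measure_ne_top _ _), one_mul]

/-- Rellich's theorem: functions in `H^{1/2}` are approximated by their averages over finitely many
small balls. -/
theorem isFinitelyControlled_toL2 : IsFinitelyControlled (SobolevHalf.toL2 D 𝕜) := by
  intro ε hε
  obtain ⟨δ, hδ, C, hC, h⟩ := D.exists_enorm_sub_average_sq_le (𝕜 := 𝕜)
  set σ := D.surfaceMeasure with hσ
  obtain ⟨ρ, hρ, hρδ, hρε⟩ : ∃ ρ > 0, ρ < δ ∧ 4 * (C * ρ) ≤ ε ^ 2 := by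
    refine ⟨min (δ / 2) (ε ^ 2 / (4 * (C + 1))), by positivity,
      (min_le_left _ _).trans_lt (by linarith), ?_⟩
    calc 4 * (C * min (δ / 2) (ε ^ 2 / (4 * (C + 1))))
        ≤ 4 * ((C + 1) * (ε ^ 2 / (4 * (C + 1)))) := by
          gcongr
          · linarith
          · exact min_le_right _ _
      _ = ε ^ 2 := by field_simp
  obtain ⟨t, htS, htf, htc⟩ := D.isCompact_frontier.finite_cover_balls hρ
  obtain ⟨n, p, hp⟩ := htf.fin_param
  have hpS : ∀ i, p i ∈ frontier D.carrier := fun i => htS (hp.2 ▸ mem_range_self i)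
  let a : Fin n → D.L2 𝕜 →L[𝕜] 𝕜 := fun i =>
    ((σ.real (Metric.closedBall (p i) ρ))⁻¹ : ℝ) •
      innerSL 𝕜 (indicatorConstLp 2 (measurableSet_closedBall (x := p i) (ε := ρ))
        (measure_ne_top σ _) (1 : 𝕜))
  have ha : ∀ i f, a i f = (σ.real (Metric.closedBall (p i) ρ))⁻¹ •
      ∫ y in Metric.closedBall (p i) ρ, f y ∂σ := fun i f => by
    change (σ.real (Metric.closedBall (p i) ρ))⁻¹ • inner 𝕜 (indicatorConstLp 2 _ _ (1 : 𝕜)) f = _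
    rw [L2.inner_indicatorConstLp_one]
  let S : D.L2 𝕜 →L[𝕜] (Fin n → 𝕜) := ContinuousLinearMap.pi a
  have hSa : ∀ i f, ‖a i f‖ ≤ ‖S f‖ := fun i f => norm_le_pi_norm (S f) i
  set M : ℝ := 4 * σ.real univ with hM
  have hM0 : 0 ≤ M := by positivity
  refine ⟨n, (√M : ℝ) • S.comp (SobolevHalf.toL2 D 𝕜), fun f => ?_⟩
  set g := SobolevHalf.toL2 D 𝕜 f with hg
  have hpt : ∀ᵐ x ∂σ, ‖g x‖ₑ ^ 2 ≤ 4 * (ENNReal.ofReal (C * ρ) *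
      ∫⁻ y, distPow (-(d + 1)) x y * ‖g x - g y‖ₑ ^ 2 ∂σ) + 4 * ‖S g‖ₑ ^ 2 := by
    filter_upwards [D.ae_mem_frontier] with x hx
    obtain ⟨z, hz, hxz⟩ := mem_iUnion₂.1 (htc hx)
    obtain ⟨i, rfl⟩ : z ∈ range p := by rw [hp.2]; exact hz
    have h1 := (h ρ hρ hρδ (p i) (hpS i)).2 g x (Metric.ball_subset_closedBall hxz)
    rw [← ha i g] at h1
    calc ‖g x‖ₑ ^ 2 = ‖(g x - a i g) + a i g‖ₑ ^ 2 := by rw [sub_add_cancel]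
      _ ≤ (‖g x - a i g‖ₑ + ‖a i g‖ₑ) ^ 2 := by gcongr; exact enorm_add_le _ _
      _ ≤ 4 * (‖g x - a i g‖ₑ ^ 2 + ‖a i g‖ₑ ^ 2) := add_sq_le_four_mul _ _
      _ ≤ _ := by
        rw [mul_add]
        gcongr
        exact enorm_le_iff_norm_le.2 (hSa i g)
  have hint : ‖g‖ₑ ^ 2 ≤ ENNReal.ofReal (ε ^ 2) * ‖f‖ₑ ^ 2 + ENNReal.ofReal M * ‖S g‖ₑ ^ 2 := by
    rw [enorm_sq_eq_lintegral]
    refine (lintegral_mono_ae hpt).trans ?_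
    rw [lintegral_add_right _ measurable_const, lintegral_const]
    refine add_le_add ?_ (le_of_eq ?_)
    · rw [lintegral_const_mul' _ _ (by norm_num), lintegral_const_mul' _ _ ENNReal.ofReal_ne_top,
        ← mul_assoc]
      refine mul_le_mul' ?_ (SobolevHalf.seminormSq_le f)
      rw [show (4 : ℝ≥0∞) = ENNReal.ofReal 4 by norm_num, ← ENNReal.ofReal_mul (by norm_num)]
      exact ENNReal.ofReal_le_ofReal hρε
    · rw [hM, ENNReal.ofReal_mul (by norm_num), ofReal_measureReal,
        show (4 : ℝ≥0∞) = ENNReal.ofReal 4 by norm_num]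
      ring
  have := norm_le_of_enorm_sq_le (sq_nonneg ε) hM0 hint
  rw [Real.sqrt_sq hε.le] at this
  refine this.trans_eq ?_
  congr 1
  change _ = ‖√M • S g‖
  rw [norm_smul, Real.norm_of_nonneg (Real.sqrt_nonneg _)]

end C1HolderDomain

/-! ### The operator `K` on `H^{1/2}` -/

namespace C1HolderDomain

variable {d : ℕ} {α : ℝ} (D : C1HolderDomain d α) {𝕜 : Type*} [RCLike 𝕜]

/-- The weaker weight `|x - t| ^ (2 α - d - 1)` costs a small multiple of the Gagliardo seminorm,
from the pairs at distance at most `η`, and a multiple of the `L²` norm, from the others. -/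
theorem lintegral_distPow_le (hα : 0 < α) (hαd : 2 * α ≤ d + 1) {η : ℝ} (hη : 0 < η)
    (f : D.L2 𝕜) :
    ∫⁻ x, ∫⁻ t, distPow (2 * α - d - 1) x t * ‖f x - f t‖ₑ ^ 2 ∂D.surfaceMeasure
        ∂D.surfaceMeasure ≤
      ENNReal.ofReal (η ^ (2 * α)) * D.seminormSq f +
        ENNReal.ofReal (η ^ (2 * α - d - 1)) * (8 * D.surfaceMeasure univ) * ‖f‖ₑ ^ 2 := by
  set σ := D.surfaceMeasure with hσ
  have hf := Lp.stronglyMeasurable f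
  have hpt : ∀ x t, distPow (2 * α - d - 1) x t * ‖f x - f t‖ₑ ^ 2 ≤
      ENNReal.ofReal (η ^ (2 * α)) * (distPow (-(d + 1)) x t * ‖f x - f t‖ₑ ^ 2) +
        ENNReal.ofReal (η ^ (2 * α - d - 1)) * (4 * (‖f x‖ₑ ^ 2 + ‖f t‖ₑ ^ 2)) := by
    intro x t
    rcases eq_or_ne x t with rfl | hxt
    · simp
    have hpos : 0 < ‖x - t‖ := norm_pos_iff.2 (sub_ne_zero.2 hxt)
    rcases le_total ‖x - t‖ η with h | h
    · refine le_add_right ?_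
      rw [← mul_assoc]
      refine mul_le_mul_left ?_ _
      have : distPow (2 * α - d - 1) x t = distPow (2 * α) x t * distPow (-(d + 1)) x t := by
        rw [distPow_mul hxt]; congr 1; ring
      rw [this]
      refine mul_le_mul_left (ENNReal.ofReal_le_ofReal ?_) _
      exact Real.rpow_le_rpow hpos.le h (by linarith)
    · refine le_add_left ?_
      refine mul_le_mul' (ENNReal.ofReal_le_ofReal ?_) ?_
      · exact Real.rpow_le_rpow_of_nonpos hη h (by linarith)
      · refine le_trans ?_ (add_sq_le_four_mul _ _)
        gcongr
        exact enorm_sub_le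
  have hm : Measurable fun z : EuclideanSpace ℝ (Fin (d + 1)) × EuclideanSpace ℝ (Fin (d + 1)) =>
      distPow (-(d + 1)) z.1 z.2 * ‖f z.1 - f z.2‖ₑ ^ 2 := by
    have h : Measurable fun z : EuclideanSpace ℝ (Fin (d + 1)) × EuclideanSpace ℝ (Fin (d + 1)) =>
      ‖f z.1 - f z.2‖ₑ :=
      ((hf.comp_measurable measurable_fst).sub (hf.comp_measurable measurable_snd)).enorm
    fun_prop
  have hfm : Measurable fun x => ‖f x‖ₑ ^ 2 := hf.enorm.pow_const 2
  calc ∫⁻ x, ∫⁻ t, distPow (2 * α - d - 1) x t * ‖f x - f t‖ₑ ^ 2 ∂σ ∂σ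
      ≤ ∫⁻ x, ∫⁻ t, (ENNReal.ofReal (η ^ (2 * α)) * (distPow (-(d + 1)) x t * ‖f x - f t‖ₑ ^ 2) +
        ENNReal.ofReal (η ^ (2 * α - d - 1)) * (4 * (‖f x‖ₑ ^ 2 + ‖f t‖ₑ ^ 2))) ∂σ ∂σ :=
        lintegral_mono fun x => lintegral_mono fun t => hpt x t
    _ = ∫⁻ x, (ENNReal.ofReal (η ^ (2 * α)) *
          (∫⁻ t, distPow (-(d + 1)) x t * ‖f x - f t‖ₑ ^ 2 ∂σ) +
        ENNReal.ofReal (η ^ (2 * α - d - 1)) *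
          (4 * (‖f x‖ₑ ^ 2 * σ univ + ∫⁻ t, ‖f t‖ₑ ^ 2 ∂σ))) ∂σ := by
        refine lintegral_congr fun x => ?_
        rw [lintegral_add_right _ (by fun_prop), lintegral_const_mul' _ _ ENNReal.ofReal_ne_top,
          lintegral_const_mul' _ _ ENNReal.ofReal_ne_top, lintegral_const_mul' _ _ (by norm_num),
          lintegral_add_left measurable_const, lintegral_const]
    _ = ENNReal.ofReal (η ^ (2 * α)) * D.seminormSq f +
        ENNReal.ofReal (η ^ (2 * α - d - 1)) *
          (4 * ((∫⁻ t, ‖f t‖ₑ ^ 2 ∂σ) * σ univ + (∫⁻ t, ‖f t‖ₑ ^ 2 ∂σ) * σ univ)) := by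
        rw [lintegral_add_left (hm.lintegral_prod_right'.const_mul _),
          lintegral_const_mul' _ _ ENNReal.ofReal_ne_top,
          lintegral_const_mul' _ _ ENNReal.ofReal_ne_top, lintegral_const_mul' _ _ (by norm_num),
          lintegral_add_right _ measurable_const, lintegral_mul_const _ hfm, lintegral_const]
        rfl
    _ = _ := by rw [← enorm_sq_eq_lintegral]; ring

/-- `K` maps `H^{1/2}` to itself, and its norm there is an arbitrarily small multiple of the `H^{1/2}`
norm, up to a multiple of the `L²` norm. -/
theorem exists_operator_sobolevHalf (hd : 1 ≤ d) (hα : 0 < α) (hα1 : α ≤ 1) {A B c : ℝ}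
    (hA : 0 ≤ A)
    (hk : IsDoubleLayerKernel D.surfaceMeasure (frontier D.carrier) d α A B c D.kernelK)
    {T : D.L2 𝕜 →L[𝕜] D.L2 𝕜}
    (hT : ∀ f, T f =ᵐ[D.surfaceMeasure] fun x => ∫ y, D.kernelK x y • f y ∂D.surfaceMeasure) :
    ∃ K : D.SobolevHalf 𝕜 →L[𝕜] D.SobolevHalf 𝕜,
      (∀ f, SobolevHalf.toL2 D 𝕜 (K f) = T (SobolevHalf.toL2 D 𝕜 f)) ∧
      ∀ ε > 0, ∃ C ≥ 0, ∀ f, ‖K f‖ ≤ ε * ‖f‖ + C * ‖SobolevHalf.toL2 D 𝕜 f‖ := by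
  have hd' : (1 : ℝ) ≤ d := by exact_mod_cast hd
  obtain ⟨C₀, hC₀, h₀⟩ := hk.exists_seminorm_le (F := 𝕜) hd hA hα (by linarith)
  have hle : ∀ η > 0, ∀ f : D.L2 𝕜, D.seminormSq (T f) ≤ C₀ *
      (ENNReal.ofReal (η ^ (2 * α)) * D.seminormSq f +
        ENNReal.ofReal (η ^ (2 * α - d - 1)) * (8 * D.surfaceMeasure univ) * ‖f‖ₑ ^ 2) := by
    intro η hη f
    rw [D.seminormSq_congr (hT f)]
    refine (h₀ f (Lp.stronglyMeasurable f) (lintegral_enorm_sq_ne_top f)).trans ?_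
    gcongr
    exact D.lintegral_distPow_le hα (by linarith) hη f
  have hmap : ∀ f ∈ D.sobolevHalfSubmodule 𝕜, T f ∈ D.sobolevHalfSubmodule 𝕜 := by
    intro f hf
    have hf' := (D.memLp_diffQuotient_iff (Lp.aestronglyMeasurable f)).1 hf
    refine (D.memLp_diffQuotient_iff (Lp.aestronglyMeasurable (T f))).2 ?_
    refine ne_top_of_le_ne_top ?_ (hle 1 one_pos f)
    have := measure_ne_top D.surfaceMeasure univ
    finiteness
  let K₀ : D.SobolevHalf 𝕜 →ₗ[𝕜] D.SobolevHalf 𝕜 := (T : D.L2 𝕜 →ₗ[𝕜] D.L2 𝕜).restrict hmap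
  have hK₀ : ∀ f, SobolevHalf.toL2 D 𝕜 (K₀ f) = T (SobolevHalf.toL2 D 𝕜 f) := fun _ => rfl
  have hbound : ∀ ε > 0, ∃ C ≥ 0, ∀ f, ‖K₀ f‖ ≤ ε * ‖f‖ + C * ‖SobolevHalf.toL2 D 𝕜 f‖ := by
    intro ε hε
    -- `η` is such that `C₀ η ^ (2 α) ≤ ε ^ 2`
    set η : ℝ := (ε ^ 2 / (C₀.toReal + 1)) ^ (2 * α)⁻¹ with hη
    have hC : 0 ≤ C₀.toReal := ENNReal.toReal_nonneg
    have hη0 : 0 < η := by positivity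
    have hη1 : η ^ (2 * α) = ε ^ 2 / (C₀.toReal + 1) := by
      rw [hη, ← Real.rpow_mul (by positivity), inv_mul_cancel₀ (by positivity), Real.rpow_one]
    have hη2 : C₀ * ENNReal.ofReal (η ^ (2 * α)) ≤ ENNReal.ofReal (ε ^ 2) := by
      rw [hη1, ← ENNReal.ofReal_toReal hC₀, ← ENNReal.ofReal_mul hC]
      refine ENNReal.ofReal_le_ofReal ?_
      rw [ENNReal.toReal_ofReal hC, ← mul_div_assoc, div_le_iff₀ (by positivity)]
      nlinarith [sq_nonneg ε]
    set q : ℝ≥0∞ := ‖T‖ₑ ^ 2 +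
      C₀ * (ENNReal.ofReal (η ^ (2 * α - d - 1)) * (8 * D.surfaceMeasure univ)) with hq
    have hqt : q ≠ ∞ := by
      have := measure_ne_top D.surfaceMeasure univ
      finiteness
    refine ⟨√q.toReal, Real.sqrt_nonneg _, fun f => ?_⟩
    have := norm_le_of_enorm_sq_le (u := K₀ f) (v := f) (w := SobolevHalf.toL2 D 𝕜 f)
      (sq_nonneg ε) (q := q.toReal) ENNReal.toReal_nonneg ?_
    · rwa [Real.sqrt_sq hε.le] at this
    rw [ENNReal.ofReal_toReal hqt, SobolevHalf.enorm_sq_eq, hK₀]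
    set g := SobolevHalf.toL2 D 𝕜 f with hg
    have h1 : ‖T g‖ₑ ^ 2 ≤ ‖T‖ₑ ^ 2 * ‖g‖ₑ ^ 2 := by
      rw [← mul_pow]; gcongr; exact T.le_opENorm g
    calc ‖T g‖ₑ ^ 2 + D.seminormSq (T g)
        ≤ ‖T‖ₑ ^ 2 * ‖g‖ₑ ^ 2 + C₀ * (ENNReal.ofReal (η ^ (2 * α)) * D.seminormSq g +
          ENNReal.ofReal (η ^ (2 * α - d - 1)) * (8 * D.surfaceMeasure univ) * ‖g‖ₑ ^ 2) :=
          add_le_add h1 (hle η hη0 g)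
      _ = C₀ * ENNReal.ofReal (η ^ (2 * α)) * D.seminormSq g + q * ‖g‖ₑ ^ 2 := by
          rw [hq]; ring
      _ ≤ _ := by
          gcongr
          exact SobolevHalf.seminormSq_le f
  refine ⟨K₀.mkContinuousOfExistsBound ?_, hK₀, hbound⟩
  obtain ⟨C, hC, h⟩ := hbound 1 one_pos
  refine ⟨1 + C * ‖SobolevHalf.toL2 D 𝕜‖, fun f => (h f).trans ?_⟩
  rw [add_mul, mul_assoc]
  gcongr
  exact (SobolevHalf.toL2 D 𝕜).le_opNorm f

theorem isFinitelyControlled_of_le {K : D.SobolevHalf 𝕜 →L[𝕜] D.SobolevHalf 𝕜}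
    (h : ∀ ε > 0, ∃ C ≥ 0, ∀ f, ‖K f‖ ≤ ε * ‖f‖ + C * ‖SobolevHalf.toL2 D 𝕜 f‖) :
    IsFinitelyControlled K := by
  intro ε hε
  obtain ⟨C, hC, hK⟩ := h (ε / 2) (by positivity)
  obtain ⟨n, S, hS⟩ := D.isFinitelyControlled_toL2 (𝕜 := 𝕜) (ε / (2 * (C + 1))) (by positivity)
  refine ⟨n, C • S, fun f => (hK f).trans ?_⟩
  have h1 : ‖(C • S) f‖ = C * ‖S f‖ := by
    change ‖C • S f‖ = _
    rw [norm_smul, Real.norm_of_nonneg hC]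
  have h2 : C * (ε / (2 * (C + 1))) ≤ ε / 2 := by
    rw [← mul_div_assoc, div_le_iff₀ (by positivity)]
    nlinarith
  rw [h1]
  calc ε / 2 * ‖f‖ + C * ‖SobolevHalf.toL2 D 𝕜 f‖
      ≤ ε / 2 * ‖f‖ + C * (ε / (2 * (C + 1)) * ‖f‖ + ‖S f‖) := by gcongr; exact hS f
    _ = ε / 2 * ‖f‖ + C * (ε / (2 * (C + 1))) * ‖f‖ + C * ‖S f‖ := by ring
    _ ≤ ε / 2 * ‖f‖ + ε / 2 * ‖f‖ + C * ‖S f‖ := by gcongr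
    _ = _ := by ring

end C1HolderDomain

end NeumannPoincare

end

theorem corollaryA2 (𝕜 : Type*) [RCLike 𝕜] (d : ℕ) (hd : 1 ≤ d) (α : ℝ) (hα : 0 < α) (hα1 : α ≤ 1)
    (D : NeumannPoincare.C1HolderDomain d α) :
    ∃ (K : D.SobolevHalf 𝕜 →L[𝕜] D.SobolevHalf 𝕜)
      (KStar : D.SobolevNegHalf 𝕜 →L[𝕜] D.SobolevNegHalf 𝕜),
      (∀ f : D.SobolevHalf 𝕜, D.IsK (NeumannPoincare.C1HolderDomain.SobolevHalf.toL2 D 𝕜 f)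
        (NeumannPoincare.C1HolderDomain.SobolevHalf.toL2 D 𝕜 (K f))) ∧
      (∀ g : D.L2 𝕜, ∃ h : D.L2 𝕜, D.IsKStar g h ∧ KStar (D.ofL2 𝕜 g) = D.ofL2 𝕜 h) ∧
      (∀ (φ : D.SobolevNegHalf 𝕜) (f : D.SobolevHalf 𝕜), KStar φ f = φ (K f)) ∧
      IsCompactOperator K ∧ IsCompactOperator KStar := by
  have hαd : α ≤ d := hα1.trans (by exact_mod_cast hd)
  obtain ⟨A, hA, B, c, hk⟩ := D.exists_isDoubleLayerKernel hd hα hαd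
  have hkS := NeumannPoincare.C1HolderDomain.isWeaklySingularKernel_kernelKStar
    hk.toIsWeaklySingularKernel
  obtain ⟨T, hT⟩ := hk.exists_operator (𝕜 := 𝕜) hd hA hα hαd
  obtain ⟨TStar, hTS⟩ := hkS.exists_operator (𝕜 := 𝕜) hd hA hα hαd
  obtain ⟨K, hK, hbound⟩ := D.exists_operator_sobolevHalf hd hα hα1 hA hk hT
  have hKc := (D.isFinitelyControlled_of_le hbound).isCompactOperator
  refine ⟨K, K.precomp 𝕜, fun f => ?_, fun g => ⟨TStar g, ?_, ?_⟩, fun φ f => rfl, hKc,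
    (NeumannPoincare.isFinitelyControlled_precomp hKc).isCompactOperator⟩
  · filter_upwards [D.ae_hasPrincipalValue hk.toIsWeaklySingularKernel hd hA hα hαd
      (NeumannPoincare.C1HolderDomain.SobolevHalf.toL2 D 𝕜 f), hT _] with x hx hx'
    rw [hK, hx']
    exact hx
  · filter_upwards [D.ae_hasPrincipalValue hkS hd hA hα hαd g, hTS g] with x hx hx'
    rw [hx']
    exact hx
  · ext f
    change D.ofL2 𝕜 g (K f) = _
    rw [D.ofL2_apply, D.ofL2_apply, hK]
    have h1 := hk.integral_mul_integral_smul hd hA hα hαd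
      (NeumannPoincare.C1HolderDomain.SobolevHalf.toL2 D 𝕜 f) g
    calc ∫ x, g x * T (NeumannPoincare.C1HolderDomain.SobolevHalf.toL2 D 𝕜 f) x ∂D.surfaceMeasure
        = ∫ x, g x * ∫ y, D.kernelK x y •
            NeumannPoincare.C1HolderDomain.SobolevHalf.toL2 D 𝕜 f y ∂D.surfaceMeasure
            ∂D.surfaceMeasure := by
          refine integral_congr_ae ?_
          filter_upwards [hT (NeumannPoincare.C1HolderDomain.SobolevHalf.toL2 D 𝕜 f)] with x hx
          rw [hx]
      _ = _ := h1
      _ = _ := by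
          refine integral_congr_ae ?_
          filter_upwards [hTS g] with y hy
          rw [hy]
          simp only [D.kernelKStar_eq]
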